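/- Let $a<b$, $T>0$, $\beta\in\mathbb R$, let $q\ge 1$ be an integer, and write $I=(a,b)$. Consider a smooth pair $(u,w)$ on $\mathbb R\times[0,T]$, complex valued and $(b-a)$-periodic in $x$, solving $$ i u_t=-w_{xx}-uF'(|u|^2),\qquad w=u_{xx},\qquad 0\le t\le T, $$ where $F:\mathbb R\to\mathbb R$ is $C^3$ with locally Lipschitz third derivative. **Scheme.** For a mesh $a=x_{1/2}<x_{3/2}<\dots<x_{n+1/2}=b$ with cells $I_j=(x_{j-1/2},x_{j+1/2})$, put $h=\max_j|I_j|$ and assume $h/\min_j|I_j|<\beta$. Let $V_h^q$ be the space of complex functions that are polynomials of degree at most $q$ on each cell; $v^-$ and $v^+$ are the limits at a node from the left and from the right, where the nodes $a$ and $b$ are identified. Functions $u_h(\cdot,t),w_h(\cdot,t)\in V_h^q$, $0\le t\le T$, with $u_h$ differentiable in time, solve the DG scheme with the alternating fluxes $\widehat u=u_h^+$, $\widehat{u_x}=u_{hx}^+$, $\widetilde w=w_h^-$, $\widetilde{w_x}=w_{hx}^-$ if for all $t\in[0,T]$, all $j$ and all polynomials $\phi,\psi$ of degree at most $q$ $$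 \int_{I_j} i u_{ht}\phi+w_h\phi_{xx}+u_hF'(|u_h|^2)\phi\,dx=-\widetilde{w_x}\phi^-\big|_{j+\frac12}+\widetilde{w_x}\phi^+\big|_{j-\frac12}+\widetilde w\phi_x^-\big|_{j+\frac12}-\widetilde w\phi_x^+\big|_{j-\frac12}, $$ $$ \int_{I_j} w_h\psi-u_h\psi_{xx}\,dx=\widehat{u_x}\psi^-\big|_{j+\frac12}-\widehat{u_x}\psi^+\big|_{j-\frac12}-\widehat u\psi_x^-\big|_{j+\frac12}+\widehat u\psi_x^+\big|_{j-\frac12}. $$ The initial values $(u_h,w_h)(\cdot,0)$ are the DG approximation of the steady problem $iu+u_{xxxx}=iu_0+u_{0xxxx}$, $u_0=u(\cdot,0)$: they satisfy the second equation above, and the first one with $iu_{ht}+u_hF'(|u_h|^2)$ replaced by $iu_h-(iu_0+u_{0xxxx})$. **Theorem.** Let $K\in\mathbb R$ and $M:\mathbb R\to\mathbb R$ be given. There are constants $C>0$ and $h_0>0$, depending only on $q,T,a,b,\beta,K,M$, such that the following holds whenever all derivatives of $u$ in $(x,t)$ of order at most $q+5$ are bounded by $K$ (in operator norm) and $F',F'',F'''$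 and the Lipschitz constant of $F'''$ are bounded by $M(R)$ on $[0,R]$ for every $R$ (thus $M$ may be constant if $F'\in W^{3,\infty}$). For every mesh and every DG solution as above, the errors $e_u=u-u_h$, $e_w=w-w_h$, $e_{u_t}=u_t-u_{ht}$ satisfy, for all $t\in[0,T]$, in particular for $t=T$, $$ \|e_u(t)\|_{L^2(I)}+\|e_w(t)\|_{L^2(I)}+\|e_{u_t}(t)\|_{L^2(I)}\le C h^{q+1}. $$ Moreover, if $h\le h_0$, then $\|e_u(t)\|_{L^2(I)}+\|e_{u_t}(t)\|_{L^2(I)}\le h$ for all $t\in[0,T]$. -/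

import Mathlib

open Set
open scoped Polynomial ContDiff

noncomputable section

/-- A mesh of `[a, b]` with `n` cells: `node 0 = a < node 1 < ... < node n = b`.
Cell `j : Fin n` is the interval between `node j.castSucc` and `node j.succ`. -/
structure Mesh (a b : ℝ) (n : ℕ) where
  node : Fin (n + 1) → ℝ
  strictMono : StrictMono node
  node_zero : node 0 = a
  node_last : node (Fin.last n) = b

namespace Mesh

variable {a b : ℝ} {n : ℕ}

/-- Left end point of cell `j`. -/
def left (m : Mesh a b n) (j : Fin n) : ℝ := m.node j.castSucc

/-- Right end point of cell `j`. -/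
def right (m : Mesh a b n) (j : Fin n) : ℝ := m.node j.succ

/-- Length of cell `j`. -/
def len (m : Mesh a b n) (j : Fin n) : ℝ := m.right j - m.left j

/-- The mesh size `h`, the largest cell length. -/
def h (m : Mesh a b n) : ℝ := ⨆ j, m.len j

/-- The smallest cell length. -/
def hmin (m : Mesh a b n) : ℝ := ⨅ j, m.len j

end Mesh

/-- A piecewise polynomial function on a mesh with `n` cells: one complex polynomial per cell.
One-sided limits at a node are values of the polynomial of the adjacent cell. -/
abbrev PiecewisePoly (n : ℕ) := Fin n → ℂ[X]

/-- Membership in the discontinuous Galerkin space `V_h^q`. -/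
def InVh {n : ℕ} (q : ℕ) (v : PiecewisePoly n) : Prop := ∀ j, (v j).natDegree ≤ q

section Scheme

variable {a b : ℝ} {n : ℕ} [NeZero n]

/-! The alternating fluxes. Index `j` stands for the right end point of cell `j`, so that the left
end point of cell `j` has index `j - 1`. Addition in `Fin n` is cyclic, which identifies the two
end points of `[a, b]` (periodic boundary conditions). -/

/-- The flux of `u`: the limit of `u_h` from the right. -/
def fluxU (m : Mesh a b n) (u : PiecewisePoly n) (j : Fin n) : ℂ :=
  (u (j + 1)).eval (m.left (j + 1) : ℂ)

/-- The flux of `u_x`: the limit of `(u_h)_x` from the right. -/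
def fluxUx (m : Mesh a b n) (u : PiecewisePoly n) (j : Fin n) : ℂ :=
  (u (j + 1)).derivative.eval (m.left (j + 1) : ℂ)

/-- The flux of `w`: the limit of `w_h` from the left. -/
def fluxW (m : Mesh a b n) (w : PiecewisePoly n) (j : Fin n) : ℂ :=
  (w j).eval (m.right j : ℂ)

/-- The flux of `w_x`: the limit of `(w_h)_x` from the left. -/
def fluxWx (m : Mesh a b n) (w : PiecewisePoly n) (j : Fin n) : ℂ :=
  (w j).derivative.eval (m.right j : ℂ)

/-- Boundary terms of the first equation on cell `j`, for the test polynomial `φ`. -/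
def boundary1 (m : Mesh a b n) (w : PiecewisePoly n) (φ : ℂ[X]) (j : Fin n) : ℂ :=
  -fluxWx m w j * φ.eval (m.right j : ℂ) + fluxWx m w (j - 1) * φ.eval (m.left j : ℂ)
    + fluxW m w j * φ.derivative.eval (m.right j : ℂ)
    - fluxW m w (j - 1) * φ.derivative.eval (m.left j : ℂ)

/-- Boundary terms of the second equation on cell `j`, for the test polynomial `ψ`. -/
def boundary2 (m : Mesh a b n) (u : PiecewisePoly n) (ψ : ℂ[X]) (j : Fin n) : ℂ :=
  fluxUx m u j * ψ.eval (m.right j : ℂ) - fluxUx m u (j - 1) * ψ.eval (m.left j : ℂ)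
    - fluxU m u j * ψ.derivative.eval (m.right j : ℂ)
    + fluxU m u (j - 1) * ψ.derivative.eval (m.left j : ℂ)

/-- The discrete version of `w = u_xx` (second equation of the scheme). -/
def SecondEq (m : Mesh a b n) (q : ℕ) (u w : PiecewisePoly n) : Prop :=
  ∀ (j : Fin n) (ψ : ℂ[X]), ψ.natDegree ≤ q →
    ∫ x in m.left j..m.right j,
        ((w j).eval (x : ℂ) * ψ.eval (x : ℂ)
          - (u j).eval (x : ℂ) * ψ.derivative.derivative.eval (x : ℂ))
      = boundary2 m u ψ j

/-- `(u, w)` is the DG approximation of the steady problem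
`i u + u_xxxx = i u₀ + (u₀)_xxxx`, `w = u_xx`, with periodic boundary conditions. -/
structure IsSteadyDG (m : Mesh a b n) (q : ℕ) (u₀ : ℝ → ℂ) (u w : PiecewisePoly n) : Prop where
  mem_u : InVh q u
  mem_w : InVh q w
  eq1 : ∀ (j : Fin n) (φ : ℂ[X]), φ.natDegree ≤ q →
    ∫ x in m.left j..m.right j,
        (Complex.I * (u j).eval (x : ℂ) * φ.eval (x : ℂ)
          + (w j).eval (x : ℂ) * φ.derivative.derivative.eval (x : ℂ)
          - (Complex.I * u₀ x + iteratedDeriv 4 u₀ x) * φ.eval (x : ℂ))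
      = boundary1 m w φ j
  eq2 : SecondEq m q u w

/-- `(uh, wh)` is a solution on `[0, T]` of the semi-discrete DG scheme for
`i u_t + w_xx + u F'(|u|²) = 0`, `w = u_xx`, and `uht` is the time derivative of `uh`. -/
structure IsDGSolution (m : Mesh a b n) (q : ℕ) (T : ℝ) (F : ℝ → ℝ)
    (uh uht wh : ℝ → PiecewisePoly n) : Prop where
  mem_u : ∀ t ∈ Icc 0 T, InVh q (uh t)
  mem_w : ∀ t ∈ Icc 0 T, InVh q (wh t)
  time_deriv : ∀ t ∈ Icc 0 T, ∀ (j : Fin n) (k : ℕ),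
    HasDerivWithinAt (fun s => (uh s j).coeff k) ((uht t j).coeff k) (Icc 0 T) t
  eq1 : ∀ t ∈ Icc 0 T, ∀ (j : Fin n) (φ : ℂ[X]), φ.natDegree ≤ q →
    ∫ x in m.left j..m.right j,
        (Complex.I * (uht t j).eval (x : ℂ) * φ.eval (x : ℂ)
          + (wh t j).eval (x : ℂ) * φ.derivative.derivative.eval (x : ℂ)
          + (uh t j).eval (x : ℂ) * ((deriv F (‖(uh t j).eval (x : ℂ)‖ ^ 2) : ℝ) : ℂ)
              * φ.eval (x : ℂ))
      = boundary1 m (wh t) φ j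
  eq2 : ∀ t ∈ Icc 0 T, SecondEq m q (uh t) (wh t)

end Scheme

/-- The `L²(a, b)` norm of `g - v` for a function `g` and a piecewise polynomial `v`. -/
def l2Error {a b : ℝ} {n : ℕ} (m : Mesh a b n) (g : ℝ → ℂ) (v : PiecewisePoly n) : ℝ :=
  Real.sqrt (∑ j, ∫ x in m.left j..m.right j, ‖g x - (v j).eval (x : ℂ)‖ ^ 2)

/-- The time derivative `u_t(·, t)` on the time interval `[0, T]` (one-sided at its ends). -/
def timeDeriv (T : ℝ) (u : ℝ → ℝ → ℂ) (t x : ℝ) : ℂ :=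
  derivWithin (fun s => u s x) (Icc 0 T) t

/-- `(u, w)` (time is the first argument) is a smooth solution, periodic in space with period
`b - a`, of `i u_t = -w_xx - u F'(|u|²)`, `w = u_xx` for `0 ≤ t ≤ T`. -/
structure IsSmoothSolution (a b T : ℝ) (F : ℝ → ℝ) (u w : ℝ → ℝ → ℂ) : Prop where
  smooth : ContDiffOn ℝ ∞ (fun p : ℝ × ℝ => u p.1 p.2) (Icc 0 T ×ˢ univ)
  periodic : ∀ t ∈ Icc 0 T, Function.Periodic (u t) (b - a)
  eq1 : ∀ t ∈ Icc 0 T, ∀ x : ℝ,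
    Complex.I * timeDeriv T u t x
      = -iteratedDeriv 2 (w t) x - u t x * ((deriv F (‖u t x‖ ^ 2) : ℝ) : ℂ)
  eq2 : ∀ t ∈ Icc 0 T, ∀ x : ℝ, w t x = iteratedDeriv 2 (u t) x

/-- All derivatives of `u` of order at most `r` in `(t, x)` are bounded by `K` on `[0, T] × ℝ`. -/
def DerivBound (T : ℝ) (r : ℕ) (K : ℝ) (u : ℝ → ℝ → ℂ) : Prop :=
  ∀ k ≤ r, ∀ p ∈ Icc 0 T ×ˢ (univ : Set ℝ),
    ‖iteratedFDerivWithin ℝ k (fun p : ℝ × ℝ => u p.1 p.2) (Icc 0 T ×ˢ univ) p‖ ≤ K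

/-- The `W^{3,∞}(0, R)` norm of `F'` is at most `M R`, for every `R`: the derivatives of orders
1, 2, 3 of `F` are bounded and the third one is Lipschitz. A constant `M` amounts to a bound for
the `W^{3,∞}` norm of `F'` on the whole half line. -/
structure NonlinearityBound (F : ℝ → ℝ) (M : ℝ → ℝ) : Prop where
  contDiff : ContDiff ℝ 3 F
  bound : ∀ R : ℝ, ∀ y ∈ Icc 0 R, ∀ k ∈ Icc 1 3, |iteratedDeriv k F y| ≤ M R
  lipschitz : ∀ R : ℝ, ∀ y ∈ Icc 0 R, ∀ z ∈ Icc 0 R,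
    |iteratedDeriv 3 F y - iteratedDeriv 3 F z| ≤ M R * |y - z|

end

/-!
Error estimate for the semi-discrete ultra-weak discontinuous Galerkin scheme with alternating
fluxes for `i u_t + u_xxxx + u F'(|u|²) = 0`.

The alternating fluxes make the form of the first equation the transpose of the form of the second
(`dgForm_eq_first`). Hence the scheme has the structure `i U' + S U + N(U) = 0` with `S` symmetric
and nonnegative, and `⟪U, S U⟫ = ‖W‖²` for the discrete second derivative `W` of `U`
(`dgForm_conjPP_self`). In particular the steady problem `i u + u_xxxx = f` is stable and uniquely
solvable in the discrete space (`SteadyDG.norm_le`, `exists_steadyDG`). Local projections that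
interpolate value and slope at the end point where the flux is taken are consistent with the scheme
without error, so the steady approximation has an error of order `h ^ (q + 1)`
(`SteadyDG.error_le`).

The discrete solution `U` is compared with the steady approximation `R` of the exact solution,
rather than with a local projection: the second equation then holds exactly for `θ = U - R`, the
initial error vanishes, and the energy identity `i ⟪θ, θ'⟫ + ‖ζ‖² = ⟪θ, r⟫`, with `ζ` the error of
`W`, contains no term that would require control of `ζ`. Its imaginary part and Gronwall's
inequality bound `θ`. The same argument for time increments of `θ` shows that `θ` is Lipschitz in
time with a constant of order `h ^ (q + 1)`, which bounds `θ'`; the real part of the identity then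
bounds `ζ` (`norm_le_of_energy_identities`). Increments of the nonlinear term are handled by
`IncrementLipschitz`.

These estimates need a pointwise bound of `U`. On fine meshes it comes from the inverse inequality
and a continuation argument (`norm_eval_le_add_one`, `le_of_bootstrap`). On coarse meshes the
scheme does not increase the `L²` norm (`IsDGSolution.norm_le`), and the inverse inequality turns
this into a bound that depends only on the threshold for the mesh size.
-/

noncomputable section

open Filter Topology MeasureTheory Complex
open scoped InnerProductSpace ComplexConjugate

/-! ### Energy estimates for curves in a complex inner product space -/

/-- A curve that is Lipschitz on an interval has a derivative bounded by the Lipschitz constant,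
also at the end points. -/
theorem HasDerivWithinAt.norm_le_of_lipschitz {H : Type*} [NormedAddCommGroup H]
    [NormedSpace ℝ H] {θ : ℝ → H} {v : H} {T C t : ℝ} (hT : 0 < T)
    (ht : t ∈ Icc 0 T) (hd : HasDerivWithinAt θ v (Icc 0 T) t)
    (hl : ∀ s ∈ Icc 0 T, ‖θ s - θ t‖ ≤ C * |s - t|) : ‖v‖ ≤ C := by
  have hne : (𝓝[Icc 0 T \ {t}] t).NeBot := by
    have := uniqueDiffOn_Icc hT t ht
    rw [← accPt_principal_iff_nhdsWithin]
    exact this.accPt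
  rw [hasDerivWithinAt_iff_tendsto_slope] at hd
  refine le_of_tendsto hd.norm ?_
  filter_upwards [self_mem_nhdsWithin] with s hs
  have hst : 0 < |s - t| := abs_pos.2 (sub_ne_zero.2 hs.2)
  rw [slope_def_module, norm_smul, norm_inv, Real.norm_eq_abs, inv_mul_le_iff₀ hst]
  linarith [hl s hs.1]

section Energy

variable {H : Type*} [NormedAddCommGroup H] [InnerProductSpace ℂ H] [NormedSpace ℝ H]

/-- A Gronwall inequality for the norm. The norm need not be differentiable where it vanishes, so
the proof differentiates `√(‖θ‖² + η²)` with a small `η > 0` instead. -/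
theorem norm_le_of_re_inner_le {θ θ' : ℝ → H} {τ A L : ℝ} (hA : 0 ≤ A) (hL : 0 ≤ L)
    (hd : ∀ t ∈ Icc 0 τ, HasDerivWithinAt θ (θ' t) (Icc 0 τ) t)
    (hre : ∀ t ∈ Icc 0 τ, (⟪θ t, θ' t⟫_ℂ).re ≤ ‖θ t‖ * (A + L * ‖θ t‖)) :
    ∀ t ∈ Icc 0 τ, ‖θ t‖ ≤ (‖θ 0‖ + A * t) * Real.exp (L * t) := by
  intro t ht
  have h0 : (0 : ℝ) ∈ Icc 0 τ := ⟨le_rfl, ht.1.trans ht.2⟩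
  have hsq : ∀ s ∈ Icc 0 τ, HasDerivWithinAt (fun s => ‖θ s‖ ^ 2) (2 * (⟪θ s, θ' s⟫_ℂ).re)
      (Icc 0 τ) s := by
    intro s hs
    have h1 := (hd s hs).inner ℂ (hd s hs)
    have h2 := Complex.reCLM.hasFDerivAt.comp_hasDerivWithinAt s h1
    have e1 : ∀ x, ‖θ x‖ ^ 2 = (⟪θ x, θ x⟫_ℂ).re := fun x =>
      (inner_self_eq_norm_sq (𝕜 := ℂ) (θ x)).symm
    have e2 : (⟪θ' s, θ s⟫_ℂ).re = (⟪θ s, θ' s⟫_ℂ).re := inner_re_symm (𝕜 := ℂ) _ _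
    simp only [e1]
    refine h2.congr_deriv ?_
    simp only [Complex.reCLM_apply, Complex.add_re]
    rw [e2]; ring
  refine le_of_forall_pos_le_add fun ε hε => ?_
  set η : ℝ := ε / Real.exp (L * t) with hη
  have hη0 : 0 < η := by positivity
  set z : ℝ → ℝ := fun s => Real.sqrt (‖θ s‖ ^ 2 + η ^ 2) with hz
  have zpos : ∀ s, 0 < z s := fun s => Real.sqrt_pos.2 (by positivity)
  have zge : ∀ s, ‖θ s‖ ≤ z s := fun s => Real.le_sqrt_of_sq_le (by nlinarith [sq_nonneg η])
  have hzd : ∀ s ∈ Icc 0 τ, HasDerivWithinAt z ((⟪θ s, θ' s⟫_ℂ).re / z s) (Icc 0 τ) s := by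
    intro s hs
    have := ((hsq s hs).add_const (η ^ 2)).sqrt (by positivity)
    exact this.congr_deriv (mul_div_mul_left _ _ two_ne_zero)
  have hgd : ∀ s ∈ Icc 0 τ, HasDerivWithinAt (fun s => z s * Real.exp (-(L * s)) - A * s)
      ((⟪θ s, θ' s⟫_ℂ).re / z s * Real.exp (-(L * s))
        + z s * (Real.exp (-(L * s)) * (-L)) - A) (Icc 0 τ) s := by
    intro s hs
    have he : HasDerivAt (fun s : ℝ => Real.exp (-(L * s))) (Real.exp (-(L * s)) * (-L)) s := by
      have : HasDerivAt (fun s : ℝ => -(L * s)) (-L) s := by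
        simpa using (hasDerivAt_id s).const_mul (-L)
      exact this.exp
    have hl : HasDerivAt (fun s : ℝ => A * s) A s := by
      simpa using (hasDerivAt_id s).const_mul A
    exact ((hzd s hs).mul he.hasDerivWithinAt).sub hl.hasDerivWithinAt
  have anti : AntitoneOn (fun s => z s * Real.exp (-(L * s)) - A * s) (Icc 0 τ) := by
    refine antitoneOn_of_deriv_nonpos (convex_Icc _ _)
      (fun s hs => (hgd s hs).continuousWithinAt) (fun s hs => ?_) (fun s hs => ?_)
    · exact ((hgd s (interior_subset hs)).differentiableWithinAt).mono interior_subset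
    · rw [interior_Icc] at hs
      have hs' := Ioo_subset_Icc_self hs
      rw [((hgd s hs').hasDerivAt (Icc_mem_nhds hs.1 hs.2)).deriv]
      have hq : (⟪θ s, θ' s⟫_ℂ).re / z s ≤ A + L * z s := by
        rw [div_le_iff₀ (zpos s)]
        calc _ ≤ ‖θ s‖ * (A + L * ‖θ s‖) := hre s hs'
          _ ≤ z s * (A + L * z s) := by
              have := zge s; gcongr
          _ = _ := by ring
      have he1 : Real.exp (-(L * s)) ≤ 1 :=
        Real.exp_le_one_iff.2 (by nlinarith [hs.1])
      have he0 := Real.exp_pos (-(L * s))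
      nlinarith [mul_le_mul_of_nonneg_right hq he0.le, mul_le_mul_of_nonneg_left he1 hA]
  have hfin := anti h0 ht ht.1
  simp only [mul_zero, neg_zero, Real.exp_zero, mul_one, sub_zero] at hfin
  have z0 : z 0 ≤ ‖θ 0‖ + η := by
    refine Real.sqrt_le_iff.2 ⟨by positivity, ?_⟩
    nlinarith [norm_nonneg (θ 0)]
  have hexp : Real.exp (-(L * t)) * Real.exp (L * t) = 1 := by
    rw [← Real.exp_add]; simp
  have hE := Real.exp_pos (L * t)
  calc ‖θ t‖ ≤ z t := zge t
    _ = (z t * Real.exp (-(L * t))) * Real.exp (L * t) := by rw [mul_assoc, hexp, mul_one]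
    _ ≤ (‖θ 0‖ + η + A * t) * Real.exp (L * t) := by gcongr; linarith
    _ = (‖θ 0‖ + A * t) * Real.exp (L * t) + ε := by
        rw [hη]; field_simp; ring

/-- The imaginary part of the energy identity of `i θ' + S θ = r` controls `‖θ‖`. -/
theorem norm_le_mul_of_energy_identity {θ θ' ζ r : ℝ → H} {τ δ Λ : ℝ} (hδ : 0 ≤ δ) (hΛ : 0 ≤ Λ)
    (hd : ∀ t ∈ Icc 0 τ, HasDerivWithinAt θ (θ' t) (Icc 0 τ) t)
    (he : ∀ t ∈ Icc 0 τ, I * ⟪θ t, θ' t⟫_ℂ + ((‖ζ t‖ ^ 2 : ℝ) : ℂ) = ⟪θ t, r t⟫_ℂ)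
    (hr : ∀ t ∈ Icc 0 τ, ‖r t‖ ≤ δ + Λ * ‖θ t‖) :
    ∀ t ∈ Icc 0 τ, ‖θ t‖ ≤ (‖θ 0‖ + δ * t) * Real.exp (Λ * t) := by
  refine norm_le_of_re_inner_le hδ hΛ hd fun t ht => ?_
  have h1 := congrArg Complex.im (he t ht)
  simp only [Complex.add_im, Complex.mul_im, Complex.I_re, Complex.I_im, Complex.ofReal_im,
    zero_mul, one_mul, zero_add, add_zero] at h1
  rw [h1]
  calc _ ≤ ‖⟪θ t, r t⟫_ℂ‖ := (le_abs_self _).trans (Complex.abs_im_le_norm _)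
    _ ≤ ‖θ t‖ * ‖r t‖ := norm_inner_le_norm _ _
    _ ≤ _ := by gcongr; exact hr t ht

/-- The constant of `norm_le_of_energy_identities`. -/
def energyConst (T Λ : ℝ) : ℝ :=
  1 + (1 + Λ) * (T * Real.exp (Λ * T))
    + (Real.exp (Λ * T) + (1 + Λ * (T * Real.exp (Λ * T))) * T) * Real.exp (Λ * T)

/-- Energy estimate for the error equation `i θ' + S θ = r` in weak form, where `⟪θ, S θ⟫ = ‖ζ‖²`.
The derivative is controlled by applying the Gronwall inequality to the time increments
`θ (t + s) - θ t`, so that no second time derivative is needed. -/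
theorem norm_le_of_energy_identities {θ θ' ζ r : ℝ → H} {T δ Λ : ℝ} (hT : 0 < T) (hδ : 0 ≤ δ)
    (hΛ : 0 ≤ Λ)
    (hd : ∀ t ∈ Icc 0 T, HasDerivWithinAt θ (θ' t) (Icc 0 T) t)
    (he : ∀ t ∈ Icc 0 T, I * ⟪θ t, θ' t⟫_ℂ + ((‖ζ t‖ ^ 2 : ℝ) : ℂ) = ⟪θ t, r t⟫_ℂ)
    (hed : ∀ s ∈ Icc 0 T, ∀ t ∈ Icc 0 T, I * ⟪θ t - θ s, θ' t - θ' s⟫_ℂ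
      + ((‖ζ t - ζ s‖ ^ 2 : ℝ) : ℂ) = ⟪θ t - θ s, r t - r s⟫_ℂ)
    (h0 : θ 0 = 0)
    (hr : ∀ t ∈ Icc 0 T, ‖r t‖ ≤ δ + Λ * ‖θ t‖)
    (hdr : ∀ s ∈ Icc 0 T, ∀ t ∈ Icc 0 T,
      ‖r t - r s‖ ≤ |t - s| * (δ + Λ * ‖θ s‖) + Λ * ‖θ t - θ s‖) :
    ∀ t ∈ Icc 0 T, ‖θ t‖ ≤ energyConst T Λ * δ ∧ ‖θ' t‖ ≤ energyConst T Λ * δ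
      ∧ ‖ζ t‖ ≤ energyConst T Λ * δ := by
  set E := Real.exp (Λ * T) with hE
  have hE0 : 0 < E := Real.exp_pos _
  have hexp : ∀ s ∈ Icc 0 T, Real.exp (Λ * s) ≤ E := fun s hs =>
    Real.exp_le_exp.2 (mul_le_mul_of_nonneg_left hs.2 hΛ)
  have hθ1 : ∀ t ∈ Icc 0 T, ‖θ t‖ ≤ δ * t * E := by
    intro t ht
    have := norm_le_mul_of_energy_identity hδ hΛ hd he hr t ht
    rw [h0, norm_zero, zero_add] at this
    exact this.trans (mul_le_mul_of_nonneg_left (hexp t ht) (mul_nonneg hδ ht.1))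
  set k₀ := T * E with hk₀
  have hk₀0 : 0 ≤ k₀ := by positivity
  have hθ : ∀ t ∈ Icc 0 T, ‖θ t‖ ≤ δ * k₀ := by
    intro t ht
    refine (hθ1 t ht).trans ?_
    rw [hk₀, mul_assoc]
    have := ht.2
    gcongr
  set k₁ := (E + (1 + Λ * k₀) * T) * E with hk₁
  have hk₁0 : 0 ≤ k₁ := by positivity
  -- The increment starts from `θ s - θ 0 = θ s`, which is already known to be `O(s)`.
  have hinc : ∀ s ∈ Icc 0 T, ∀ t ∈ Icc 0 (T - s), ‖θ (t + s) - θ t‖ ≤ k₁ * δ * s := by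
    intro s hs t ht
    have hmem : ∀ x ∈ Icc 0 (T - s), x ∈ Icc 0 T ∧ x + s ∈ Icc 0 T := fun x hx =>
      ⟨⟨hx.1, by linarith [hx.2, hs.1]⟩, ⟨by linarith [hx.1, hs.1], by linarith [hx.2]⟩⟩
    have hT' : T - s ≤ T := by linarith [hs.1]
    have hd' : ∀ x ∈ Icc 0 (T - s), HasDerivWithinAt (fun x => θ (x + s) - θ x)
        (θ' (x + s) - θ' x) (Icc 0 (T - s)) x := by
      intro x hx
      have h1 : HasDerivWithinAt (fun x => x + s) (1 : ℝ) (Icc 0 (T - s)) x :=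
        (hasDerivWithinAt_id x _).add_const s
      have h2 := (hd (x + s) (hmem x hx).2).scomp x h1 fun y hy => (hmem y hy).2
      rw [one_smul] at h2
      exact h2.sub ((hd x (hmem x hx).1).mono fun y hy => (hmem y hy).1)
    have hk : 0 ≤ s * (δ + Λ * (δ * k₀)) := mul_nonneg hs.1 (by positivity)
    have := norm_le_mul_of_energy_identity (ζ := fun x => ζ (x + s) - ζ x)
      (r := fun x => r (x + s) - r x) (δ := s * (δ + Λ * (δ * k₀))) hk hΛ hd'
      (fun x hx => hed x (hmem x hx).1 (x + s) (hmem x hx).2)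
      (fun x hx => by
        refine (hdr x (hmem x hx).1 (x + s) (hmem x hx).2).trans ?_
        rw [add_sub_cancel_left, abs_of_nonneg hs.1]
        have := hθ x (hmem x hx).1
        have := hs.1
        gcongr) t ht
    refine this.trans ?_
    simp only [zero_add, h0, sub_zero]
    have ht' := (hmem t ht).1
    have h3 := hθ1 s hs
    have h4 := hexp t ht'
    calc (‖θ s‖ + s * (δ + Λ * (δ * k₀)) * t) * Real.exp (Λ * t)
        ≤ (δ * s * E + s * (δ + Λ * (δ * k₀)) * T) * E := by
          have := ht'.2
          have := ht'.1
          have := hs.1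
          gcongr
      _ = k₁ * δ * s := by rw [hk₁]; ring
  have hlip : ∀ s ∈ Icc 0 T, ∀ t ∈ Icc 0 T, ‖θ s - θ t‖ ≤ k₁ * δ * |s - t| := by
    have key : ∀ s ∈ Icc 0 T, ∀ t ∈ Icc 0 T, t ≤ s → ‖θ s - θ t‖ ≤ k₁ * δ * |s - t| := by
      intro s hs t ht hts
      have := hinc (s - t) ⟨by linarith, by linarith [hs.2, ht.1]⟩ t
        ⟨ht.1, by linarith [hs.2]⟩
      rwa [add_sub_cancel, ← abs_of_nonneg (sub_nonneg.2 hts)] at this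
    intro s hs t ht
    rcases le_total t s with h | h
    · exact key s hs t ht h
    · rw [norm_sub_rev, abs_sub_comm]; exact key t ht s hs h
  have hθ' : ∀ t ∈ Icc 0 T, ‖θ' t‖ ≤ k₁ * δ := fun t ht =>
    (hd t ht).norm_le_of_lipschitz hT ht fun s hs => hlip s hs t ht
  have hC : energyConst T Λ = 1 + (1 + Λ) * k₀ + k₁ := rfl
  intro t ht
  refine ⟨(hθ t ht).trans ?_, (hθ' t ht).trans ?_, ?_⟩
  · rw [hC]; nlinarith [mul_nonneg hδ hk₀0, mul_nonneg hδ hk₁0, mul_nonneg (mul_nonneg hδ hk₀0) hΛ]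
  · rw [hC]; nlinarith [mul_nonneg hδ hk₀0, mul_nonneg hδ hk₁0, mul_nonneg (mul_nonneg hδ hk₀0) hΛ]
  · have h1 := congrArg Complex.re (he t ht)
    simp only [Complex.add_re, Complex.mul_re, Complex.I_re, Complex.I_im, Complex.ofReal_re,
      zero_mul, one_mul, zero_sub] at h1
    have h2 : (⟪θ t, θ' t⟫_ℂ).im ≤ ‖θ t‖ * ‖θ' t‖ :=
      ((le_abs_self _).trans (Complex.abs_im_le_norm _)).trans (norm_inner_le_norm _ _)
    have h3 : (⟪θ t, r t⟫_ℂ).re ≤ ‖θ t‖ * ‖r t‖ :=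
      ((le_abs_self _).trans (Complex.abs_re_le_norm _)).trans (norm_inner_le_norm _ _)
    have h4 : ‖ζ t‖ ^ 2 ≤ (δ * k₀) * (k₁ * δ) + (δ * k₀) * (δ + Λ * (δ * k₀)) := by
      have a1 := hθ t ht
      have a2 := hθ' t ht
      have a3 : ‖r t‖ ≤ δ + Λ * (δ * k₀) := (hr t ht).trans (by gcongr)
      have b1 : ‖θ t‖ * ‖θ' t‖ ≤ (δ * k₀) * (k₁ * δ) := by gcongr
      have b2 : ‖θ t‖ * ‖r t‖ ≤ (δ * k₀) * (δ + Λ * (δ * k₀)) := by gcongr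
      linarith
    refine le_of_sq_le_sq (h4.trans ?_) (by rw [hC]; positivity)
    rw [hC]
    have e : (δ * k₀) * (k₁ * δ) + (δ * k₀) * (δ + Λ * (δ * k₀))
        = (k₀ * (k₁ + 1 + Λ * k₀)) * δ ^ 2 := by ring
    rw [e, mul_pow]
    refine mul_le_mul_of_nonneg_right ?_ (sq_nonneg _)
    rw [sq]
    have i1 : k₀ ≤ 1 + (1 + Λ) * k₀ + k₁ := by nlinarith [mul_nonneg hΛ hk₀0]
    have i2 : k₁ + 1 + Λ * k₀ ≤ 1 + (1 + Λ) * k₀ + k₁ := by nlinarith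
    exact mul_le_mul i1 i2 (by positivity) (by positivity)

/-- Continuation argument: a continuous quantity that starts below a threshold, and is strictly
below it whenever it has not exceeded it before, never exceeds it. -/
theorem le_of_bootstrap {X : ℝ → ℝ} {T c : ℝ} (hX : ContinuousOn X (Icc 0 T)) (h0 : X 0 < c)
    (h : ∀ τ ∈ Icc 0 T, (∀ t ∈ Icc 0 τ, X t ≤ c) → X τ < c) : ∀ t ∈ Icc 0 T, X t ≤ c := by
  by_contra! hcon
  obtain ⟨t₁, ht₁, hlt⟩ := hcon
  have hsub : Icc 0 t₁ ⊆ Icc 0 T := Icc_subset_Icc_right ht₁.2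
  have hne : (Icc 0 T ∩ X ⁻¹' {c}).Nonempty := by
    obtain ⟨x, hx, hxc⟩ := intermediate_value_Icc ht₁.1 (hX.mono hsub) ⟨h0.le, hlt.le⟩
    exact ⟨x, hsub hx, hxc⟩
  have hcl : IsCompact (Icc 0 T ∩ X ⁻¹' {c}) :=
    isCompact_Icc.of_isClosed_subset
      (hX.preimage_isClosed_of_isClosed isClosed_Icc isClosed_singleton) inter_subset_left
  obtain ⟨τ, ⟨hτ, hτc⟩, hmin⟩ := hcl.exists_isLeast hne
  refine (h τ hτ fun t ht => ?_).ne hτc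
  by_contra! hgt
  have hsub' : Icc 0 t ⊆ Icc 0 T := Icc_subset_Icc_right (ht.2.trans hτ.2)
  obtain ⟨x, hx, hxc⟩ := intermediate_value_Icc ht.1 (hX.mono hsub') ⟨h0.le, hgt.le⟩
  have := hmin ⟨hsub' hx, hxc⟩
  have hxt : x = t := le_antisymm hx.2 (ht.2.trans this)
  rw [hxt] at hxc
  exact hgt.ne' hxc

end Energy

/-! ### The nonlinearity: Lipschitz bounds for values and for increments -/

/-- Quantitative `C^{1,1}` behaviour of `g` on `S` without derivatives: `g` and its increments are
Lipschitz, where the increments `g a - g b` and `g c - g d` over two segments are compared. -/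
structure IncrementLipschitz {E A : Type*} [NormedAddCommGroup E] [NormedAddCommGroup A]
    (S : Set E) (g : E → A) (L : ℝ) : Prop where
  bound : ∀ a ∈ S, ‖g a‖ ≤ L
  lip : ∀ a ∈ S, ∀ b ∈ S, ‖g a - g b‖ ≤ L * ‖a - b‖
  lip₂ : ∀ a ∈ S, ∀ b ∈ S, ∀ c ∈ S, ∀ d ∈ S, ‖(g a - g b) - (g c - g d)‖
    ≤ L * (‖(a - b) - (c - d)‖ + ‖c - d‖ * (‖a - c‖ + ‖b - d‖))

namespace IncrementLipschitz

theorem mul {E A : Type*} [NormedAddCommGroup E] [NormedRing A] {S : Set E} {f g : E → A}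
    {L K : ℝ} (hL : 0 ≤ L) (hK : 0 ≤ K) (hf : IncrementLipschitz S f L)
    (hg : IncrementLipschitz S g K) :
    IncrementLipschitz S (fun x => f x * g x) (3 * (L * K)) where
  bound x hx := by
    calc _ ≤ ‖f x‖ * ‖g x‖ := norm_mul_le _ _
      _ ≤ L * K := by gcongr; exacts [hf.bound x hx, hg.bound x hx]
      _ ≤ _ := by nlinarith [mul_nonneg hL hK]
  lip x hx y hy := by
    have e : f x * g x - f y * g y = (f x - f y) * g x + f y * (g x - g y) := by noncomm_ring
    rw [e]
    calc _ ≤ ‖f x - f y‖ * ‖g x‖ + ‖f y‖ * ‖g x - g y‖ :=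
          (norm_add_le _ _).trans (add_le_add (norm_mul_le _ _) (norm_mul_le _ _))
      _ ≤ (L * ‖x - y‖) * K + L * (K * ‖x - y‖) := by
          gcongr
          exacts [hf.lip x hx y hy, hg.bound x hx, hf.bound y hy, hg.lip x hx y hy]
      _ ≤ _ := by nlinarith [mul_nonneg (mul_nonneg hL hK) (norm_nonneg (x - y))]
  lip₂ a ha b hb c hc d hd := by
    have e : (f a * g a - f b * g b) - (f c * g c - f d * g d)
        = ((f a - f b) - (f c - f d)) * g a + (f c - f d) * (g a - g c)
          + f b * ((g a - g b) - (g c - g d)) + (f b - f d) * (g c - g d) := by noncomm_ring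
    rw [e]
    set X := ‖(a - b) - (c - d)‖
    have i1 := (norm_mul_le ((f a - f b) - (f c - f d)) (g a)).trans
      (mul_le_mul (hf.lip₂ a ha b hb c hc d hd) (hg.bound a ha) (norm_nonneg _) (by positivity))
    have i2 := (norm_mul_le (f c - f d) (g a - g c)).trans
      (mul_le_mul (hf.lip c hc d hd) (hg.lip a ha c hc) (norm_nonneg _) (by positivity))
    have i3 := (norm_mul_le (f b) ((g a - g b) - (g c - g d))).trans
      (mul_le_mul (hf.bound b hb) (hg.lip₂ a ha b hb c hc d hd) (norm_nonneg _) (by positivity))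
    have i4 := (norm_mul_le (f b - f d) (g c - g d)).trans
      (mul_le_mul (hf.lip b hb d hd) (hg.lip c hc d hd) (norm_nonneg _) (by positivity))
    refine (norm_add₄_le).trans ?_
    have hX : 0 ≤ L * K * X := by positivity
    have hb : 0 ≤ L * K * ‖c - d‖ * ‖b - d‖ := by positivity
    nlinarith

theorem comp {E A B : Type*} [NormedAddCommGroup E] [NormedAddCommGroup A]
    [NormedAddCommGroup B] {S : Set E} {S' : Set A} {f : A → B} {g : E → A} {L K : ℝ}
    (hL : 0 ≤ L) (hK : 0 ≤ K) (hf : IncrementLipschitz S' f L) (hg : IncrementLipschitz S g K)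
    (hS : MapsTo g S S') :
    IncrementLipschitz S (fun x => f (g x)) (L * (1 + K + K ^ 2)) where
  bound x hx := (hf.bound _ (hS hx)).trans
    (by nlinarith [mul_nonneg hL hK, mul_nonneg hL (sq_nonneg K)])
  lip x hx y hy := by
    refine (hf.lip _ (hS hx) _ (hS hy)).trans ?_
    have := hg.lip x hx y hy
    calc _ ≤ L * (K * ‖x - y‖) := by gcongr
      _ ≤ L * ((1 + K + K ^ 2) * ‖x - y‖) := by gcongr; nlinarith
      _ = _ := by ring
  lip₂ a ha b hb c hc d hd := by
    refine (hf.lip₂ _ (hS ha) _ (hS hb) _ (hS hc) _ (hS hd)).trans ?_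
    rw [mul_assoc]
    refine mul_le_mul_of_nonneg_left ?_ hL
    have i1 := hg.lip₂ a ha b hb c hc d hd
    have i2 := hg.lip c hc d hd
    have i3 := hg.lip a ha c hc
    have i4 := hg.lip b hb d hd
    set X := ‖(a - b) - (c - d)‖
    have hX : 0 ≤ X := norm_nonneg _
    calc _ ≤ K * (X + ‖c - d‖ * (‖a - c‖ + ‖b - d‖))
          + (K * ‖c - d‖) * (K * ‖a - c‖ + K * ‖b - d‖) := by gcongr
      _ ≤ _ := by
        have : 0 ≤ ‖c - d‖ * (‖a - c‖ + ‖b - d‖) := by positivity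
        nlinarith [mul_nonneg (sq_nonneg K) hX]

theorem of_norm_le {E A B : Type*} [NormedAddCommGroup E] [NormedAddCommGroup A]
    [NormedAddCommGroup B] {S : Set E} {f : E → A} {L : ℝ} (hf : IncrementLipschitz S f L)
    (φ : A →+ B) (hφ : ∀ x, ‖φ x‖ ≤ ‖x‖) : IncrementLipschitz S (fun x => φ (f x)) L where
  bound x hx := (hφ _).trans (hf.bound x hx)
  lip x hx y hy := by rw [← map_sub]; exact (hφ _).trans (hf.lip x hx y hy)
  lip₂ a ha b hb c hc d hd := by
    simp only [← map_sub]; exact (hφ _).trans (hf.lip₂ a ha b hb c hc d hd)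

/-- A real function with bounded and Lipschitz derivative on a convex set. -/
theorem of_hasDerivAt {f f' : ℝ → ℝ} {S : Set ℝ} (hS : Convex ℝ S) {L : ℝ} (hL : 0 ≤ L)
    (hb : ∀ x ∈ S, |f x| ≤ L) (hd : ∀ x, HasDerivAt f (f' x) x) (hb' : ∀ x ∈ S, |f' x| ≤ L)
    (hl : ∀ x ∈ S, ∀ y ∈ S, |f' x - f' y| ≤ L * |x - y|) : IncrementLipschitz S f L where
  bound := hb
  lip a ha b hb := hS.norm_image_sub_le_of_norm_hasDerivWithin_le
    (fun x _ => (hd x).hasDerivWithinAt) hb' hb ha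
  lip₂ a ha b hb c hc d hd' := by
    -- The mean value theorem along the two segments simultaneously.
    set p : ℝ → ℝ := fun τ => b + τ * (a - b)
    set r : ℝ → ℝ := fun τ => d + τ * (c - d)
    have hp : ∀ τ ∈ Icc (0 : ℝ) 1, p τ ∈ S := fun τ hτ => hS.add_smul_sub_mem hb ha hτ
    have hr : ∀ τ ∈ Icc (0 : ℝ) 1, r τ ∈ S := fun τ hτ => hS.add_smul_sub_mem hd' hc hτ
    have hpd : ∀ τ, HasDerivAt p (a - b) τ := fun τ =>
      (((hasDerivAt_id τ).mul_const (a - b)).const_add b).congr_deriv (one_mul _)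
    have hrd : ∀ τ, HasDerivAt r (c - d) τ := fun τ =>
      (((hasDerivAt_id τ).mul_const (c - d)).const_add d).congr_deriv (one_mul _)
    have key := (convex_Icc (0 : ℝ) 1).norm_image_sub_le_of_norm_hasDerivWithin_le
      (f := fun τ => f (p τ) - f (r τ))
      (f' := fun τ => f' (p τ) * (a - b) - f' (r τ) * (c - d))
      (C := L * (‖(a - b) - (c - d)‖ + ‖c - d‖ * (‖a - c‖ + ‖b - d‖))) (x := 0) (y := 1)
      (fun τ _ => (((hd (p τ)).comp τ (hpd τ)).sub ((hd (r τ)).comp τ (hrd τ))).hasDerivWithinAt)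
      (fun τ hτ => ?_) (by simp) (by simp)
    · simp only [p, r, one_mul, zero_mul, add_zero, add_sub_cancel, sub_zero, norm_one,
        mul_one] at key
      refine le_trans (le_of_eq ?_) key
      congr 1; ring
    · have e : f' (p τ) * (a - b) - f' (r τ) * (c - d)
          = f' (p τ) * ((a - b) - (c - d)) + (f' (p τ) - f' (r τ)) * (c - d) := by ring
      rw [e]
      have e2 : p τ - r τ = τ * (a - c) + (1 - τ) * (b - d) := by simp only [p, r]; ring
      have i1 : |p τ - r τ| ≤ ‖a - c‖ + ‖b - d‖ := by
        rw [e2]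
        refine (abs_add_le _ _).trans ?_
        rw [abs_mul, abs_mul, abs_of_nonneg hτ.1, abs_of_nonneg (sub_nonneg.2 hτ.2)]
        simp only [Real.norm_eq_abs]
        nlinarith [abs_nonneg (a - c), abs_nonneg (b - d), hτ.1, hτ.2]
      calc _ ≤ ‖f' (p τ)‖ * ‖(a - b) - (c - d)‖ + ‖f' (p τ) - f' (r τ)‖ * ‖c - d‖ :=
            (norm_add_le _ _).trans (add_le_add (norm_mul_le _ _) (norm_mul_le _ _))
        _ ≤ L * ‖(a - b) - (c - d)‖ + (L * (‖a - c‖ + ‖b - d‖)) * ‖c - d‖ := by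
            gcongr
            · exact hb' _ (hp τ hτ)
            · exact (hl _ (hp τ hτ) _ (hr τ hτ)).trans (by gcongr)
        _ = _ := by ring

end IncrementLipschitz

/-- The nonlinear term `z F'(|z|²)`. -/
def nonlinearTerm (F : ℝ → ℝ) (z : ℂ) : ℂ := z * ((deriv F (‖z‖ ^ 2) : ℝ) : ℂ)

theorem NonlinearityBound.hasDerivAt_deriv {F : ℝ → ℝ} {M : ℝ → ℝ} (hF : NonlinearityBound F M)
    (x : ℝ) : HasDerivAt (deriv F) (iteratedDeriv 2 F x) x ∧
      HasDerivAt (iteratedDeriv 2 F) (iteratedDeriv 3 F x) x := by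
  have h1 : deriv F = iteratedDeriv 1 F := iteratedDeriv_one.symm
  constructor
  · rw [h1, iteratedDeriv_succ (n := 1)]
    exact ((hF.contDiff.differentiable_iteratedDeriv 1 (by norm_num)) x).hasDerivAt
  · rw [iteratedDeriv_succ (n := 2)]
    exact ((hF.contDiff.differentiable_iteratedDeriv 2 (by norm_num)) x).hasDerivAt

theorem NonlinearityBound.continuous_nonlinearTerm {F : ℝ → ℝ} {M : ℝ → ℝ}
    (hF : NonlinearityBound F M) : Continuous (nonlinearTerm F) := by
  have : Continuous (deriv F) :=
    continuous_iff_continuousAt.2 fun x => (hF.hasDerivAt_deriv x).1.continuousAt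
  unfold nonlinearTerm
  fun_prop

/-- The constant in the Lipschitz bounds of `nonlinearTerm F` on the disc of radius `R`. -/
def nonlinearConst (M : ℝ → ℝ) (R : ℝ) : ℝ :=
  3 * ((1 + R) * (|M (R ^ 2)| * (1 + 3 * ((1 + R) * (1 + R))
    + (3 * ((1 + R) * (1 + R))) ^ 2)))

theorem nonlinearConst_nonneg (M : ℝ → ℝ) {R : ℝ} (hR : 0 ≤ R) : 0 ≤ nonlinearConst M R := by
  unfold nonlinearConst; positivity

theorem NonlinearityBound.incrementLipschitz {F : ℝ → ℝ} {M : ℝ → ℝ}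
    (hF : NonlinearityBound F M) {R : ℝ} (hR : 0 ≤ R) :
    IncrementLipschitz {z : ℂ | ‖z‖ ≤ R} (nonlinearTerm F) (nonlinearConst M R) := by
  have hid : IncrementLipschitz {z : ℂ | ‖z‖ ≤ R} (fun z => z) (1 + R) :=
    { bound := fun x hx => (show ‖x‖ ≤ R from hx).trans (by linarith)
      lip := fun x _ y _ => le_mul_of_one_le_left (norm_nonneg _) (by linarith)
      lip₂ := fun a _ b _ c _ d _ => by
        have : 0 ≤ ‖c - d‖ * (‖a - c‖ + ‖b - d‖) := by positivity
        nlinarith [norm_nonneg ((a - b) - (c - d))] }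
  have hconj := hid.of_norm_le (starRingEnd ℂ).toAddMonoidHom
    (fun x => (RCLike.norm_conj x).le)
  have hsq : IncrementLipschitz {z : ℂ | ‖z‖ ≤ R} (fun z => ‖z‖ ^ 2)
      (3 * ((1 + R) * (1 + R))) := by
    have h := (hid.mul (by positivity) (by positivity) hconj).of_norm_le
      Complex.reLm.toAddMonoidHom (fun x => Complex.abs_re_le_norm x)
    have e : (fun z : ℂ => ‖z‖ ^ 2) = fun z => (z * conj z).re := by
      funext z; rw [Complex.mul_conj, Complex.ofReal_re, Complex.normSq_eq_norm_sq]
    rw [e]; exact h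
  have hf : IncrementLipschitz (Icc 0 (R ^ 2)) (deriv F) |M (R ^ 2)| := by
    have hb := hF.bound (R ^ 2)
    refine IncrementLipschitz.of_hasDerivAt (convex_Icc _ _) (abs_nonneg _)
      (fun x hx => ?_) (fun x => (hF.hasDerivAt_deriv x).1)
      (fun x hx => (hb x hx 2 (by simp)).trans (le_abs_self _)) fun x hx y hy => ?_
    · have := hb x hx 1 (by simp)
      rw [iteratedDeriv_one] at this
      exact this.trans (le_abs_self _)
    · exact (convex_Icc 0 (R ^ 2)).norm_image_sub_le_of_norm_hasDerivWithin_le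
        (fun x _ => (hF.hasDerivAt_deriv x).2.hasDerivWithinAt)
        (fun x hx => (hb x hx 3 (by simp)).trans (le_abs_self _)) hy hx
  have hcomp := hf.comp (abs_nonneg _) (by positivity) hsq
    (fun z hz => ⟨by positivity, pow_le_pow_left₀ (norm_nonneg z) hz 2⟩)
  have hcast := hcomp.of_norm_le Complex.ofRealHom.toAddMonoidHom
    (fun x => (Complex.norm_real x).le)
  exact hid.mul (by positivity) (by positivity) hcast

/-! ### Space and time derivatives of functions that are smooth on a closed time slab -/

/-- Smoothness of `v t x` on the closed slab `[0, T] × ℝ`. -/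
def SlabSmooth (T : ℝ) (v : ℝ → ℝ → ℂ) : Prop :=
  ContDiffOn ℝ ∞ (fun p : ℝ × ℝ => v p.1 p.2) (Icc 0 T ×ˢ univ)

/-- The space derivative `v_x`. -/
def spaceDeriv (v : ℝ → ℝ → ℂ) (t x : ℝ) : ℂ := deriv (v t) x

section Slab

variable {T : ℝ} {v : ℝ → ℝ → ℂ}

theorem uniqueDiffOn_slab (hT : 0 < T) : UniqueDiffOn ℝ (Icc 0 T ×ˢ (univ : Set ℝ)) :=
  (uniqueDiffOn_Icc hT).prod uniqueDiffOn_univ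

theorem SlabSmooth.hasFDerivWithinAt (hv : SlabSmooth T v) {t : ℝ} (ht : t ∈ Icc 0 T) (x : ℝ) :
    HasFDerivWithinAt (fun p : ℝ × ℝ => v p.1 p.2)
      (fderivWithin ℝ (fun p : ℝ × ℝ => v p.1 p.2) (Icc 0 T ×ˢ univ) (t, x))
      (Icc 0 T ×ˢ univ) (t, x) :=
  ((hv.differentiableOn (by simp)) (t, x) ⟨ht, mem_univ _⟩).hasFDerivWithinAt

theorem SlabSmooth.hasDerivAt_space_fderivWithin (hv : SlabSmooth T v) {t : ℝ}
    (ht : t ∈ Icc 0 T) (x : ℝ) : HasDerivAt (v t)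
      (fderivWithin ℝ (fun p : ℝ × ℝ => v p.1 p.2) (Icc 0 T ×ˢ univ) (t, x) (0, 1)) x := by
  have h1 : HasDerivWithinAt (fun y : ℝ => (t, y)) ((0 : ℝ), (1 : ℝ)) univ x :=
    ((hasDerivAt_const x t).prodMk (hasDerivAt_id x)).hasDerivWithinAt
  have := (hv.hasFDerivWithinAt ht x).comp_hasDerivWithinAt x h1 fun y _ => ⟨ht, mem_univ _⟩
  exact hasDerivWithinAt_univ.1 this

theorem SlabSmooth.hasDerivWithinAt_time_fderivWithin (hv : SlabSmooth T v) {t : ℝ}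
    (ht : t ∈ Icc 0 T) (x : ℝ) : HasDerivWithinAt (fun s => v s x)
      (fderivWithin ℝ (fun p : ℝ × ℝ => v p.1 p.2) (Icc 0 T ×ˢ univ) (t, x) (1, 0))
      (Icc 0 T) t := by
  have h1 : HasDerivWithinAt (fun s : ℝ => (s, x)) ((1 : ℝ), (0 : ℝ)) (Icc 0 T) t :=
    ((hasDerivAt_id t).prodMk (hasDerivAt_const t x)).hasDerivWithinAt
  have hm : MapsTo (fun s : ℝ => (s, x)) (Icc 0 T) (Icc 0 T ×ˢ univ) :=
    fun y hy => ⟨hy, mem_univ _⟩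
  exact (hv.hasFDerivWithinAt ht x).comp_hasDerivWithinAt t h1 hm

theorem SlabSmooth.fderivWithin_space (hv : SlabSmooth T v) {t : ℝ} (ht : t ∈ Icc 0 T) (x : ℝ) :
    fderivWithin ℝ (fun p : ℝ × ℝ => v p.1 p.2) (Icc 0 T ×ˢ univ) (t, x) (0, 1)
      = spaceDeriv v t x :=
  (hv.hasDerivAt_space_fderivWithin ht x).deriv.symm

theorem SlabSmooth.fderivWithin_time (hT : 0 < T) (hv : SlabSmooth T v) {t : ℝ}
    (ht : t ∈ Icc 0 T) (x : ℝ) :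
    fderivWithin ℝ (fun p : ℝ × ℝ => v p.1 p.2) (Icc 0 T ×ˢ univ) (t, x) (1, 0)
      = timeDeriv T v t x :=
  ((hv.hasDerivWithinAt_time_fderivWithin ht x).derivWithin (uniqueDiffOn_Icc hT t ht)).symm

theorem SlabSmooth.hasDerivWithinAt_time (hT : 0 < T) (hv : SlabSmooth T v) {t : ℝ}
    (ht : t ∈ Icc 0 T) (x : ℝ) :
    HasDerivWithinAt (fun s => v s x) (timeDeriv T v t x) (Icc 0 T) t :=
  hv.fderivWithin_time hT ht x ▸ hv.hasDerivWithinAt_time_fderivWithin ht x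

theorem SlabSmooth.contDiffOn_fderivWithin (hT : 0 < T) (hv : SlabSmooth T v) :
    ContDiffOn ℝ ∞ (fderivWithin ℝ (fun p : ℝ × ℝ => v p.1 p.2) (Icc 0 T ×ˢ univ))
      (Icc 0 T ×ˢ univ) :=
  ContDiffOn.fderivWithin hv (uniqueDiffOn_slab hT) (by simp)

theorem SlabSmooth.spaceDeriv (hT : 0 < T) (hv : SlabSmooth T v) :
    SlabSmooth T (_root_.spaceDeriv v) := by
  refine ((hv.contDiffOn_fderivWithin hT).clm_apply
    (contDiffOn_const (c := ((0 : ℝ), (1 : ℝ))))).congr fun p hp => ?_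
  exact (hv.fderivWithin_space hp.1 p.2).symm

theorem SlabSmooth.timeDeriv (hT : 0 < T) (hv : SlabSmooth T v) :
    SlabSmooth T (_root_.timeDeriv T v) := by
  refine ((hv.contDiffOn_fderivWithin hT).clm_apply
    (contDiffOn_const (c := ((1 : ℝ), (0 : ℝ))))).congr fun p hp => ?_
  exact (hv.fderivWithin_time hT hp.1 p.2).symm

theorem SlabSmooth.timeDeriv_spaceDeriv (hT : 0 < T) (hv : SlabSmooth T v) {t : ℝ}
    (ht : t ∈ Icc 0 T) (x : ℝ) :
    _root_.timeDeriv T (_root_.spaceDeriv v) t x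
      = _root_.spaceDeriv (_root_.timeDeriv T v) t x := by
  set U : ℝ × ℝ → ℂ := fun p => v p.1 p.2
  set S : Set (ℝ × ℝ) := Icc 0 T ×ˢ univ
  have hmem : (t, x) ∈ S := ⟨ht, mem_univ _⟩
  have hd : HasFDerivWithinAt (fderivWithin ℝ U S)
      (fderivWithin ℝ (fderivWithin ℝ U S) S (t, x)) S (t, x) :=
    (((hv.contDiffOn_fderivWithin hT).differentiableOn (by simp)) _ hmem).hasFDerivWithinAt
  have hcl : (t, x) ∈ closure (interior S) := by
    rw [interior_prod_eq, closure_prod_eq, interior_Icc, interior_univ, closure_univ,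
      closure_Ioo hT.ne]
    exact hmem
  have hsymm := (hv.contDiffWithinAt hmem).isSymmSndFDerivWithinAt
    (by rw [minSmoothness_of_isRCLikeNormedField]; exact ENat.LEInfty.out)
    (uniqueDiffOn_slab hT) hcl hmem
  have hy : HasFDerivWithinAt (fun p : ℝ × ℝ => _root_.spaceDeriv v p.1 p.2)
      ((fderivWithin ℝ (fderivWithin ℝ U S) S (t, x)).flip (0, 1)) S (t, x) := by
    have h := hd.clm_apply (hasFDerivWithinAt_const ((0 : ℝ), (1 : ℝ)) (t, x) S)
    refine (h.congr_fderiv (by ext <;> simp)).congr (fun p hp => ?_) ?_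
    · exact (hv.fderivWithin_space hp.1 p.2).symm
    · exact (hv.fderivWithin_space ht x).symm
  have hx : HasFDerivWithinAt (fun p : ℝ × ℝ => _root_.timeDeriv T v p.1 p.2)
      ((fderivWithin ℝ (fderivWithin ℝ U S) S (t, x)).flip (1, 0)) S (t, x) := by
    have h := hd.clm_apply (hasFDerivWithinAt_const ((1 : ℝ), (0 : ℝ)) (t, x) S)
    refine (h.congr_fderiv (by ext <;> simp)).congr (fun p hp => ?_) ?_
    · exact (hv.fderivWithin_time hT hp.1 p.2).symm
    · exact (hv.fderivWithin_time hT ht x).symm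
  rw [← (hv.spaceDeriv hT).fderivWithin_time hT ht x,
    ← (hv.timeDeriv hT).fderivWithin_space ht x,
    hy.fderivWithin (uniqueDiffOn_slab hT _ hmem), hx.fderivWithin (uniqueDiffOn_slab hT _ hmem)]
  exact hsymm (1, 0) (0, 1)

theorem SlabSmooth.iterate_spaceDeriv (hT : 0 < T) (hv : SlabSmooth T v) (k : ℕ) :
    SlabSmooth T (_root_.spaceDeriv^[k] v) := by
  induction k with
  | zero => exact hv
  | succ k ih => rw [Function.iterate_succ_apply']; exact ih.spaceDeriv hT

theorem iteratedDeriv_eq_iterate_spaceDeriv (v : ℝ → ℝ → ℂ) (k : ℕ) (t : ℝ) :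
    iteratedDeriv k (v t) = spaceDeriv^[k] v t := by
  induction k with
  | zero => simp
  | succ k ih => rw [Function.iterate_succ_apply', iteratedDeriv_succ, ih]; rfl

theorem spaceDeriv_congr {v₁ v₂ : ℝ → ℝ → ℂ} {t : ℝ} (h : v₁ t = v₂ t) :
    spaceDeriv v₁ t = spaceDeriv v₂ t := by
  funext x; unfold spaceDeriv; rw [h]

theorem SlabSmooth.timeDeriv_iterate_spaceDeriv (hT : 0 < T) (hv : SlabSmooth T v) (k : ℕ)
    {t : ℝ} (ht : t ∈ Icc 0 T) :
    _root_.timeDeriv T (_root_.spaceDeriv^[k] v) t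
      = _root_.spaceDeriv^[k] (_root_.timeDeriv T v) t := by
  induction k with
  | zero => rfl
  | succ k ih =>
    rw [Function.iterate_succ_apply', Function.iterate_succ_apply', ← spaceDeriv_congr ih]
    funext x
    exact (hv.iterate_spaceDeriv hT k).timeDeriv_spaceDeriv hT ht x

theorem SlabSmooth.contDiff (hv : SlabSmooth T v) {t : ℝ} (ht : t ∈ Icc 0 T) :
    ContDiff ℝ ∞ (v t) := by
  rw [← contDiffOn_univ]
  exact ContDiffOn.comp hv (g := fun p : ℝ × ℝ => v p.1 p.2) (f := fun y : ℝ => (t, y))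
    (by fun_prop) fun y _ => ⟨ht, mem_univ _⟩

theorem DerivBound.mono {r r' : ℕ} {K : ℝ} (h : DerivBound T r K v) (hr : r' ≤ r) :
    DerivBound T r' K v := fun k hk => h k (hk.trans hr)

theorem DerivBound.of_fderivWithin {K : ℝ} {r : ℕ} (hT : 0 < T) (hv : SlabSmooth T v)
    (h : DerivBound T (r + 1) K v) {v' : ℝ → ℝ → ℂ} {e : ℝ × ℝ} (he : ‖e‖ ≤ 1)
    (hv' : ∀ p ∈ Icc 0 T ×ˢ (univ : Set ℝ),
      fderivWithin ℝ (fun p : ℝ × ℝ => v p.1 p.2) (Icc 0 T ×ˢ univ) p e = v' p.1 p.2) :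
    DerivBound T r K v' := by
  intro k hk p hp
  set U : ℝ × ℝ → ℂ := fun p => v p.1 p.2
  set S : Set (ℝ × ℝ) := Icc 0 T ×ˢ univ
  set A : ((ℝ × ℝ) →L[ℝ] ℂ) →L[ℝ] ℂ := ContinuousLinearMap.apply ℝ ℂ e
  have hA : ‖A‖ ≤ 1 := A.opNorm_le_bound zero_le_one fun f => by
    calc ‖f e‖ ≤ ‖f‖ * ‖e‖ := f.le_opNorm e
      _ ≤ 1 * ‖f‖ := by nlinarith [norm_nonneg f]
  have hcongr : iteratedFDerivWithin ℝ k (fun p : ℝ × ℝ => v' p.1 p.2) S p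
      = iteratedFDerivWithin ℝ k (A ∘ fderivWithin ℝ U S) S p :=
    iteratedFDerivWithin_congr (fun p hp => (hv' p hp).symm) hp k
  rw [hcongr]
  have h1 := A.norm_iteratedFDerivWithin_comp_left (n := k) (N := ∞)
    ((hv.contDiffOn_fderivWithin hT) p hp) (uniqueDiffOn_slab hT) hp
    (by exact_mod_cast le_top)
  refine h1.trans ?_
  rw [norm_iteratedFDerivWithin_fderivWithin (uniqueDiffOn_slab hT) hp]
  have h2 := h (k + 1) (by lia) p hp
  have h3 := norm_nonneg (iteratedFDerivWithin ℝ (k + 1) U S p)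
  nlinarith

theorem DerivBound.spaceDeriv {K : ℝ} {r : ℕ} (hT : 0 < T) (hv : SlabSmooth T v)
    (h : DerivBound T (r + 1) K v) : DerivBound T r K (_root_.spaceDeriv v) :=
  h.of_fderivWithin hT hv (e := (0, 1)) (by simp [Prod.norm_def])
    fun p hp => hv.fderivWithin_space hp.1 p.2

theorem DerivBound.timeDeriv {K : ℝ} {r : ℕ} (hT : 0 < T) (hv : SlabSmooth T v)
    (h : DerivBound T (r + 1) K v) : DerivBound T r K (_root_.timeDeriv T v) :=
  h.of_fderivWithin hT hv (e := (1, 0)) (by simp [Prod.norm_def])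
    fun p hp => hv.fderivWithin_time hT hp.1 p.2

theorem DerivBound.iterate_spaceDeriv {K : ℝ} {r : ℕ} (hT : 0 < T) (hv : SlabSmooth T v)
    (k : ℕ) (h : DerivBound T (r + k) K v) : DerivBound T r K (_root_.spaceDeriv^[k] v) := by
  induction k generalizing r with
  | zero => exact h
  | succ k ih =>
    rw [Function.iterate_succ_apply']
    exact (ih (r := r + 1) (by rwa [add_assoc, add_comm 1])).spaceDeriv hT
      (hv.iterate_spaceDeriv hT k)

theorem DerivBound.norm_le {K : ℝ} {r : ℕ} (h : DerivBound T r K v) {t : ℝ} (ht : t ∈ Icc 0 T)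
    (x : ℝ) : ‖v t x‖ ≤ K := by
  simpa using h 0 (Nat.zero_le _) (t, x) ⟨ht, mem_univ _⟩

theorem DerivBound.norm_sub_le {K : ℝ} {r : ℕ} (hT : 0 < T) (hv : SlabSmooth T v)
    (h : DerivBound T (r + 1) K v) {s t : ℝ} (hs : s ∈ Icc 0 T) (ht : t ∈ Icc 0 T) (x : ℝ) :
    ‖v t x - v s x‖ ≤ K * |t - s| :=
  (convex_Icc 0 T).norm_image_sub_le_of_norm_hasDerivWithin_le
    (fun _ hy => hv.hasDerivWithinAt_time hT hy x)
    (fun _ hy => (h.timeDeriv hT hv).norm_le hy x) hs ht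

theorem DerivBound.norm_sub_sub_smul_le {K : ℝ} {r : ℕ} (hT : 0 < T) (hv : SlabSmooth T v)
    (h : DerivBound T (r + 2) K v) {s t : ℝ} (hs : s ∈ Icc 0 T) (ht : t ∈ Icc 0 T) (x : ℝ) :
    ‖v t x - v s x - (t - s) * _root_.timeDeriv T v s x‖ ≤ K * |t - s| * |t - s| := by
  have hK : 0 ≤ K := (norm_nonneg _).trans (h.norm_le hs x)
  have hsub : uIcc s t ⊆ Icc 0 T := uIcc_subset_Icc hs ht
  have key := (convex_uIcc s t).norm_image_sub_le_of_norm_hasDerivWithin_le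
    (f := fun y => v y x - (y - s : ℝ) * _root_.timeDeriv T v s x)
    (f' := fun y => _root_.timeDeriv T v y x - _root_.timeDeriv T v s x)
    (C := K * |t - s|) (x := s) (y := t) (fun y hy => ?_) (fun y hy => ?_)
    left_mem_uIcc right_mem_uIcc
  · have e : v t x - (t - s : ℝ) * _root_.timeDeriv T v s x
        - (v s x - (s - s : ℝ) * _root_.timeDeriv T v s x)
        = v t x - v s x - (t - s) * _root_.timeDeriv T v s x := by push_cast; ring
    rwa [e] at key
  · have h1 := (hv.hasDerivWithinAt_time hT (hsub hy) x).mono hsub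
    have h2 : HasDerivAt (fun y : ℝ => ((y - s : ℝ) : ℂ)) 1 y := by
      simpa using ((hasDerivAt_id y).sub_const s).ofReal_comp
    have h3 := h2.mul_const (_root_.timeDeriv T v s x)
    rw [one_mul] at h3
    exact h1.sub h3.hasDerivWithinAt
  · refine ((h.timeDeriv hT hv).norm_sub_le hT (hv.timeDeriv hT) hs (hsub hy) x).trans ?_
    exact mul_le_mul_of_nonneg_left (abs_sub_left_of_mem_uIcc hy) hK

theorem periodic_timeDeriv {L : ℝ} (hp : ∀ t ∈ Icc 0 T, Function.Periodic (v t) L) {t : ℝ}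
    (ht : t ∈ Icc 0 T) : Function.Periodic (timeDeriv T v t) L := fun x =>
  derivWithin_congr (fun s hs => hp s hs x) (hp t ht x)

end Slab

/-! ### Square integrable functions on the cells of a mesh -/

namespace Mesh

variable {a b : ℝ} {n : ℕ}

theorem left_lt_right (m : Mesh a b n) (j : Fin n) : m.left j < m.right j :=
  m.strictMono j.castSucc_lt_succ

theorem len_pos (m : Mesh a b n) (j : Fin n) : 0 < m.len j := sub_pos.2 (m.left_lt_right j)

theorem sum_len (m : Mesh a b n) : ∑ j, m.len j = b - a := by
  have h : ∀ (k : ℕ) (f : Fin (k + 1) → ℝ),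
      ∑ j : Fin k, (f j.succ - f j.castSucc) = f (Fin.last k) - f 0 := by
    intro k
    induction k with
    | zero => intro f; simp
    | succ k ih =>
      intro f
      rw [Fin.sum_univ_castSucc]
      have := ih fun i => f i.castSucc
      simp only [Fin.castSucc_zero, ← Fin.succ_castSucc] at this ⊢
      rw [this]; simp
  have := h n m.node
  rw [m.node_zero, m.node_last] at this
  exact this

theorem len_le_h (m : Mesh a b n) (j : Fin n) : m.len j ≤ m.h :=
  le_ciSup (Set.finite_range _).bddAbove j

theorem h_le (m : Mesh a b n) [NeZero n] : m.h ≤ b - a :=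
  ciSup_le fun j => by
    rw [← m.sum_len]
    exact Finset.single_le_sum (fun i _ => (m.len_pos i).le) (Finset.mem_univ j)

theorem h_pos (m : Mesh a b n) [NeZero n] : 0 < m.h := (m.len_pos 0).trans_le (m.len_le_h 0)

theorem h_le_mul_len (m : Mesh a b n) [NeZero n] {β : ℝ} (hβ : m.h / m.hmin < β) (j : Fin n) :
    m.h ≤ β * m.len j := by
  have h1 : m.hmin ≤ m.len j := ciInf_le (Set.finite_range _).bddBelow j
  have h2 : 0 < m.hmin := by
    obtain ⟨i, hi⟩ := exists_eq_ciInf_of_finite (f := m.len)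
    unfold hmin; rw [← hi]; exact m.len_pos i
  have hβ0 : 0 ≤ β := (div_nonneg m.h_pos.le h2.le).trans hβ.le
  rw [div_lt_iff₀ h2] at hβ
  exact hβ.le.trans (mul_le_mul_of_nonneg_left h1 hβ0)

end Mesh

theorem Continuous.memLp_two_Ioc {f : ℝ → ℂ} (hf : Continuous f) (l r : ℝ) :
    MemLp f 2 (volume.restrict (Ioc l r)) := by
  obtain ⟨C, hC⟩ := isCompact_Icc.exists_bound_of_continuousOn (s := Icc l r) hf.continuousOn
  exact MemLp.of_bound hf.aestronglyMeasurable C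
    ((ae_restrict_iff' measurableSet_Ioc).2 (.of_forall fun x hx => hC x (Ioc_subset_Icc_self hx)))

/-- The class of a continuous function in `L²(l, r)`. -/
def intervalL2 (l r : ℝ) : C(ℝ, ℂ) →ₗ[ℂ] Lp ℂ 2 (volume.restrict (Ioc l r)) where
  toFun f := (f.continuous.memLp_two_Ioc l r).toLp f
  map_add' _ _ := MemLp.toLp_add _ _
  map_smul' c _ := MemLp.toLp_const_smul c _

theorem inner_intervalL2 {l r : ℝ} (h : l ≤ r) (f g : C(ℝ, ℂ)) :
    ⟪intervalL2 l r f, intervalL2 l r g⟫_ℂ = ∫ x in l..r, conj (f x) * g x := by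
  rw [L2.inner_def, intervalIntegral.integral_of_le h]
  refine integral_congr_ae ?_
  filter_upwards [(f.continuous.memLp_two_Ioc l r).coeFn_toLp,
    (g.continuous.memLp_two_Ioc l r).coeFn_toLp] with x hf hg
  change ⟪((f.continuous.memLp_two_Ioc l r).toLp f) x,
    ((g.continuous.memLp_two_Ioc l r).toLp g) x⟫_ℂ = _
  rw [hf, hg, RCLike.inner_apply']

theorem norm_sq_intervalL2 {l r : ℝ} (h : l ≤ r) (f : C(ℝ, ℂ)) :
    ‖intervalL2 l r f‖ ^ 2 = ∫ x in l..r, ‖f x‖ ^ 2 := by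
  have h1 : ((‖intervalL2 l r f‖ ^ 2 : ℝ) : ℂ) = ((∫ x in l..r, ‖f x‖ ^ 2 : ℝ) : ℂ) := by
    rw [← intervalIntegral.integral_ofReal]
    push_cast
    have h2 : ⟪intervalL2 l r f, intervalL2 l r f⟫_ℂ = (‖intervalL2 l r f‖ : ℂ) ^ 2 :=
      inner_self_eq_norm_sq_to_K _
    rw [← h2, inner_intervalL2 h]
    refine intervalIntegral.integral_congr fun x _ => ?_
    simp only [RCLike.conj_mul]
    rfl
  exact_mod_cast h1

/-- The Hilbert space of square integrable functions on the cells of a mesh. As a product over the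
cells it treats all piecewise continuous functions without reference to values at the nodes. -/
abbrev CellL2 {a b : ℝ} {n : ℕ} (m : Mesh a b n) : Type :=
  PiLp 2 fun j : Fin n => Lp ℂ 2 (volume.restrict (Ioc (m.left j) (m.right j)))

section CellL2

variable {a b : ℝ} {n : ℕ} (m : Mesh a b n)

/-- The class in `CellL2 m` of a family of continuous functions, one for each cell. -/
def toL2 : (Fin n → C(ℝ, ℂ)) →ₗ[ℂ] CellL2 m :=
  (WithLp.linearEquiv 2 ℂ _).symm.toLinearMap ∘ₗ
    LinearMap.pi fun j => intervalL2 (m.left j) (m.right j) ∘ₗ LinearMap.proj j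

theorem inner_toL2 (f g : Fin n → C(ℝ, ℂ)) :
    ⟪toL2 m f, toL2 m g⟫_ℂ = ∑ j, ∫ x in m.left j..m.right j, conj (f j x) * g j x := by
  rw [PiLp.inner_apply]
  exact Finset.sum_congr rfl fun j _ => inner_intervalL2 (m.left_lt_right j).le _ _

theorem norm_sq_toL2 (f : Fin n → C(ℝ, ℂ)) :
    ‖toL2 m f‖ ^ 2 = ∑ j, ∫ x in m.left j..m.right j, ‖f j x‖ ^ 2 := by
  rw [PiLp.norm_sq_eq_of_L2]
  exact Finset.sum_congr rfl fun j _ => norm_sq_intervalL2 (m.left_lt_right j).le _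

theorem integral_norm_sq_le_norm_sq_toL2 (f : Fin n → C(ℝ, ℂ)) (j : Fin n) :
    ∫ x in m.left j..m.right j, ‖f j x‖ ^ 2 ≤ ‖toL2 m f‖ ^ 2 := by
  rw [norm_sq_toL2]
  exact Finset.single_le_sum (f := fun j => ∫ x in m.left j..m.right j, ‖f j x‖ ^ 2)
    (fun i _ => intervalIntegral.integral_nonneg (m.left_lt_right i).le fun x _ => by positivity)
    (Finset.mem_univ j)

theorem norm_toL2_mono {f g : Fin n → C(ℝ, ℂ)}
    (h : ∀ j, ∀ x ∈ Icc (m.left j) (m.right j), ‖f j x‖ ≤ ‖g j x‖) :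
    ‖toL2 m f‖ ≤ ‖toL2 m g‖ := by
  refine le_of_sq_le_sq ?_ (norm_nonneg _)
  rw [norm_sq_toL2, norm_sq_toL2]
  refine Finset.sum_le_sum fun j _ => ?_
  refine intervalIntegral.integral_mono_on (m.left_lt_right j).le
    (Continuous.intervalIntegrable (by fun_prop) _ _)
    (Continuous.intervalIntegrable (by fun_prop) _ _) fun x hx => ?_
  exact pow_le_pow_left₀ (norm_nonneg _) (h j x hx) 2

theorem norm_toL2_le_add {f g₁ g₂ : Fin n → C(ℝ, ℂ)} {c₁ c₂ : ℝ} (h₁ : 0 ≤ c₁) (h₂ : 0 ≤ c₂)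
    (h : ∀ j, ∀ x ∈ Icc (m.left j) (m.right j),
      ‖f j x‖ ≤ c₁ * ‖g₁ j x‖ + c₂ * ‖g₂ j x‖) :
    ‖toL2 m f‖ ≤ c₁ * ‖toL2 m g₁‖ + c₂ * ‖toL2 m g₂‖ := by
  let A : (Fin n → C(ℝ, ℂ)) → (Fin n → C(ℝ, ℂ)) := fun g j =>
    ⟨fun x => ((‖g j x‖ : ℝ) : ℂ), by fun_prop⟩
  have hA : ∀ g, ‖toL2 m (A g)‖ ≤ ‖toL2 m g‖ := fun g =>
    norm_toL2_mono m fun j x _ => by simp [A]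
  have h1 : ‖toL2 m f‖ ≤ ‖toL2 m ((c₁ : ℂ) • A g₁ + (c₂ : ℂ) • A g₂)‖ := by
    refine norm_toL2_mono m fun j x hx => (h j x hx).trans ?_
    have e : ((c₁ : ℂ) • A g₁ + (c₂ : ℂ) • A g₂) j x
        = ((c₁ * ‖g₁ j x‖ + c₂ * ‖g₂ j x‖ : ℝ) : ℂ) := by simp [A]
    rw [e, Complex.norm_real]
    exact le_abs_self _
  refine h1.trans ?_
  rw [map_add, map_smul, map_smul]
  refine (norm_add_le _ _).trans ?_
  rw [norm_smul, norm_smul, Complex.norm_real, Complex.norm_real, Real.norm_of_nonneg h₁,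
    Real.norm_of_nonneg h₂]
  gcongr
  exacts [hA _, hA _]

theorem norm_toL2_le_mul {f g : Fin n → C(ℝ, ℂ)} {c : ℝ} (hc : 0 ≤ c)
    (h : ∀ j, ∀ x ∈ Icc (m.left j) (m.right j), ‖f j x‖ ≤ c * ‖g j x‖) :
    ‖toL2 m f‖ ≤ c * ‖toL2 m g‖ := by
  have := norm_toL2_le_add m (g₁ := g) (g₂ := g) hc le_rfl
    fun j x hx => (h j x hx).trans (by simp)
  simpa using this

theorem norm_toL2_le_of_integral_le {f : Fin n → C(ℝ, ℂ)} {c : ℝ} (hc : 0 ≤ c)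
    (h : ∀ j, ∫ x in m.left j..m.right j, ‖f j x‖ ^ 2 ≤ c ^ 2 * m.len j) :
    ‖toL2 m f‖ ≤ c * Real.sqrt (b - a) := by
  have hba : 0 ≤ b - a := m.sum_len ▸ Finset.sum_nonneg fun j _ => (m.len_pos j).le
  refine le_of_sq_le_sq ?_ (by positivity)
  rw [norm_sq_toL2, mul_pow, Real.sq_sqrt hba, ← m.sum_len, Finset.mul_sum]
  exact Finset.sum_le_sum fun j _ => h j

theorem norm_toL2_le {f : Fin n → C(ℝ, ℂ)} {c : ℝ} (hc : 0 ≤ c)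
    (h : ∀ j, ∀ x ∈ Icc (m.left j) (m.right j), ‖f j x‖ ≤ c) :
    ‖toL2 m f‖ ≤ c * Real.sqrt (b - a) := by
  refine norm_toL2_le_of_integral_le m hc fun j => ?_
  have h1 : ∫ x in m.left j..m.right j, ‖f j x‖ ^ 2 ≤ ∫ _ in m.left j..m.right j, c ^ 2 :=
    intervalIntegral.integral_mono_on (m.left_lt_right j).le
      (Continuous.intervalIntegrable (by fun_prop) _ _)
      (Continuous.intervalIntegrable (by fun_prop) _ _) fun x hx =>
      pow_le_pow_left₀ (norm_nonneg _) (h j x hx) 2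
  rw [intervalIntegral.integral_const, smul_eq_mul] at h1
  exact h1.trans (le_of_eq (mul_comm _ _))

/-- The class in `CellL2 m` of a globally defined function; zero if it is not continuous. -/
def funL2 (g : ℝ → ℂ) : CellL2 m :=
  open Classical in if h : Continuous g then toL2 m fun _ => ⟨g, h⟩ else 0

theorem funL2_eq {g : ℝ → ℂ} (h : Continuous g) : funL2 m g = toL2 m fun _ => ⟨g, h⟩ :=
  dif_pos h

/-! ### Piecewise polynomials and the inverse inequality -/

/-- A polynomial as a continuous function of a real variable. -/
def polyC : ℂ[X] →ₗ[ℂ] C(ℝ, ℂ) where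
  toFun p := ⟨fun x => p.eval (x : ℂ), by fun_prop⟩
  map_add' p r := by ext x; simp
  map_smul' c p := by ext x; simp

@[simp] theorem polyC_apply (p : ℂ[X]) (x : ℝ) : polyC p x = p.eval (x : ℂ) := rfl

/-- The class of a piecewise polynomial in `CellL2 m`. -/
def polyL2 : PiecewisePoly n →ₗ[ℂ] CellL2 m := toL2 m ∘ₗ polyC.compLeft (Fin n)

theorem polyL2_eq (v : PiecewisePoly n) : polyL2 m v = toL2 m fun j => polyC (v j) := rfl

theorem l2Error_eq {g : ℝ → ℂ} (hg : Continuous g) (v : PiecewisePoly n) :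
    l2Error m g v = ‖funL2 m g - polyL2 m v‖ := by
  rw [funL2_eq m hg, polyL2_eq, ← map_sub, l2Error, ← Real.sqrt_sq (norm_nonneg (toL2 m _)),
    norm_sq_toL2]
  rfl

/-- The polynomial with complex conjugate coefficients. -/
def conjPoly (p : ℂ[X]) : ℂ[X] := p.map (starRingEnd ℂ)

theorem eval_conjPoly (p : ℂ[X]) (x : ℝ) :
    (conjPoly p).eval (x : ℂ) = conj (p.eval (x : ℂ)) := by
  have h := Polynomial.eval_map_apply (f := starRingEnd ℂ) (p := p) (x : ℂ)
  rwa [Complex.conj_ofReal] at h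

theorem derivative_conjPoly (p : ℂ[X]) : (conjPoly p).derivative = conjPoly p.derivative :=
  Polynomial.derivative_map _ _

theorem natDegree_conjPoly (p : ℂ[X]) : (conjPoly p).natDegree = p.natDegree :=
  Polynomial.natDegree_map _

theorem conjPoly_conjPoly (p : ℂ[X]) : conjPoly (conjPoly p) = p := by
  unfold conjPoly; rw [Polynomial.map_map]; simp

theorem Polynomial.eq_zero_of_integral_norm_sq_eq_zero {l r : ℝ} (hlr : l < r) {p : ℂ[X]}
    (h : ∫ x in l..r, ‖p.eval (x : ℂ)‖ ^ 2 = 0) : p = 0 := by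
  have hz : ∀ x ∈ Icc l r, p.eval (x : ℂ) = 0 := by
    by_contra! hcon
    obtain ⟨x, hx, hne⟩ := hcon
    have hc : Continuous fun x : ℝ => ‖p.eval (x : ℂ)‖ ^ 2 := by fun_prop
    have := intervalIntegral.integral_pos hlr hc.continuousOn
      (fun y _ => by positivity) ⟨x, hx, by positivity⟩
    exact this.ne' h
  refine Polynomial.eq_zero_of_infinite_isRoot p ?_
  refine ((Icc_infinite hlr).image (Complex.ofReal_injective.injOn)).mono ?_
  rintro _ ⟨x, hx, rfl⟩
  exact hz x hx

/-- Polynomials of degree less than `N` in terms of their coefficients. -/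
def coeffPoly (N : ℕ) : (Fin N → ℂ) →ₗ[ℂ] ℂ[X] :=
  (Polynomial.degreeLT ℂ N).subtype ∘ₗ (Polynomial.degreeLTEquiv ℂ N).symm.toLinearMap

theorem coeffPoly_injective (N : ℕ) : Function.Injective (coeffPoly N) :=
  Subtype.val_injective.comp (Polynomial.degreeLTEquiv ℂ N).symm.injective

theorem coeffPoly_degree_lt (N : ℕ) (c : Fin N → ℂ) : (coeffPoly N c).degree < N :=
  Polynomial.mem_degreeLT.1 ((Polynomial.degreeLTEquiv ℂ N).symm c).2

theorem exists_coeffPoly {N : ℕ} {p : ℂ[X]} (hp : p.degree < N) : ∃ c, coeffPoly N c = p :=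
  ⟨Polynomial.degreeLTEquiv ℂ N ⟨p, Polynomial.mem_degreeLT.2 hp⟩, by simp [coeffPoly]⟩

theorem degree_lt_of_natDegree_le {q : ℕ} {p : ℂ[X]} (hp : p.natDegree ≤ q) :
    p.degree < (q + 1 : ℕ) :=
  (Polynomial.degree_le_natDegree).trans_lt (by exact_mod_cast Nat.lt_succ_of_le hp)

theorem natDegree_coeffPoly_le (q : ℕ) (c : Fin (q + 1) → ℂ) :
    (coeffPoly (q + 1) c).natDegree ≤ q := by
  have h := coeffPoly_degree_lt (q + 1) c
  by_cases h0 : coeffPoly (q + 1) c = 0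
  · rw [h0]; simp
  · exact Nat.lt_succ_iff.1 ((Polynomial.natDegree_lt_iff_degree_lt h0).2 h)

theorem coeff_coeffPoly {N : ℕ} (c : Fin N → ℂ) (k : Fin N) :
    (coeffPoly N c).coeff k = c k := by
  have := congrFun ((Polynomial.degreeLTEquiv ℂ N).apply_symm_apply c) k
  exact this

/-- On the unit interval the supremum of a polynomial is bounded by its `L²` norm, since both are
norms on a finite dimensional space. -/
theorem exists_sup_le_integral_unit (q : ℕ) : ∃ C > 0, ∀ p : ℂ[X], p.natDegree ≤ q →
    ∀ y ∈ Icc (0 : ℝ) 1,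
      ‖p.eval (y : ℂ)‖ ^ 2 ≤ C * ∫ x in (0 : ℝ)..1, ‖p.eval (x : ℂ)‖ ^ 2 := by
  let f : (Fin (q + 1) → ℂ) →ₗ[ℂ] Lp ℂ 2 (volume.restrict (Ioc (0 : ℝ) 1)) :=
    intervalL2 0 1 ∘ₗ polyC ∘ₗ coeffPoly (q + 1)
  have hf : ∀ c, ‖f c‖ ^ 2 = ∫ x in (0 : ℝ)..1, ‖(coeffPoly (q + 1) c).eval (x : ℂ)‖ ^ 2 :=
    fun c => norm_sq_intervalL2 zero_le_one _
  have hker : f.ker = ⊥ := by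
    rw [LinearMap.ker_eq_bot']
    intro c hc
    have h0 := hf c
    rw [hc, norm_zero, zero_pow two_ne_zero] at h0
    have := Polynomial.eq_zero_of_integral_norm_sq_eq_zero zero_lt_one h0.symm
    exact coeffPoly_injective _ (this.trans (map_zero _).symm)
  obtain ⟨K, hK, hanti⟩ := f.exists_antilipschitzWith hker
  refine ⟨((q + 1) * K) ^ 2, by positivity, fun p hp y hy => ?_⟩
  obtain ⟨c, rfl⟩ := exists_coeffPoly (degree_lt_of_natDegree_le hp)
  rw [← hf, ← mul_pow]
  refine pow_le_pow_left₀ (norm_nonneg _) ?_ 2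
  have h1 : ‖c‖ ≤ K * ‖f c‖ := by simpa using hanti.le_mul_dist c 0
  rw [Polynomial.eval_eq_sum_range' (Nat.lt_succ_of_le hp), ← Fin.sum_univ_eq_sum_range
    (fun k => (coeffPoly (q + 1) c).coeff k * (y : ℂ) ^ k)]
  calc _ ≤ ∑ k : Fin (q + 1), ‖(coeffPoly (q + 1) c).coeff k * (y : ℂ) ^ (k : ℕ)‖ :=
        norm_sum_le _ _
    _ ≤ ∑ _k : Fin (q + 1), ‖c‖ := by
        refine Finset.sum_le_sum fun k _ => ?_
        rw [coeff_coeffPoly, norm_mul, norm_pow, Complex.norm_real, Real.norm_of_nonneg hy.1]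
        exact mul_le_of_le_one_right (norm_nonneg _) (pow_le_one₀ hy.1 hy.2) |>.trans
          (norm_le_pi_norm c k)
    _ = (q + 1) * ‖c‖ := by simp
    _ ≤ _ := by rw [mul_assoc]; gcongr

/-- The inverse inequality between the supremum and the `L²` norm of a polynomial, with the
correct scaling in the length of the interval. -/
theorem exists_inverse_inequality (q : ℕ) : ∃ C > 0, ∀ l r : ℝ, l < r → ∀ p : ℂ[X],
    p.natDegree ≤ q → ∀ x ∈ Icc l r,
      ‖p.eval (x : ℂ)‖ ^ 2 ≤ C / (r - l) * ∫ x in l..r, ‖p.eval (x : ℂ)‖ ^ 2 := by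
  obtain ⟨C, hC, h⟩ := exists_sup_le_integral_unit q
  refine ⟨C, hC, fun l r hlr p hp x hx => ?_⟩
  have hd : 0 < r - l := sub_pos.2 hlr
  set p' : ℂ[X] := p.comp (Polynomial.C ((r - l : ℝ) : ℂ) * Polynomial.X + Polynomial.C (l : ℂ))
  have hp' : p'.natDegree ≤ q := by
    refine (Polynomial.natDegree_comp_le).trans ?_
    calc _ ≤ p.natDegree * 1 := by gcongr; compute_degree
      _ ≤ q := by simpa using hp
  have he : ∀ y : ℝ, p'.eval (y : ℂ) = p.eval ((((r - l) * y + l : ℝ)) : ℂ) := fun y => by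
    simp [p']
  have h1 := h p' hp' ((x - l) / (r - l))
    ⟨div_nonneg (by linarith [hx.1]) hd.le, (div_le_one hd).2 (by linarith [hx.2])⟩
  have e1 : (r - l) * ((x - l) / (r - l)) + l = x := by field_simp; ring
  simp only [he, e1] at h1
  refine h1.trans (le_of_eq ?_)
  rw [intervalIntegral.integral_comp_mul_add (fun y : ℝ => ‖p.eval (y : ℂ)‖ ^ 2) hd.ne' l]
  simp only [mul_zero, mul_one, zero_add, sub_add_cancel, smul_eq_mul]
  ring

theorem polyL2_injective (m : Mesh a b n) : Function.Injective (polyL2 m) := by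
  rw [injective_iff_map_eq_zero]
  intro v hv
  funext j
  have h1 := integral_norm_sq_le_norm_sq_toL2 m (fun j => polyC (v j)) j
  rw [← polyL2_eq, hv, norm_zero, zero_pow two_ne_zero] at h1
  refine Polynomial.eq_zero_of_integral_norm_sq_eq_zero (m.left_lt_right j) (le_antisymm h1 ?_)
  exact intervalIntegral.integral_nonneg (m.left_lt_right j).le fun x _ => by positivity

theorem InVh.sub {q : ℕ} {v w : PiecewisePoly n} (hv : InVh q v) (hw : InVh q w) :
    InVh q (v - w) := fun j =>
  (Polynomial.natDegree_sub_le _ _).trans (max_le (hv j) (hw j))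

theorem InVh.smul {q : ℕ} {v : PiecewisePoly n} (c : ℂ) (hv : InVh q v) :
    InVh q (c • v) := fun j => (Polynomial.natDegree_smul_le _ _).trans (hv j)

theorem polyL2_eq_sum {q : ℕ} {v : PiecewisePoly n} (hv : InVh q v) :
    polyL2 m v = ∑ j, ∑ k ∈ Finset.range (q + 1),
      (v j).coeff k • polyL2 m (Pi.single j (Polynomial.X ^ k)) := by
  have h : v = ∑ j, ∑ k ∈ Finset.range (q + 1),
      (v j).coeff k • (Pi.single j (Polynomial.X ^ k) : PiecewisePoly n) := by
    funext i
    rw [Finset.sum_apply, Finset.sum_eq_single i]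
    · rw [Finset.sum_apply]
      conv_lhs => rw [(v i).as_sum_range' (q + 1) (Nat.lt_succ_of_le (hv i))]
      refine Finset.sum_congr rfl fun k _ => ?_
      simp [Polynomial.smul_X_eq_monomial]
    · intro j _ hj
      simp [Finset.sum_apply, Pi.single_eq_of_ne hj.symm]
    · simp
  conv_lhs => rw [h]
  simp only [map_sum, map_smul]

/-- A curve of piecewise polynomials is differentiable in `L²` if its coefficients are. -/
theorem hasDerivWithinAt_polyL2 {q : ℕ} {P : ℝ → PiecewisePoly n} {P' : PiecewisePoly n}
    {S : Set ℝ} {t : ℝ} (ht : t ∈ S) (hP : ∀ s ∈ S, InVh q (P s)) (hP' : InVh q P')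
    (hd : ∀ j k, HasDerivWithinAt (fun s => (P s j).coeff k) ((P' j).coeff k) S t) :
    HasDerivWithinAt (fun s => polyL2 m (P s)) (polyL2 m P') S t := by
  rw [polyL2_eq_sum m hP']
  have : HasDerivWithinAt (fun s => ∑ j, ∑ k ∈ Finset.range (q + 1),
      (P s j).coeff k • polyL2 m (Pi.single j (Polynomial.X ^ k))) (∑ j,
      ∑ k ∈ Finset.range (q + 1), (P' j).coeff k • polyL2 m (Pi.single j (Polynomial.X ^ k)))
      S t := by
    refine HasDerivWithinAt.fun_sum fun j _ => HasDerivWithinAt.fun_sum fun k _ => ?_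
    exact (hd j k).smul_const _
  exact this.congr (fun s hs => polyL2_eq_sum m (hP s hs)) (polyL2_eq_sum m (hP t ht))

end CellL2

/-! ### The bilinear form of the scheme -/

section Form

variable {a b : ℝ} {n : ℕ}

/-- Coefficientwise complex conjugation of a piecewise polynomial. -/
def conjPP (v : PiecewisePoly n) : PiecewisePoly n := fun j => conjPoly (v j)

theorem conjPP_conjPP (v : PiecewisePoly n) : conjPP (conjPP v) = v :=
  funext fun j => conjPoly_conjPoly (v j)

theorem conjPP_add (v w : PiecewisePoly n) : conjPP (v + w) = conjPP v + conjPP w :=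
  funext fun _ => Polynomial.map_add _

theorem conjPP_smul (c : ℂ) (v : PiecewisePoly n) : conjPP (c • v) = conj c • conjPP v :=
  funext fun _ => Polynomial.map_smul _ _

theorem InVh.conjPP {q : ℕ} {v : PiecewisePoly n} (hv : InVh q v) : InVh q (conjPP v) :=
  fun j => (natDegree_conjPoly (v j)).le.trans (hv j)

theorem inner_polyL2_toL2 (m : Mesh a b n) (Φ : PiecewisePoly n) (f : Fin n → C(ℝ, ℂ)) :
    ⟪polyL2 m Φ, toL2 m f⟫_ℂ
      = ∑ j, ∫ x in m.left j..m.right j, f j x * (conjPP Φ j).eval (x : ℂ) := by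
  rw [polyL2_eq, inner_toL2]
  refine Finset.sum_congr rfl fun j _ => intervalIntegral.integral_congr fun x _ => ?_
  simp only [polyC_apply, conjPP, eval_conjPoly, mul_comm]

variable [NeZero n] (m : Mesh a b n)

/-- The bilinear form of the second equation of the scheme, summed over the cells. -/
def dgForm : PiecewisePoly n →ₗ[ℂ] PiecewisePoly n →ₗ[ℂ] ℂ :=
  LinearMap.mk₂ ℂ (fun u ψ => ∑ j, ((∫ x in m.left j..m.right j,
      (u j).eval (x : ℂ) * (ψ j).derivative.derivative.eval (x : ℂ)) + boundary2 m u (ψ j) j))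
    (fun u v ψ => by
      rw [← Finset.sum_add_distrib]
      refine Finset.sum_congr rfl fun j _ => ?_
      simp only [Pi.add_apply, Polynomial.eval_add, add_mul]
      rw [intervalIntegral.integral_add (Continuous.intervalIntegrable (by fun_prop) _ _)
        (Continuous.intervalIntegrable (by fun_prop) _ _)]
      simp only [boundary2, fluxU, fluxUx, Pi.add_apply, Polynomial.eval_add,
        Polynomial.derivative_add]
      ring)
    (fun c u ψ => by
      rw [smul_eq_mul, Finset.mul_sum]
      refine Finset.sum_congr rfl fun j _ => ?_
      simp only [Pi.smul_apply, Polynomial.eval_smul, smul_eq_mul, mul_assoc]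
      rw [intervalIntegral.integral_const_mul]
      simp only [boundary2, fluxU, fluxUx, Pi.smul_apply, Polynomial.eval_smul,
        Polynomial.derivative_smul, smul_eq_mul]
      ring)
    (fun u v ψ => by
      rw [← Finset.sum_add_distrib]
      refine Finset.sum_congr rfl fun j _ => ?_
      simp only [Pi.add_apply, Polynomial.eval_add, Polynomial.derivative_add, mul_add]
      rw [intervalIntegral.integral_add (Continuous.intervalIntegrable (by fun_prop) _ _)
        (Continuous.intervalIntegrable (by fun_prop) _ _)]
      simp only [boundary2, Polynomial.eval_add, Polynomial.derivative_add]
      ring)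
    (fun c u ψ => by
      rw [smul_eq_mul, Finset.mul_sum]
      refine Finset.sum_congr rfl fun j _ => ?_
      simp only [Pi.smul_apply, Polynomial.eval_smul, Polynomial.derivative_smul, smul_eq_mul,
        mul_left_comm _ c]
      rw [intervalIntegral.integral_const_mul]
      simp only [boundary2, Polynomial.eval_smul, Polynomial.derivative_smul, smul_eq_mul]
      ring)

theorem dgForm_apply (u ψ : PiecewisePoly n) :
    dgForm m u ψ = ∑ j, ((∫ x in m.left j..m.right j,
      (u j).eval (x : ℂ) * (ψ j).derivative.derivative.eval (x : ℂ)) + boundary2 m u (ψ j) j) :=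
  rfl

theorem integral_second_derivative_sub (w φ : ℂ[X]) (l r : ℝ) :
    (∫ x in l..r, w.eval (x : ℂ) * φ.derivative.derivative.eval (x : ℂ))
      - ∫ x in l..r, φ.eval (x : ℂ) * w.derivative.derivative.eval (x : ℂ)
    = (w.eval (r : ℂ) * φ.derivative.eval (r : ℂ) - φ.eval (r : ℂ) * w.derivative.eval (r : ℂ))
      - (w.eval (l : ℂ) * φ.derivative.eval (l : ℂ)
        - φ.eval (l : ℂ) * w.derivative.eval (l : ℂ)) := by
  rw [← intervalIntegral.integral_sub (Continuous.intervalIntegrable (by fun_prop) _ _)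
    (Continuous.intervalIntegrable (by fun_prop) _ _)]
  have hd : ∀ (p : ℂ[X]) (x : ℝ), HasDerivAt (fun y : ℝ => p.eval (y : ℂ))
      (p.derivative.eval (x : ℂ)) x := fun p x => (p.hasDerivAt (x : ℂ)).comp_ofReal
  refine intervalIntegral.integral_eq_sub_of_hasDerivAt
    (f := fun x : ℝ => w.eval (x : ℂ) * φ.derivative.eval (x : ℂ)
      - φ.eval (x : ℂ) * w.derivative.eval (x : ℂ)) (fun x _ => ?_)
    (Continuous.intervalIntegrable (by fun_prop) _ _)
  refine (((hd w x).mul (hd φ.derivative x)).sub ((hd φ x).mul (hd w.derivative x))).congr_deriv ?_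
  ring

/-- Because of the alternating fluxes, the form of the first equation of the scheme is the
transpose of the form of the second one. -/
theorem dgForm_eq_first (φ w : PiecewisePoly n) :
    dgForm m φ w = ∑ j, ((∫ x in m.left j..m.right j,
      (w j).eval (x : ℂ) * (φ j).derivative.derivative.eval (x : ℂ)) - boundary1 m w (φ j) j) := by
  rw [dgForm_apply, ← sub_eq_zero, ← Finset.sum_sub_distrib]
  set G : Fin n → ℂ := fun j =>
    fluxUx m φ j * (w j).eval (m.right j : ℂ) - fluxU m φ j * (w j).derivative.eval (m.right j : ℂ)
  have hG : ∑ j, G (j - 1) = ∑ j, G j := (Equiv.subRight (1 : Fin n)).sum_comp G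
  rw [← sub_eq_zero.2 hG.symm, ← Finset.sum_sub_distrib]
  refine Finset.sum_congr rfl fun j _ => ?_
  have h := integral_second_derivative_sub (w j) (φ j) (m.left j) (m.right j)
  simp only [G, boundary1, boundary2, fluxU, fluxUx, fluxW, fluxWx, sub_add_cancel] at h ⊢
  linear_combination -h

theorem dgForm_conjPP (u ψ : PiecewisePoly n) :
    dgForm m (conjPP u) (conjPP ψ) = conj (dgForm m u ψ) := by
  rw [dgForm_apply, dgForm_apply, map_sum]
  refine Finset.sum_congr rfl fun j _ => ?_
  rw [map_add]
  congr 1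
  · simp only [intervalIntegral.integral_of_le (m.left_lt_right j).le]
    rw [← integral_conj]
    refine integral_congr_ae (.of_forall fun x => ?_)
    simp only [conjPP, derivative_conjPoly, eval_conjPoly, map_mul]
  · simp only [boundary2, fluxU, fluxUx, conjPP, derivative_conjPoly, eval_conjPoly, map_mul,
      map_add, map_sub]

/-- The energy identity: the second equation, with a defect `μ`, turns the form of the first
equation, tested with `u`, into `‖w‖²`. -/
theorem dgForm_conjPP_self {q : ℕ} {u w : PiecewisePoly n} {μ : CellL2 m} (hw : InVh q w)
    (h : ∀ Ψ, InVh q Ψ →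
      ⟪polyL2 m Ψ, polyL2 m w⟫_ℂ = dgForm m u (conjPP Ψ) + ⟪polyL2 m Ψ, μ⟫_ℂ) :
    dgForm m (conjPP u) w = ((‖polyL2 m w‖ ^ 2 : ℝ) : ℂ) - ⟪μ, polyL2 m w⟫_ℂ := by
  have h1 := h w hw
  have h2 := dgForm_conjPP m u (conjPP w)
  rw [conjPP_conjPP] at h2
  rw [h2, ← sub_eq_iff_eq_add.2 h1, map_sub, inner_conj_symm, inner_conj_symm,
    inner_self_eq_norm_sq_to_K]
  push_cast
  rfl

/-- The steady problem `i u + u_xxxx = f`, `w = u_xx` in the discontinuous Galerkin space, for a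
right hand side `f` in `L²`. -/
structure SteadyDG (q : ℕ) (f : CellL2 m) (u w : PiecewisePoly n) : Prop where
  mem_u : InVh q u
  mem_w : InVh q w
  eq1 : ∀ Φ, InVh q Φ →
    I * ⟪polyL2 m Φ, polyL2 m u⟫_ℂ + dgForm m (conjPP Φ) w = ⟪polyL2 m Φ, f⟫_ℂ
  eq2 : ∀ Ψ, InVh q Ψ → ⟪polyL2 m Ψ, polyL2 m w⟫_ℂ = dgForm m u (conjPP Ψ)

variable {m}

theorem SecondEq.inner_eq {q : ℕ} {u w : PiecewisePoly n} (h : SecondEq m q u w)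
    {Ψ : PiecewisePoly n} (hΨ : InVh q Ψ) :
    ⟪polyL2 m Ψ, polyL2 m w⟫_ℂ = dgForm m u (conjPP Ψ) := by
  rw [polyL2_eq m w, inner_polyL2_toL2, dgForm_apply]
  refine Finset.sum_congr rfl fun j _ => ?_
  have h1 := h j (conjPP Ψ j) (hΨ.conjPP j)
  rw [intervalIntegral.integral_sub (Continuous.intervalIntegrable (by fun_prop) _ _)
    (Continuous.intervalIntegrable (by fun_prop) _ _)] at h1
  simp only [polyC_apply]
  linear_combination h1

/-- The first equation of the scheme, summed over the cells and tested with the conjugate of `Φ`: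
`v` stands for the factor of `i` and `g` for the remaining terms. -/
theorem first_eq_inner {q : ℕ} {v w : PiecewisePoly n} {g : Fin n → C(ℝ, ℂ)}
    (h : ∀ (j : Fin n) (φ : ℂ[X]), φ.natDegree ≤ q →
      ∫ x in m.left j..m.right j, (I * (v j).eval (x : ℂ) * φ.eval (x : ℂ)
        + (w j).eval (x : ℂ) * φ.derivative.derivative.eval (x : ℂ) + g j x * φ.eval (x : ℂ))
        = boundary1 m w φ j) {Φ : PiecewisePoly n} (hΦ : InVh q Φ) :
    I * ⟪polyL2 m Φ, polyL2 m v⟫_ℂ + dgForm m (conjPP Φ) w + ⟪polyL2 m Φ, toL2 m g⟫_ℂ = 0 := by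
  rw [polyL2_eq m v, inner_polyL2_toL2, inner_polyL2_toL2, dgForm_eq_first, Finset.mul_sum,
    ← Finset.sum_add_distrib, ← Finset.sum_add_distrib]
  refine Finset.sum_eq_zero fun j _ => ?_
  have h1 := h j (conjPP Φ j) (hΦ.conjPP j)
  simp only [mul_assoc] at h1
  rw [intervalIntegral.integral_add (Continuous.intervalIntegrable (by fun_prop) _ _)
    (Continuous.intervalIntegrable (by fun_prop) _ _),
    intervalIntegral.integral_add (Continuous.intervalIntegrable (by fun_prop) _ _)
    (Continuous.intervalIntegrable (by fun_prop) _ _), intervalIntegral.integral_const_mul] at h1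
  simp only [polyC_apply]
  linear_combination h1

theorem IsSteadyDG.steadyDG {q : ℕ} {u₀ : ℝ → ℂ} {u w : PiecewisePoly n}
    (h : IsSteadyDG m q u₀ u w) (hc : Continuous fun x => I * u₀ x + iteratedDeriv 4 u₀ x) :
    SteadyDG m q (funL2 m fun x => I * u₀ x + iteratedDeriv 4 u₀ x) u w where
  mem_u := h.mem_u
  mem_w := h.mem_w
  eq1 Φ hΦ := by
    have h1 := first_eq_inner (m := m) (v := u) (w := w)
      (g := fun _ => -⟨fun x => I * u₀ x + iteratedDeriv 4 u₀ x, hc⟩) (q := q)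
      (fun j φ hφ => by
        rw [← h.eq1 j φ hφ]
        refine intervalIntegral.integral_congr fun x _ => ?_
        simp only [ContinuousMap.coe_neg, ContinuousMap.coe_mk, Pi.neg_apply]
        ring) hΦ
    have h2 : toL2 m (fun _ => -(⟨fun x => I * u₀ x + iteratedDeriv 4 u₀ x, hc⟩ : C(ℝ, ℂ)))
        = -funL2 m fun x => I * u₀ x + iteratedDeriv 4 u₀ x := by
      rw [funL2_eq m hc, ← map_neg]; rfl
    rw [h2, inner_neg_right] at h1
    linear_combination h1
  eq2 Ψ hΨ := h.eq2.inner_eq hΨ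

/-! ### The steady problem: stability and existence -/

namespace SteadyDG

variable {q : ℕ} {f f' : CellL2 m} {u u' w w' : PiecewisePoly n}

theorem sub (h : SteadyDG m q f u w) (h' : SteadyDG m q f' u' w') :
    SteadyDG m q (f - f') (u - u') (w - w') where
  mem_u := h.mem_u.sub h'.mem_u
  mem_w := h.mem_w.sub h'.mem_w
  eq1 Φ hΦ := by
    simp only [map_sub, inner_sub_right]
    linear_combination h.eq1 Φ hΦ - h'.eq1 Φ hΦ
  eq2 Ψ hΨ := by
    simp only [map_sub, inner_sub_right, LinearMap.sub_apply]
    linear_combination h.eq2 Ψ hΨ - h'.eq2 Ψ hΨ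

theorem smul (c : ℂ) (h : SteadyDG m q f u w) : SteadyDG m q (c • f) (c • u) (c • w) where
  mem_u := h.mem_u.smul c
  mem_w := h.mem_w.smul c
  eq1 Φ hΦ := by
    simp only [map_smul, inner_smul_right, smul_eq_mul]
    linear_combination c * h.eq1 Φ hΦ
  eq2 Ψ hΨ := by
    simp only [map_smul, inner_smul_right, LinearMap.smul_apply, smul_eq_mul]
    linear_combination c * h.eq2 Ψ hΨ

theorem dgForm_self (h : SteadyDG m q f u w) :
    dgForm m (conjPP u) w = ((‖polyL2 m w‖ ^ 2 : ℝ) : ℂ) := by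
  have := dgForm_conjPP_self m (μ := 0) h.mem_w fun Ψ hΨ => by
    rw [inner_zero_right, add_zero]; exact h.eq2 Ψ hΨ
  rwa [inner_zero_left, sub_zero] at this

theorem energy (h : SteadyDG m q f u w) :
    I * ((‖polyL2 m u‖ ^ 2 : ℝ) : ℂ) + ((‖polyL2 m w‖ ^ 2 : ℝ) : ℂ) = ⟪polyL2 m u, f⟫_ℂ := by
  have h1 := h.eq1 u h.mem_u
  rw [h.dgForm_self, inner_self_eq_norm_sq_to_K] at h1
  rw [← h1]
  push_cast
  rfl

theorem norm_le (h : SteadyDG m q f u w) : ‖polyL2 m u‖ ≤ ‖f‖ := by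
  have h1 := congrArg Complex.im h.energy
  simp only [Complex.add_im, Complex.mul_im, Complex.I_re, Complex.I_im, Complex.ofReal_im,
    Complex.ofReal_re, zero_mul, one_mul, zero_add, add_zero] at h1
  have h2 : ‖polyL2 m u‖ ^ 2 ≤ ‖polyL2 m u‖ * ‖f‖ := by
    rw [h1]
    exact ((le_abs_self _).trans (Complex.abs_im_le_norm _)).trans (norm_inner_le_norm _ _)
  by_contra! hlt
  have := norm_nonneg f
  nlinarith

theorem norm_w_sq_le (h : SteadyDG m q f u w) : ‖polyL2 m w‖ ^ 2 ≤ ‖f‖ * ‖f‖ := by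
  have h1 := congrArg Complex.re h.energy
  simp only [Complex.add_re, Complex.mul_re, Complex.I_re, Complex.I_im, Complex.ofReal_im,
    Complex.ofReal_re, zero_mul, one_mul, zero_add, sub_zero] at h1
  rw [h1]
  calc _ ≤ ‖polyL2 m u‖ * ‖f‖ :=
        ((le_abs_self _).trans (Complex.abs_re_le_norm _)).trans (norm_inner_le_norm _ _)
    _ ≤ _ := by gcongr; exact h.norm_le

end SteadyDG

/-- In finite dimension, a bilinear form without left kernel represents every functional. -/
theorem LinearMap.surjective_of_forall_eq_zero {E : Type*} [AddCommGroup E] [Module ℂ E]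
    [FiniteDimensional ℂ E] (A : E →ₗ[ℂ] E →ₗ[ℂ] ℂ) (h : ∀ x, A x = 0 → x = 0)
    (f : E →ₗ[ℂ] ℂ) : ∃ x, A x = f :=
  (LinearMap.injective_iff_surjective_of_finrank_eq_finrank
    (V₂ := Module.Dual ℂ E) (f := A) Subspace.dual_finrank_eq.symm).1
    ((injective_iff_map_eq_zero A).2 h) f

/-- The steady problem is solvable: by stability the associated linear map is injective, and the
space of trial functions and the space of test functions have the same dimension. -/
theorem exists_steadyDG (m : Mesh a b n) (q : ℕ) (f : CellL2 m) :
    ∃ u w, SteadyDG m q f u w := by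
  let c : (Fin n → Fin (q + 1) → ℂ) →ₗ[ℂ] PiecewisePoly n := (coeffPoly (q + 1)).compLeft (Fin n)
  have hc : ∀ x, InVh q (c x) := fun x j => natDegree_coeffPoly_le q (x j)
  have hc' : ∀ v, InVh q v → ∃ x, c x = v := fun v hv => by
    choose x hx using fun j => exists_coeffPoly (degree_lt_of_natDegree_le (hv j))
    exact ⟨x, funext hx⟩
  have hcinj : ∀ x, c x = 0 → x = 0 := fun x hx => funext fun j =>
    coeffPoly_injective _ ((congrFun hx j).trans (map_zero _).symm)
  -- The pair of equations as a bilinear form; the test functions enter through conjugation.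
  let A : ((Fin n → Fin (q + 1) → ℂ) × (Fin n → Fin (q + 1) → ℂ)) →ₗ[ℂ]
      ((Fin n → Fin (q + 1) → ℂ) × (Fin n → Fin (q + 1) → ℂ)) →ₗ[ℂ] ℂ :=
    LinearMap.mk₂ ℂ (fun X Y =>
      I * ⟪polyL2 m (conjPP (c Y.1)), polyL2 m (c X.1)⟫_ℂ + dgForm m (c Y.1) (c X.2)
        + (⟪polyL2 m (conjPP (c Y.2)), polyL2 m (c X.2)⟫_ℂ - dgForm m (c X.1) (c Y.2)))
      (fun X X' Y => by
        simp only [Prod.fst_add, Prod.snd_add, map_add, inner_add_right, LinearMap.add_apply]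
        ring)
      (fun k X Y => by
        simp only [Prod.smul_fst, Prod.smul_snd, map_smul, inner_smul_right,
          LinearMap.smul_apply, smul_eq_mul]
        ring)
      (fun X Y Y' => by
        simp only [Prod.fst_add, Prod.snd_add, map_add, conjPP_add, inner_add_left,
          LinearMap.add_apply]
        ring)
      (fun k X Y => by
        simp only [Prod.smul_fst, Prod.smul_snd, map_smul, conjPP_smul, inner_smul_left,
          LinearMap.smul_apply, smul_eq_mul, RCLike.conj_conj]
        ring)
  have hA : ∀ X Y, A X Y = I * ⟪polyL2 m (conjPP (c Y.1)), polyL2 m (c X.1)⟫_ℂ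
      + dgForm m (c Y.1) (c X.2)
      + (⟪polyL2 m (conjPP (c Y.2)), polyL2 m (c X.2)⟫_ℂ - dgForm m (c X.1) (c Y.2)) :=
    fun X Y => rfl
  have key : ∀ X (f : CellL2 m), (∀ Y, A X Y = ⟪polyL2 m (conjPP (c Y.1)), f⟫_ℂ) →
      SteadyDG m q f (c X.1) (c X.2) := fun X f h =>
    { mem_u := hc _
      mem_w := hc _
      eq1 := fun Φ hΦ => by
        obtain ⟨y, hy⟩ := hc' _ hΦ.conjPP
        have h0 : conjPP (0 : PiecewisePoly n) = 0 := by
          simpa using conjPP_smul 0 (0 : PiecewisePoly n)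
        have := h (y, 0)
        rw [hA] at this
        simpa [hy, conjPP_conjPP, h0] using this
      eq2 := fun Ψ hΨ => by
        obtain ⟨y, hy⟩ := hc' _ hΨ.conjPP
        have h0 : conjPP (0 : PiecewisePoly n) = 0 := by
          simpa using conjPP_smul 0 (0 : PiecewisePoly n)
        have := h (0, y)
        rw [hA] at this
        simpa [hy, conjPP_conjPP, h0, sub_eq_zero] using this }
  let F : ((Fin n → Fin (q + 1) → ℂ) × (Fin n → Fin (q + 1) → ℂ)) →ₗ[ℂ] ℂ :=
    { toFun := fun Y => ⟪polyL2 m (conjPP (c Y.1)), f⟫_ℂ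
      map_add' := fun Y Y' => by
        simp only [Prod.fst_add, map_add, conjPP_add, inner_add_left]
      map_smul' := fun k Y => by
        simp only [Prod.smul_fst, map_smul, conjPP_smul, inner_smul_left, RCLike.conj_conj,
          smul_eq_mul, RingHom.id_apply] }
  obtain ⟨X, hX⟩ := LinearMap.surjective_of_forall_eq_zero A (fun X hX => by
    have hs := key X 0 fun Y => by rw [hX, inner_zero_right]; rfl
    have h1 := hs.norm_le
    have h2 := hs.norm_w_sq_le
    rw [norm_zero] at h1 h2
    have e1 : c X.1 = 0 := polyL2_injective m (by
      rw [map_zero]; exact norm_le_zero_iff.1 h1)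
    have e2 : c X.2 = 0 := polyL2_injective m (by
      rw [map_zero]
      exact norm_eq_zero.1 (pow_eq_zero_iff two_ne_zero |>.1
        (le_antisymm (by simpa using h2) (sq_nonneg _))))
    exact Prod.ext (hcinj _ e1) (hcinj _ e2)) F
  exact ⟨_, _, key X f fun Y => by rw [hX]; rfl⟩

end Form

/-! ### Local projections and their approximation properties -/

theorem Polynomial.exists_derivative_eq (p : ℂ[X]) :
    ∃ P : ℂ[X], P.derivative = p ∧ P.natDegree ≤ p.natDegree + 1 := by
  refine ⟨∑ k ∈ Finset.range (p.natDegree + 1),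
    Polynomial.monomial (k + 1) (p.coeff k / (k + 1)), ?_, ?_⟩
  · rw [Polynomial.derivative_sum]
    conv_rhs => rw [p.as_sum_range]
    refine Finset.sum_congr rfl fun k _ => ?_
    have : ((k : ℂ) + 1) ≠ 0 := by exact_mod_cast k.succ_ne_zero
    rw [Polynomial.derivative_monomial]
    push_cast
    rw [div_mul_cancel₀ _ this]
  · refine Polynomial.natDegree_sum_le_of_forall_le _ _ fun k hk => ?_
    exact (Polynomial.natDegree_monomial_le _).trans (by have := Finset.mem_range.1 hk; lia)

theorem Polynomial.hasDerivAt_ofReal (p : ℂ[X]) (x : ℝ) :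
    HasDerivAt (fun y : ℝ => p.eval (y : ℂ)) (p.derivative.eval (x : ℂ)) x :=
  (p.hasDerivAt (x : ℂ)).comp_ofReal

/-- Taylor approximation of a complex valued function and of its derivative. -/
theorem exists_taylor_polynomial (e : ℝ) (q : ℕ) : ∀ {g : ℝ → ℂ} {G : ℝ}, ContDiff ℝ ∞ g →
    (∀ x, ‖iteratedDeriv (q + 1) g x‖ ≤ G) → ∃ P : ℂ[X], P.natDegree ≤ q ∧
      (∀ x : ℝ, ‖g x - P.eval (x : ℂ)‖ ≤ G * |x - e| ^ (q + 1)) ∧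
      ∀ x : ℝ, ‖deriv g x - P.derivative.eval (x : ℂ)‖ ≤ G * |x - e| ^ q := by
  have step : ∀ {g : ℝ → ℂ} {G : ℝ} {P : ℂ[X]} {k : ℕ}, ContDiff ℝ ∞ g → 0 ≤ G →
      g e = P.eval (e : ℂ) → (∀ x : ℝ, ‖deriv g x - P.derivative.eval (x : ℂ)‖ ≤ G * |x - e| ^ k) →
      ∀ x : ℝ, ‖g x - P.eval (x : ℂ)‖ ≤ G * |x - e| ^ (k + 1) := by
    intro g G P k hg hG he hd x
    have h := (convex_uIcc e x).norm_image_sub_le_of_norm_hasDerivWithin_le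
      (f := fun y : ℝ => g y - P.eval (y : ℂ)) (C := G * |x - e| ^ k)
      (fun y _ => ((hg.differentiable (by simp) y).hasDerivAt.sub
        (P.hasDerivAt_ofReal y)).hasDerivWithinAt)
      (fun y hy => (hd y).trans (mul_le_mul_of_nonneg_left
        (pow_le_pow_left₀ (abs_nonneg _) (abs_sub_left_of_mem_uIcc hy) k) hG))
      left_mem_uIcc right_mem_uIcc
    rw [he, sub_self, sub_zero] at h
    rwa [pow_succ, ← mul_assoc]
  induction q with
  | zero =>
    intro g G hg hb
    have hd : ∀ x : ℝ, ‖deriv g x - (Polynomial.C (g e)).derivative.eval (x : ℂ)‖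
        ≤ G * |x - e| ^ 0 := fun x => by
      simpa [iteratedDeriv_one] using hb x
    exact ⟨Polynomial.C (g e), by simp,
      step hg ((norm_nonneg _).trans (hb e)) (by simp) hd, hd⟩
  | succ q ih =>
    intro g G hg hb
    have hg' : ContDiff ℝ ∞ (deriv g) := (contDiff_infty_iff_deriv.1 hg).2
    obtain ⟨P, hP, h1, -⟩ := ih hg' fun x => by
      rw [← iteratedDeriv_succ']; exact hb x
    obtain ⟨Q, hQ, hQd⟩ := P.exists_derivative_eq
    set R : ℂ[X] := Q + Polynomial.C (g e - Q.eval (e : ℂ))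
    have hR : R.derivative = P := by simp [R, hQ]
    have hd : ∀ x : ℝ, ‖deriv g x - R.derivative.eval (x : ℂ)‖ ≤ G * |x - e| ^ (q + 1) := by
      rw [hR]; exact h1
    refine ⟨R, ?_, step hg ((norm_nonneg _).trans (hb e)) (by simp [R]) hd, hd⟩
    refine (Polynomial.natDegree_add_le _ _).trans (max_le (by lia) (by simp))

/-- The correction that makes a projection orthogonal to polynomials of degree less than `N`. The
weight `(x - e)²` keeps the value and the slope at `e`. -/
theorem exists_weighted_orthogonal {l r : ℝ} (hlr : l < r) (e : ℝ) (N : ℕ) {E : ℝ → ℂ}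
    (hE : Continuous E) : ∃ p : ℂ[X], p.degree < N ∧ ∀ φ : ℂ[X], φ.degree < N →
      ∫ x in l..r, ((x - e : ℝ) : ℂ) ^ 2 * (p.eval (x : ℂ) * φ.eval (x : ℂ))
        = ∫ x in l..r, E x * φ.eval (x : ℂ) := by
  let A : (Fin N → ℂ) →ₗ[ℂ] (Fin N → ℂ) →ₗ[ℂ] ℂ :=
    LinearMap.mk₂ ℂ (fun c d => ∫ x in l..r, ((x - e : ℝ) : ℂ) ^ 2
        * ((coeffPoly N c).eval (x : ℂ) * (coeffPoly N d).eval (x : ℂ)))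
      (fun c c' d => by
        simp only [map_add, Polynomial.eval_add, add_mul, mul_add]
        exact intervalIntegral.integral_add (Continuous.intervalIntegrable (by fun_prop) _ _)
          (Continuous.intervalIntegrable (by fun_prop) _ _))
      (fun k c d => by
        simp only [map_smul, Polynomial.eval_smul, smul_eq_mul, mul_assoc, mul_left_comm _ k]
        exact intervalIntegral.integral_const_mul _ _)
      (fun c d d' => by
        simp only [map_add, Polynomial.eval_add, mul_add]
        exact intervalIntegral.integral_add (Continuous.intervalIntegrable (by fun_prop) _ _)
          (Continuous.intervalIntegrable (by fun_prop) _ _))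
      (fun k c d => by
        simp only [map_smul, Polynomial.eval_smul, smul_eq_mul, mul_left_comm _ k]
        exact intervalIntegral.integral_const_mul _ _)
  have hA : ∀ c d, A c d = ∫ x in l..r, ((x - e : ℝ) : ℂ) ^ 2
        * ((coeffPoly N c).eval (x : ℂ) * (coeffPoly N d).eval (x : ℂ)) := fun c d => rfl
  let F : (Fin N → ℂ) →ₗ[ℂ] ℂ :=
    { toFun := fun d => ∫ x in l..r, E x * (coeffPoly N d).eval (x : ℂ)
      map_add' := fun d d' => by
        simp only [map_add, Polynomial.eval_add, mul_add]
        exact intervalIntegral.integral_add (Continuous.intervalIntegrable (by fun_prop) _ _)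
          (Continuous.intervalIntegrable (by fun_prop) _ _)
      map_smul' := fun k d => by
        simp only [map_smul, Polynomial.eval_smul, smul_eq_mul, mul_left_comm _ k,
          RingHom.id_apply]
        exact intervalIntegral.integral_const_mul _ _ }
  obtain ⟨c, hc⟩ := LinearMap.surjective_of_forall_eq_zero A (fun c hc => by
    obtain ⟨d, hd⟩ := exists_coeffPoly (N := N) (p := conjPoly (coeffPoly N c)) (by
      rw [conjPoly, Polynomial.degree_map]; exact coeffPoly_degree_lt N c)
    have h0 : A c d = 0 := by rw [hc]; rfl
    rw [hA, hd] at h0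
    set s : ℂ[X] := (Polynomial.X - Polynomial.C (e : ℂ)) * coeffPoly N c with hs
    have h1 : ((∫ x in l..r, ‖s.eval (x : ℂ)‖ ^ 2 : ℝ) : ℂ) = 0 := by
      rw [← intervalIntegral.integral_ofReal, ← h0]
      refine intervalIntegral.integral_congr fun x _ => ?_
      simp only [eval_conjPoly, Complex.mul_conj, Complex.normSq_eq_norm_sq, hs,
        Polynomial.eval_mul, Polynomial.eval_sub, Polynomial.eval_X, Polynomial.eval_C, norm_mul,
        mul_pow, ← Complex.ofReal_sub, Complex.norm_real, Real.norm_eq_abs, sq_abs]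
      push_cast
      ring
    have h2 := Polynomial.eq_zero_of_integral_norm_sq_eq_zero hlr (by exact_mod_cast h1)
    have h3 : coeffPoly N c = 0 := by
      rcases mul_eq_zero.1 h2 with h | h
      · exact absurd h (Polynomial.X_sub_C_ne_zero _)
      · exact h
    exact coeffPoly_injective N (h3.trans (map_zero _).symm)) F
  refine ⟨coeffPoly N c, coeffPoly_degree_lt N c, fun φ hφ => ?_⟩
  obtain ⟨d, rfl⟩ := exists_coeffPoly hφ
  rw [← hA, hc]
  rfl

/-- The local projection on one cell: it interpolates the value and the slope at the point `e` of
the cell and has an error orthogonal to the polynomials of degree at most `q - 2`. -/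
theorem exists_local_projection {q : ℕ} (hq : 1 ≤ q) {l r e h G : ℝ} (hlr : l < r)
    (he : e ∈ Icc l r) (hh : r - l ≤ h) {g : ℝ → ℂ} (hg : ContDiff ℝ ∞ g)
    (hG : ∀ x, ‖iteratedDeriv (q + 1) g x‖ ≤ G) :
    ∃ p : ℂ[X], p.natDegree ≤ q ∧ p.eval (e : ℂ) = g e ∧ p.derivative.eval (e : ℂ) = deriv g e ∧
      (∀ φ : ℂ[X], φ.degree < (q - 1 : ℕ) →
        ∫ x in l..r, p.eval (x : ℂ) * φ.eval (x : ℂ) = ∫ x in l..r, g x * φ.eval (x : ℂ)) ∧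
      ∫ x in l..r, ‖g x - p.eval (x : ℂ)‖ ^ 2 ≤ (2 * (G * h ^ (q + 1))) ^ 2 * (r - l) := by
  obtain ⟨P, hP, h1, h2⟩ := exists_taylor_polynomial e q hg hG
  have hG0 : 0 ≤ G := (norm_nonneg _).trans (hG e)
  have hh0 : 0 ≤ h := (sub_pos.2 hlr).le.trans hh
  have hgc : Continuous g := hg.continuous
  have hE : Continuous fun x : ℝ => g x - P.eval (x : ℂ) := by fun_prop
  obtain ⟨s, hs, hsE⟩ := exists_weighted_orthogonal hlr e (q - 1) hE
  set p : ℂ[X] := P + (Polynomial.X - Polynomial.C (e : ℂ)) ^ 2 * s with hp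
  have hpe : ∀ x : ℝ, p.eval (x : ℂ) = P.eval (x : ℂ) + ((x - e : ℝ) : ℂ) ^ 2 * s.eval (x : ℂ) :=
    fun x => by simp [hp]
  have habs : ∀ x ∈ Icc l r, |x - e| ≤ h := fun x hx =>
    abs_le.2 ⟨by linarith [hx.1, he.2], by linarith [hx.2, he.1]⟩
  -- Testing the orthogonality relation with `conj s` bounds the weighted norm of `s`.
  have hweight : ∫ x in l..r, (x - e) ^ 2 * ‖s.eval (x : ℂ)‖ ^ 2 ≤ (G * h ^ q) ^ 2 * (r - l) := by
    have t1 := hsE (conjPoly s) (by rw [conjPoly, Polynomial.degree_map]; exact hs)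
    have t2 : ((∫ x in l..r, (x - e) ^ 2 * ‖s.eval (x : ℂ)‖ ^ 2 : ℝ) : ℂ)
        = ∫ x in l..r, (g x - P.eval (x : ℂ)) * (conjPoly s).eval (x : ℂ) := by
      rw [← t1, ← intervalIntegral.integral_ofReal]
      refine intervalIntegral.integral_congr fun x _ => ?_
      simp only [eval_conjPoly, Complex.mul_conj, Complex.normSq_eq_norm_sq]
      push_cast
      ring
    have hX : 0 ≤ ∫ x in l..r, (x - e) ^ 2 * ‖s.eval (x : ℂ)‖ ^ 2 :=
      intervalIntegral.integral_nonneg hlr.le fun x _ => by positivity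
    have t3 := congrArg norm t2
    rw [Complex.norm_real, Real.norm_of_nonneg hX] at t3
    have t4 : ∫ x in l..r, (x - e) ^ 2 * ‖s.eval (x : ℂ)‖ ^ 2
        ≤ ∫ x in l..r, (1 / 2 * ((x - e) ^ 2 * ‖s.eval (x : ℂ)‖ ^ 2)
          + 1 / 2 * (G * h ^ q) ^ 2) := by
      rw [t3]
      refine (intervalIntegral.norm_integral_le_integral_norm hlr.le).trans ?_
      refine intervalIntegral.integral_mono_on hlr.le
        (Continuous.intervalIntegrable (by fun_prop) _ _)
        (Continuous.intervalIntegrable (by fun_prop) _ _) fun x hx => ?_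
      rw [norm_mul, eval_conjPoly, RCLike.norm_conj]
      have u1 : ‖g x - P.eval (x : ℂ)‖ ≤ (G * h ^ q) * |x - e| := by
        refine (h1 x).trans ?_
        rw [pow_succ, ← mul_assoc]
        have := habs x hx
        gcongr
      have u2 : ‖g x - P.eval (x : ℂ)‖ * ‖s.eval (x : ℂ)‖
          ≤ (G * h ^ q) * (|x - e| * ‖s.eval (x : ℂ)‖) := by
        rw [← mul_assoc]; gcongr
      have u3 : (|x - e| * ‖s.eval (x : ℂ)‖) ^ 2 = (x - e) ^ 2 * ‖s.eval (x : ℂ)‖ ^ 2 := by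
        rw [mul_pow, sq_abs]
      rw [← u3]
      nlinarith [sq_nonneg (G * h ^ q - |x - e| * ‖s.eval (x : ℂ)‖)]
    rw [intervalIntegral.integral_add (Continuous.intervalIntegrable (by fun_prop) _ _)
      (Continuous.intervalIntegrable (by fun_prop) _ _), intervalIntegral.integral_const_mul,
      intervalIntegral.integral_const, smul_eq_mul] at t4
    linarith
  refine ⟨p, ?_, ?_, ?_, fun φ hφ => ?_, ?_⟩
  · refine (Polynomial.natDegree_add_le _ _).trans (max_le hP ?_)
    by_cases hs0 : s = 0
    · simp [hs0]
    · have := (Polynomial.natDegree_lt_iff_degree_lt hs0).2 hs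
      refine (Polynomial.natDegree_mul_le).trans ?_
      have h3 : ((Polynomial.X - Polynomial.C (e : ℂ)) ^ 2).natDegree ≤ 2 := by compute_degree
      lia
  · have := h1 e
    rw [sub_self, abs_zero, zero_pow (by lia), mul_zero] at this
    rw [hpe, sub_self, Complex.ofReal_zero, zero_pow two_ne_zero, zero_mul, add_zero]
    exact (sub_eq_zero.1 (norm_le_zero_iff.1 this)).symm
  · have := h2 e
    rw [sub_self, abs_zero, zero_pow (by lia), mul_zero] at this
    have h3 : p.derivative.eval (e : ℂ) = P.derivative.eval (e : ℂ) := by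
      simp [hp, Polynomial.derivative_mul, Polynomial.derivative_pow]
    rw [h3]
    exact (sub_eq_zero.1 (norm_le_zero_iff.1 this)).symm
  · have t1 := hsE φ hφ
    simp only [sub_mul] at t1
    rw [intervalIntegral.integral_sub (Continuous.intervalIntegrable (by fun_prop) _ _)
      (Continuous.intervalIntegrable (by fun_prop) _ _)] at t1
    simp only [hpe, add_mul, mul_assoc]
    rw [intervalIntegral.integral_add (Continuous.intervalIntegrable (by fun_prop) _ _)
      (Continuous.intervalIntegrable (by fun_prop) _ _), t1]
    ring
  · calc ∫ x in l..r, ‖g x - p.eval (x : ℂ)‖ ^ 2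
        ≤ ∫ x in l..r, (2 * (G * h ^ (q + 1)) ^ 2
          + 2 * h ^ 2 * ((x - e) ^ 2 * ‖s.eval (x : ℂ)‖ ^ 2)) := by
          refine intervalIntegral.integral_mono_on hlr.le
            (Continuous.intervalIntegrable (by fun_prop) _ _)
            (Continuous.intervalIntegrable (by fun_prop) _ _) fun x hx => ?_
          have v1 : ‖g x - P.eval (x : ℂ)‖ ≤ G * h ^ (q + 1) :=
            (h1 x).trans (by have := habs x hx; gcongr)
          have v2 : ‖((x - e : ℝ) : ℂ) ^ 2 * s.eval (x : ℂ)‖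
              ≤ h * (|x - e| * ‖s.eval (x : ℂ)‖) := by
            rw [norm_mul, norm_pow, Complex.norm_real, Real.norm_eq_abs, sq, ← mul_assoc]
            have := habs x hx
            gcongr
          have v3 : ‖g x - p.eval (x : ℂ)‖
              ≤ G * h ^ (q + 1) + h * (|x - e| * ‖s.eval (x : ℂ)‖) := by
            rw [hpe, ← sub_sub]
            exact (norm_sub_le _ _).trans (add_le_add v1 v2)
          have v4 : (|x - e| * ‖s.eval (x : ℂ)‖) ^ 2 = (x - e) ^ 2 * ‖s.eval (x : ℂ)‖ ^ 2 := by
            rw [mul_pow, sq_abs]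
          rw [← v4]
          refine (pow_le_pow_left₀ (norm_nonneg _) v3 2).trans ?_
          nlinarith [sq_nonneg (G * h ^ (q + 1) - h * (|x - e| * ‖s.eval (x : ℂ)‖))]
      _ = 2 * (G * h ^ (q + 1)) ^ 2 * (r - l)
          + 2 * h ^ 2 * ∫ x in l..r, (x - e) ^ 2 * ‖s.eval (x : ℂ)‖ ^ 2 := by
          rw [intervalIntegral.integral_add (Continuous.intervalIntegrable (by fun_prop) _ _)
            (Continuous.intervalIntegrable (by fun_prop) _ _),
            intervalIntegral.integral_const, intervalIntegral.integral_const_mul, smul_eq_mul]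
          ring
      _ ≤ 2 * (G * h ^ (q + 1)) ^ 2 * (r - l) + 2 * h ^ 2 * ((G * h ^ q) ^ 2 * (r - l)) := by
          gcongr
      _ = _ := by ring

section Projection

variable {a b : ℝ} {n : ℕ} [NeZero n] {m : Mesh a b n}

theorem Mesh.eq_of_periodic (m : Mesh a b n) {g : ℝ → ℂ} (hg : Function.Periodic g (b - a))
    (j : Fin n) : g (m.left (j + 1)) = g (m.right j) := by
  obtain ⟨k, rfl⟩ : ∃ k, n = k + 1 := ⟨n - 1, (Nat.succ_pred (NeZero.ne n)).symm⟩
  by_cases hj : j = Fin.last k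
  · subst hj
    rw [Fin.last_add_one]
    have h1 : m.left 0 = a := by unfold Mesh.left; exact m.node_zero
    have h2 : m.right (Fin.last k) = b := by
      unfold Mesh.right; rw [Fin.succ_last]; exact m.node_last
    rw [h1, h2, ← hg a, add_sub_cancel]
  · congr 1
    unfold Mesh.left Mesh.right
    congr 1
    ext
    have hlt : j < Fin.last k := lt_of_le_of_ne (Fin.le_last j) hj
    simp [Fin.val_add_one_of_lt hlt]

theorem integral_mul_second_derivative {g : ℝ → ℂ} (hg : ContDiff ℝ ∞ g) (ψ : ℂ[X]) (l r : ℝ) :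
    (∫ x in l..r, iteratedDeriv 2 g x * ψ.eval (x : ℂ))
      = (∫ x in l..r, g x * ψ.derivative.derivative.eval (x : ℂ))
        + (deriv g r * ψ.eval (r : ℂ) - g r * ψ.derivative.eval (r : ℂ))
        - (deriv g l * ψ.eval (l : ℂ) - g l * ψ.derivative.eval (l : ℂ)) := by
  have hg' : ContDiff ℝ ∞ (deriv g) := (contDiff_infty_iff_deriv.1 hg).2
  have c0 := hg.continuous
  have c2 : Continuous (iteratedDeriv 2 g) := hg.continuous_iteratedDeriv 2 ENat.LEInfty.out
  have e2 : iteratedDeriv 2 g = deriv (deriv g) := by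
    rw [iteratedDeriv_succ, iteratedDeriv_one]
  have key := intervalIntegral.integral_eq_sub_of_hasDerivAt (a := l) (b := r)
    (f := fun x : ℝ => deriv g x * ψ.eval (x : ℂ) - g x * ψ.derivative.eval (x : ℂ))
    (f' := fun x : ℝ => iteratedDeriv 2 g x * ψ.eval (x : ℂ)
      - g x * ψ.derivative.derivative.eval (x : ℂ)) (fun x _ => by
        have d0 := (hg.differentiable (by simp) x).hasDerivAt
        have d1 := (hg'.differentiable (by simp) x).hasDerivAt
        refine ((d1.mul (ψ.hasDerivAt_ofReal x)).sub
          (d0.mul (ψ.derivative.hasDerivAt_ofReal x))).congr_deriv ?_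
        rw [e2]; ring) (Continuous.intervalIntegrable (by fun_prop) _ _)
  rw [intervalIntegral.integral_sub (Continuous.intervalIntegrable (by fun_prop) _ _)
    (Continuous.intervalIntegrable (by fun_prop) _ _)] at key
  linear_combination key

theorem degree_second_derivative_lt {q : ℕ} {ψ : ℂ[X]} (hψ : ψ.natDegree ≤ q) :
    ψ.derivative.derivative.degree < (q - 1 : ℕ) := by
  by_cases h0 : ψ.derivative.derivative = 0
  · rw [h0, Polynomial.degree_zero]; exact WithBot.bot_lt_coe _
  · rw [← Polynomial.natDegree_lt_iff_degree_lt h0]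
    have h1 : ψ.derivative.natDegree ≠ 0 := fun h => h0 (by
      rw [Polynomial.eq_C_of_natDegree_eq_zero h, Polynomial.derivative_C])
    have h2 := Polynomial.natDegree_derivative_lt h1
    have h3 : ψ.natDegree ≠ 0 := fun h => h1 (by
      rw [Polynomial.eq_C_of_natDegree_eq_zero h, Polynomial.derivative_C]; simp)
    have h4 := Polynomial.natDegree_derivative_lt h3
    lia

theorem deriv_periodic {g : ℝ → ℂ} {L : ℝ} (hg : Function.Periodic g L) :
    Function.Periodic (deriv g) L := fun x => by
  rw [← deriv_comp_add_const]
  congr 1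
  exact funext hg

/-- The projection for `u` interpolates at left end points, where the fluxes of `u` are taken, and
so is consistent with the second equation without any error. -/
theorem exists_projection_left {q : ℕ} (hq : 1 ≤ q) {g : ℝ → ℂ} {G : ℝ} (hg : ContDiff ℝ ∞ g)
    (hper : Function.Periodic g (b - a)) (hG : ∀ x, ‖iteratedDeriv (q + 1) g x‖ ≤ G) :
    ∃ p : PiecewisePoly n, InVh q p ∧
      (∀ Ψ, InVh q Ψ →
        dgForm m p (conjPP Ψ) = ⟪polyL2 m Ψ, funL2 m (iteratedDeriv 2 g)⟫_ℂ) ∧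
      ‖polyL2 m p - funL2 m g‖ ≤ 2 * (G * m.h ^ (q + 1)) * Real.sqrt (b - a) := by
  have hG0 : 0 ≤ G := (norm_nonneg _).trans (hG 0)
  have hh := m.h_pos
  choose p hp hpe hpd hpo hpn using fun j => exists_local_projection hq (m.left_lt_right j)
    (left_mem_Icc.2 (m.left_lt_right j).le) (m.len_le_h j) hg hG
  refine ⟨p, hp, fun Ψ hΨ => ?_, ?_⟩
  · rw [funL2_eq m (hg.continuous_iteratedDeriv 2 ENat.LEInfty.out), inner_polyL2_toL2,
      dgForm_apply]
    refine Finset.sum_congr rfl fun j _ => ?_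
    rw [hpo j _ (degree_second_derivative_lt (hΨ.conjPP j))]
    simp only [ContinuousMap.coe_mk]
    rw [integral_mul_second_derivative hg]
    simp only [boundary2, fluxU, fluxUx, sub_add_cancel, hpe, hpd, m.eq_of_periodic hper,
      m.eq_of_periodic (deriv_periodic hper)]
    ring
  · rw [norm_sub_rev, funL2_eq m hg.continuous, polyL2_eq, ← map_sub]
    exact norm_toL2_le_of_integral_le m (by positivity) hpn

/-- The projection for `w` interpolates at right end points, where the fluxes of `w` are taken. -/
theorem exists_projection_right {q : ℕ} (hq : 1 ≤ q) {g : ℝ → ℂ} {G : ℝ} (hg : ContDiff ℝ ∞ g)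
    (hper : Function.Periodic g (b - a)) (hG : ∀ x, ‖iteratedDeriv (q + 1) g x‖ ≤ G) :
    ∃ p : PiecewisePoly n, InVh q p ∧
      (∀ Φ, InVh q Φ →
        dgForm m (conjPP Φ) p = ⟪polyL2 m Φ, funL2 m (iteratedDeriv 2 g)⟫_ℂ) ∧
      ‖polyL2 m p - funL2 m g‖ ≤ 2 * (G * m.h ^ (q + 1)) * Real.sqrt (b - a) := by
  have hG0 : 0 ≤ G := (norm_nonneg _).trans (hG 0)
  have hh := m.h_pos
  choose p hp hpe hpd hpo hpn using fun j => exists_local_projection hq (m.left_lt_right j)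
    (right_mem_Icc.2 (m.left_lt_right j).le) (m.len_le_h j) hg hG
  refine ⟨p, hp, fun Φ hΦ => ?_, ?_⟩
  · rw [funL2_eq m (hg.continuous_iteratedDeriv 2 ENat.LEInfty.out), inner_polyL2_toL2,
      dgForm_eq_first]
    refine Finset.sum_congr rfl fun j _ => ?_
    rw [hpo j _ (degree_second_derivative_lt (hΦ.conjPP j))]
    simp only [ContinuousMap.coe_mk]
    rw [integral_mul_second_derivative hg]
    have e1 := m.eq_of_periodic hper (j - 1)
    have e2 := m.eq_of_periodic (deriv_periodic hper) (j - 1)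
    rw [sub_add_cancel] at e1 e2
    simp only [boundary1, fluxW, fluxWx, hpe, hpd, e1, e2]
    ring
  · rw [norm_sub_rev, funL2_eq m hg.continuous, polyL2_eq, ← map_sub]
    exact norm_toL2_le_of_integral_le m (by positivity) hpn

theorem le_of_sq_add_sq_le {x y D : ℝ} (hD : 0 ≤ D)
    (h : x ^ 2 + y ^ 2 ≤ 2 * (D * x + D * y)) : x ≤ 3 * D := by
  nlinarith [sq_nonneg (y - D)]

/-- Error estimate for the steady problem. -/
theorem SteadyDG.error_le {q : ℕ} (hq : 1 ≤ q) {g : ℝ → ℂ} {G : ℝ} (hg : ContDiff ℝ ∞ g)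
    (hper : Function.Periodic g (b - a)) (hG : ∀ x, ‖iteratedDeriv (q + 1) g x‖ ≤ G)
    (hG' : ∀ x, ‖iteratedDeriv (q + 3) g x‖ ≤ G) {f : CellL2 m}
    (hf : f = I • funL2 m g + funL2 m (iteratedDeriv 4 g)) {u w : PiecewisePoly n}
    (h : SteadyDG m q f u w) :
    ‖funL2 m g - polyL2 m u‖ ≤ 8 * Real.sqrt (b - a) * G * m.h ^ (q + 1) ∧
      ‖funL2 m (iteratedDeriv 2 g) - polyL2 m w‖ ≤ 8 * Real.sqrt (b - a) * G * m.h ^ (q + 1) := by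
  have hG0 : 0 ≤ G := (norm_nonneg _).trans (hG 0)
  have hh := m.h_pos
  have hg2 : ContDiff ℝ ∞ (iteratedDeriv 2 g) := by
    rw [iteratedDeriv_eq_iterate]; exact hg.iterate_deriv 2
  have hper2 : Function.Periodic (iteratedDeriv 2 g) (b - a) := by
    rw [iteratedDeriv_succ, iteratedDeriv_one]; exact deriv_periodic (deriv_periodic hper)
  have hiter : ∀ k, iteratedDeriv k (iteratedDeriv 2 g) = iteratedDeriv (k + 2) g := fun k => by
    simp only [iteratedDeriv_eq_iterate, Function.iterate_add_apply]
  obtain ⟨pu, hpu, hu1, hu2⟩ := exists_projection_left (m := m) hq hg hper hG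
  obtain ⟨pw, hpw, hw1, hw2⟩ := exists_projection_right (m := m) hq hg2 hper2
    fun x => by rw [hiter]; exact hG' x
  simp only [hiter, Nat.reduceAdd] at hw1
  set D := 2 * (G * m.h ^ (q + 1)) * Real.sqrt (b - a)
  have hD : 0 ≤ D := by positivity
  set μ := polyL2 m pw - funL2 m (iteratedDeriv 2 g)
  set η := polyL2 m pu - funL2 m g
  -- The error equations for the differences `pu - u` and `pw - w`.
  have e2 : ∀ Ψ, InVh q Ψ → ⟪polyL2 m Ψ, polyL2 m (pw - w)⟫_ℂ
      = dgForm m (pu - u) (conjPP Ψ) + ⟪polyL2 m Ψ, μ⟫_ℂ := fun Ψ hΨ => by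
    simp only [μ, map_sub, inner_sub_right, LinearMap.sub_apply]
    linear_combination -(h.eq2 Ψ hΨ) - hu1 Ψ hΨ
  have e3 := dgForm_conjPP_self m (hpw.sub h.mem_w) e2
  have hξ := hpu.sub h.mem_u
  have e1 : dgForm m (conjPP (pu - u)) (pw - w)
      = -I * ⟪polyL2 m (pu - u), polyL2 m (pu - u)⟫_ℂ + I * ⟪polyL2 m (pu - u), η⟫_ℂ := by
    have t1 := h.eq1 _ hξ
    have t2 := hw1 _ hξ
    rw [hf, inner_add_right, inner_smul_right] at t1
    have t3 : ⟪polyL2 m (pu - u), polyL2 m (pu - u)⟫_ℂ = ⟪polyL2 m (pu - u), polyL2 m pu⟫_ℂ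
        - ⟪polyL2 m (pu - u), polyL2 m u⟫_ℂ := by rw [← inner_sub_right, ← map_sub]
    rw [map_sub (dgForm m (conjPP (pu - u)))]
    simp only [η]
    rw [inner_sub_right, t3]
    linear_combination t2 - t1
  have e4 : ⟪polyL2 m (pu - u), polyL2 m (pu - u)⟫_ℂ = ((‖polyL2 m (pu - u)‖ ^ 2 : ℝ) : ℂ) := by
    rw [inner_self_eq_norm_sq_to_K]; push_cast; rfl
  rw [e3, e4] at e1
  set x := ‖polyL2 m (pu - u)‖
  set y := ‖polyL2 m (pw - w)‖
  have n1 : ‖⟪μ, polyL2 m (pw - w)⟫_ℂ‖ ≤ D * y :=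
    (norm_inner_le_norm _ _).trans (mul_le_mul_of_nonneg_right hw2 (norm_nonneg _))
  have n2 : ‖⟪polyL2 m (pu - u), η⟫_ℂ‖ ≤ D * x :=
    (norm_inner_le_norm _ _).trans ((mul_le_mul_of_nonneg_left hu2 (norm_nonneg _)).trans_eq
      (mul_comm _ _))
  have r1 := congrArg Complex.re e1
  have r2 := congrArg Complex.im e1
  simp only [Complex.sub_re, Complex.sub_im, Complex.add_re, Complex.add_im, Complex.mul_re,
    Complex.mul_im, Complex.neg_re, Complex.neg_im, Complex.I_re, Complex.I_im,
    Complex.ofReal_re, Complex.ofReal_im] at r1 r2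
  have a1 := abs_le.1 ((Complex.abs_re_le_norm _).trans n1)
  have a2 := abs_le.1 ((Complex.abs_im_le_norm _).trans n1)
  have a3 := abs_le.1 ((Complex.abs_re_le_norm _).trans n2)
  have a4 := abs_le.1 ((Complex.abs_im_le_norm _).trans n2)
  have hxy : x ^ 2 + y ^ 2 ≤ 2 * (D * x + D * y) := by linarith
  have hx : x ≤ 3 * D := le_of_sq_add_sq_le hD hxy
  have hy : y ≤ 3 * D := le_of_sq_add_sq_le (y := x) hD (by linarith)
  have hfin : 4 * D = 8 * Real.sqrt (b - a) * G * m.h ^ (q + 1) := by simp only [D]; ring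
  rw [← hfin]
  constructor
  · have : funL2 m g - polyL2 m u = polyL2 m (pu - u) - η := by simp only [η, map_sub]; abel
    rw [this]
    exact (norm_sub_le _ _).trans (by linarith)
  · have : funL2 m (iteratedDeriv 2 g) - polyL2 m w = polyL2 m (pw - w) - μ := by
      simp only [μ, map_sub]; abel
    rw [this]
    exact (norm_sub_le _ _).trans (by linarith)

end Projection

/-! ### The steady approximation of a smooth time dependent function -/

section Curves

variable {a b : ℝ} {n : ℕ}

theorem funL2_add (m : Mesh a b n) {g g' : ℝ → ℂ} (hg : Continuous g) (hg' : Continuous g') :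
    funL2 m (g + g') = funL2 m g + funL2 m g' := by
  rw [funL2_eq m hg, funL2_eq m hg', funL2_eq m (hg.add hg'), ← map_add]; rfl

theorem funL2_sub (m : Mesh a b n) {g g' : ℝ → ℂ} (hg : Continuous g) (hg' : Continuous g') :
    funL2 m (g - g') = funL2 m g - funL2 m g' := by
  rw [funL2_eq m hg, funL2_eq m hg', funL2_eq m (hg.sub hg'), ← map_sub]; rfl

theorem funL2_smul (m : Mesh a b n) (c : ℂ) {g : ℝ → ℂ} (hg : Continuous g) :
    funL2 m (c • g) = c • funL2 m g := by
  rw [funL2_eq m hg, funL2_eq m (hg.const_smul c), ← map_smul]; rfl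

theorem norm_funL2_le (m : Mesh a b n) {g : ℝ → ℂ} (hg : Continuous g) {c : ℝ} (hc : 0 ≤ c)
    (h : ∀ x, ‖g x‖ ≤ c) : ‖funL2 m g‖ ≤ c * Real.sqrt (b - a) := by
  rw [funL2_eq m hg]
  exact norm_toL2_le m hc fun _ x _ => h x

/-- The right hand side `i g + g_xxxx` of the steady problem solved by `g`. -/
def steadyRhs (g : ℝ → ℂ) : ℝ → ℂ := I • g + iteratedDeriv 4 g

theorem continuous_steadyRhs {g : ℝ → ℂ} (hg : ContDiff ℝ ∞ g) : Continuous (steadyRhs g) :=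
  (hg.continuous.const_smul I).add (hg.continuous_iteratedDeriv 4 ENat.LEInfty.out)

theorem funL2_steadyRhs (m : Mesh a b n) {g : ℝ → ℂ} (hg : ContDiff ℝ ∞ g) :
    funL2 m (steadyRhs g) = I • funL2 m g + funL2 m (iteratedDeriv 4 g) := by
  rw [steadyRhs, funL2_add m (hg.continuous.const_smul I)
    (hg.continuous_iteratedDeriv 4 ENat.LEInfty.out), funL2_smul m I hg.continuous]

theorem hasDerivWithinAt_of_norm_sub_le {H : Type*} [NormedAddCommGroup H] [NormedSpace ℝ H]
    {θ : ℝ → H} {v : H} {S : Set ℝ} {t C : ℝ}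
    (h : ∀ s ∈ S, ‖θ s - θ t - (s - t) • v‖ ≤ C * |s - t| * |s - t|) :
    HasDerivWithinAt θ v S t := by
  rw [hasDerivWithinAt_iff_isLittleO, Asymptotics.isLittleO_iff]
  intro c hc
  have hnear : ∀ᶠ s in 𝓝[S] t, |s - t| < c / (|C| + 1) := by
    refine mem_nhdsWithin_of_mem_nhds ?_
    exact Metric.ball_mem_nhds t (by positivity)
  filter_upwards [hnear, self_mem_nhdsWithin] with s hs hsS
  refine (h s hsS).trans (mul_le_mul_of_nonneg_right ?_ (abs_nonneg _))
  rw [lt_div_iff₀ (by positivity)] at hs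
  nlinarith [le_abs_self C, abs_nonneg (s - t)]

variable [NeZero n] {m : Mesh a b n} {q : ℕ} {T K : ℝ} {v : ℝ → ℝ → ℂ}

/-- Error of the steady approximation, and of its increments in time. -/
theorem SteadyDG.curve_error_le (hq : 1 ≤ q) (hT : 0 < T) (hv : SlabSmooth T v)
    (hper : ∀ t ∈ Icc 0 T, Function.Periodic (v t) (b - a)) (hK : DerivBound T (q + 4) K v)
    {R Z : ℝ → PiecewisePoly n}
    (hR : ∀ t ∈ Icc 0 T, SteadyDG m q (funL2 m (steadyRhs (v t))) (R t) (Z t)) :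
    (∀ t ∈ Icc 0 T, ‖funL2 m (v t) - polyL2 m (R t)‖
      ≤ 8 * Real.sqrt (b - a) * K * m.h ^ (q + 1)) ∧
    (∀ t ∈ Icc 0 T, ‖funL2 m (iteratedDeriv 2 (v t)) - polyL2 m (Z t)‖
      ≤ 8 * Real.sqrt (b - a) * K * m.h ^ (q + 1)) ∧
    ∀ s ∈ Icc 0 T, ∀ t ∈ Icc 0 T, ‖funL2 m (v t) - polyL2 m (R t)
      - (funL2 m (v s) - polyL2 m (R s))‖
      ≤ 8 * Real.sqrt (b - a) * K * m.h ^ (q + 1) * |t - s| := by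
  have hb : ∀ k, k ≤ q + 3 → ∀ t ∈ Icc 0 T, ∀ x, ‖iteratedDeriv k (v t) x‖ ≤ K := by
    intro k hk t ht x
    rw [iteratedDeriv_eq_iterate_spaceDeriv]
    exact (DerivBound.iterate_spaceDeriv (r := 0) hT hv k (hK.mono (by lia))).norm_le ht x
  have hi : ∀ k, k ≤ q + 3 → ∀ s ∈ Icc 0 T, ∀ t ∈ Icc 0 T, ∀ x,
      ‖iteratedDeriv k (v t - v s) x‖ ≤ K * |t - s| := by
    intro k hk s hs t ht x
    have hc : ∀ t ∈ Icc 0 T, ContDiffAt ℝ k (v t) x := fun t ht =>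
      ((hv.contDiff ht).of_le (by exact_mod_cast le_top)).contDiffAt
    rw [iteratedDeriv_sub (hc t ht) (hc s hs), iteratedDeriv_eq_iterate_spaceDeriv,
      iteratedDeriv_eq_iterate_spaceDeriv]
    exact (DerivBound.iterate_spaceDeriv (r := 0 + 1) hT hv k
      (hK.mono (by lia))).norm_sub_le hT (hv.iterate_spaceDeriv hT k) hs ht x
  have h1 := fun t (ht : t ∈ Icc 0 T) => (hR t ht).error_le hq (hv.contDiff ht) (hper t ht)
    (hb _ (by lia) t ht) (hb _ (by lia) t ht) (funL2_steadyRhs m (hv.contDiff ht))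
  refine ⟨fun t ht => (h1 t ht).1, fun t ht => (h1 t ht).2, fun s hs t ht => ?_⟩
  have cs := hv.contDiff hs
  have ct := hv.contDiff ht
  have cts : ContDiff ℝ ∞ (v t - v s) := ct.sub cs
  have hf : funL2 m (steadyRhs (v t)) - funL2 m (steadyRhs (v s))
      = I • funL2 m (v t - v s) + funL2 m (iteratedDeriv 4 (v t - v s)) := by
    rw [← funL2_steadyRhs m cts, ← funL2_sub m (continuous_steadyRhs ct)
      (continuous_steadyRhs cs)]
    congr 1
    funext x
    have hc : ∀ t ∈ Icc 0 T, ContDiffAt ℝ (4 : ℕ) (v t) x := fun t ht =>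
      ((hv.contDiff ht).of_le ENat.LEInfty.out).contDiffAt
    simp only [steadyRhs, Pi.sub_apply, Pi.add_apply, Pi.smul_apply, smul_eq_mul,
      iteratedDeriv_sub (hc t ht) (hc s hs)]
    ring
  have h2 := ((hR t ht).sub (hR s hs)).error_le hq cts
    (fun x => by simp only [Pi.sub_apply, hper t ht x, hper s hs x])
    (hi _ (by lia) s hs t ht) (hi _ (by lia) s hs t ht) hf
  have e : funL2 m (v t) - polyL2 m (R t) - (funL2 m (v s) - polyL2 m (R s))
      = funL2 m (v t - v s) - polyL2 m (R t - R s) := by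
    rw [funL2_sub m ct.continuous cs.continuous, map_sub]; abel
  rw [e]
  exact h2.1.trans (le_of_eq (by ring))

/-- By stability of the steady problem, the steady approximation of `v` is differentiable in time,
and its derivative is the steady approximation of `v_t`. -/
theorem SteadyDG.hasDerivWithinAt (hT : 0 < T) (hv : SlabSmooth T v)
    (hK : DerivBound T 6 K v) {R Z R' Z' : ℝ → PiecewisePoly n}
    (hR : ∀ t ∈ Icc 0 T, SteadyDG m q (funL2 m (steadyRhs (v t))) (R t) (Z t))
    (hR' : ∀ t ∈ Icc 0 T, SteadyDG m q (funL2 m (steadyRhs (timeDeriv T v t))) (R' t) (Z' t))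
    {t : ℝ} (ht : t ∈ Icc 0 T) :
    HasDerivWithinAt (fun s => polyL2 m (R s)) (polyL2 m (R' t)) (Icc 0 T) t := by
  have hK0 : 0 ≤ K := (norm_nonneg _).trans (hK.norm_le ht 0)
  refine hasDerivWithinAt_of_norm_sub_le (C := 2 * K * Real.sqrt (b - a)) fun s hs => ?_
  have cs := continuous_steadyRhs (hv.contDiff hs)
  have ct := continuous_steadyRhs (hv.contDiff ht)
  have ct' := continuous_steadyRhs ((hv.timeDeriv hT).contDiff ht)
  have h1 := (((hR s hs).sub (hR t ht)).sub ((hR' t ht).smul ((s - t : ℝ) : ℂ))).norm_le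
  rw [map_sub, map_sub, map_smul, Complex.coe_smul, ← funL2_smul m _ ct', ← funL2_sub m cs ct,
    ← funL2_sub m (cs.sub ct) (ct'.const_smul _)] at h1
  refine h1.trans ?_
  have hpt : ∀ x, ‖(steadyRhs (v s) - steadyRhs (v t)
      - ((s - t : ℝ) : ℂ) • steadyRhs (timeDeriv T v t)) x‖
      ≤ 2 * K * |s - t| * |s - t| := fun x => by
    have g0 := hK.mono (r' := 0 + 2) (by lia) |>.norm_sub_sub_smul_le hT hv ht hs x
    have g4 := (hK.iterate_spaceDeriv (r := 0 + 2) hT hv 4).norm_sub_sub_smul_le hT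
      (hv.iterate_spaceDeriv hT 4) ht hs x
    rw [hv.timeDeriv_iterate_spaceDeriv hT 4 ht] at g4
    have e : (steadyRhs (v s) - steadyRhs (v t)
        - ((s - t : ℝ) : ℂ) • steadyRhs (timeDeriv T v t)) x
        = I * (v s x - v t x - (s - t) * timeDeriv T v t x)
          + (spaceDeriv^[4] v s x - spaceDeriv^[4] v t x
            - (s - t) * spaceDeriv^[4] (timeDeriv T v) t x) := by
      simp only [steadyRhs, iteratedDeriv_eq_iterate_spaceDeriv, Pi.sub_apply, Pi.add_apply,
        Pi.smul_apply, smul_eq_mul]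
      push_cast
      ring
    rw [e]
    refine (norm_add_le _ _).trans ?_
    rw [norm_mul, Complex.norm_I, one_mul]
    linarith
  refine (norm_funL2_le m ((cs.sub ct).sub (ct'.const_smul _)) (by positivity) hpt).trans
    (le_of_eq (by ring))

end Curves

/-! ### Comparison of the scheme with the steady approximation -/

section Comparison

variable {a b : ℝ} {n : ℕ}

/-- The class in `CellL2 m` of a continuous function `N` of a piecewise polynomial. -/
def compL2 (m : Mesh a b n) (N : C(ℂ, ℂ)) (v : PiecewisePoly n) : CellL2 m :=
  toL2 m fun j => N.comp (polyC (v j))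

/-- The right hand side of the error equation: `N(u) - N(u_h) + i (ρ_t - ρ)`, where `ρ` and `ρ_t`
are the errors of the steady approximations `r` of `u` and `r'` of `u_t`. -/
def errorRhs (m : Mesh a b n) (N : C(ℂ, ℂ)) (u u' : ℝ → ℂ) (v r r' : PiecewisePoly n) :
    CellL2 m :=
  funL2 m (N ∘ u) - compL2 m N v
    + (I • (funL2 m u' - polyL2 m r') - I • (funL2 m u - polyL2 m r))

theorem norm_funL2_comp_sub_compL2_le (m : Mesh a b n) {N : C(ℂ, ℂ)} {S : Set ℂ} {L : ℝ}
    (hL : 0 ≤ L) (hN : IncrementLipschitz S N L) {g : ℝ → ℂ} (hg : Continuous g)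
    {v : PiecewisePoly n} (hgS : ∀ x, g x ∈ S)
    (hv : ∀ j, ∀ x ∈ Icc (m.left j) (m.right j), (v j).eval (x : ℂ) ∈ S) :
    ‖funL2 m (N ∘ g) - compL2 m N v‖ ≤ L * ‖funL2 m g - polyL2 m v‖ := by
  rw [funL2_eq m (N.continuous.comp hg), funL2_eq m hg, compL2, polyL2_eq, ← map_sub, ← map_sub]
  exact norm_toL2_le_mul m hL fun j x hx => hN.lip _ (hgS x) _ (hv j x hx)

/-- Increments of `N(g) - N(v)` between two times, where only the exact function `g` is known to
vary slowly: the increment of `v` is controlled by those of `g` and of the error. -/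
theorem norm_increment_funL2_comp_sub_compL2_le (m : Mesh a b n) {N : C(ℂ, ℂ)} {R L κ : ℝ}
    (hL : 0 ≤ L) (hR : 0 ≤ R) (hκ : 0 ≤ κ) (hN : IncrementLipschitz {z : ℂ | ‖z‖ ≤ R} N L)
    {g g' : ℝ → ℂ} (hg : Continuous g) (hg' : Continuous g') {v v' : PiecewisePoly n}
    (hgR : ∀ x, ‖g x‖ ≤ R) (hgR' : ∀ x, ‖g' x‖ ≤ R)
    (hv : ∀ j, ∀ x ∈ Icc (m.left j) (m.right j), ‖(v j).eval (x : ℂ)‖ ≤ R)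
    (hv' : ∀ j, ∀ x ∈ Icc (m.left j) (m.right j), ‖(v' j).eval (x : ℂ)‖ ≤ R)
    (hgg : ∀ x, ‖g x - g' x‖ ≤ κ) :
    ‖funL2 m (N ∘ g) - compL2 m N v - (funL2 m (N ∘ g') - compL2 m N v')‖
      ≤ L * (1 + 2 * R) * ‖funL2 m g - polyL2 m v - (funL2 m g' - polyL2 m v')‖
        + 2 * L * κ * ‖funL2 m g' - polyL2 m v'‖ := by
  rw [funL2_eq m (N.continuous.comp hg), funL2_eq m hg, funL2_eq m (N.continuous.comp hg'),
    funL2_eq m hg', compL2, compL2, polyL2_eq, polyL2_eq]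
  simp only [← map_sub]
  refine norm_toL2_le_add m (by positivity) (by positivity) fun j x hx => ?_
  refine (hN.lip₂ _ (hgR x) _ (hv j x hx) _ (hgR' x) _ (hv' j x hx)).trans ?_
  simp only [Pi.sub_apply, ContinuousMap.coe_sub, ContinuousMap.coe_mk, polyC_apply]
  set A := g x
  set B := (v j).eval (x : ℂ)
  set C := g' x
  set D := (v' j).eval (x : ℂ)
  have h1 : ‖B - D‖ ≤ ‖A - C‖ + ‖A - B - (C - D)‖ := by
    have : B - D = (A - C) - (A - B - (C - D)) := by ring
    rw [this]; exact norm_sub_le _ _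
  have h2 : ‖C - D‖ ≤ 2 * R :=
    (norm_sub_le _ _).trans (by linarith [hgR' x, hv' j x hx])
  have h3 := hgg x
  have h4 := norm_nonneg (C - D)
  have h5 := norm_nonneg (A - B - (C - D))
  have h6 : ‖C - D‖ * (‖A - C‖ + ‖B - D‖) ≤ 2 * κ * ‖C - D‖ + 2 * R * ‖A - B - (C - D)‖ := by
    have i1 : ‖A - C‖ + ‖B - D‖ ≤ 2 * κ + ‖A - B - (C - D)‖ := by linarith
    calc _ ≤ ‖C - D‖ * (2 * κ + ‖A - B - (C - D)‖) := by gcongr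
      _ = 2 * κ * ‖C - D‖ + ‖C - D‖ * ‖A - B - (C - D)‖ := by ring
      _ ≤ _ := by gcongr
  calc _ ≤ L * (‖A - B - (C - D)‖ + (2 * κ * ‖C - D‖ + 2 * R * ‖A - B - (C - D)‖)) := by gcongr
    _ = _ := by ring

/-- What the error analysis uses about the discrete solution `(U, U', W)` and the steady
approximations `R`, `R'`, `Z` of `u`, `u' = u_t`, `w`: the energy identities of the error equation,
and a bound `D` for the errors of the steady approximations and their increments in time. -/
structure Comparison (m : Mesh a b n) (T K D : ℝ) (N : C(ℂ, ℂ)) (u u' w : ℝ → ℝ → ℂ)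
    (U U' W R R' Z : ℝ → PiecewisePoly n) : Prop where
  continuous : ∀ t ∈ Icc 0 T, Continuous (u t)
  norm_le : ∀ t ∈ Icc 0 T, ∀ x, ‖u t x‖ ≤ K
  norm_sub_le : ∀ s ∈ Icc 0 T, ∀ t ∈ Icc 0 T, ∀ x, ‖u t x - u s x‖ ≤ K * |t - s|
  init : polyL2 m (U 0 - R 0) = 0
  hasDeriv : ∀ t ∈ Icc 0 T, HasDerivWithinAt (fun s => polyL2 m (U s - R s))
    (polyL2 m (U' t - R' t)) (Icc 0 T) t
  energy : ∀ t ∈ Icc 0 T, I * ⟪polyL2 m (U t - R t), polyL2 m (U' t - R' t)⟫_ℂ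
    + ((‖polyL2 m (W t - Z t)‖ ^ 2 : ℝ) : ℂ)
    = ⟪polyL2 m (U t - R t), errorRhs m N (u t) (u' t) (U t) (R t) (R' t)⟫_ℂ
  energy_sub : ∀ s ∈ Icc 0 T, ∀ t ∈ Icc 0 T,
    I * ⟪polyL2 m (U t - R t) - polyL2 m (U s - R s),
        polyL2 m (U' t - R' t) - polyL2 m (U' s - R' s)⟫_ℂ
      + ((‖polyL2 m (W t - Z t) - polyL2 m (W s - Z s)‖ ^ 2 : ℝ) : ℂ)
    = ⟪polyL2 m (U t - R t) - polyL2 m (U s - R s),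
        errorRhs m N (u t) (u' t) (U t) (R t) (R' t)
          - errorRhs m N (u s) (u' s) (U s) (R s) (R' s)⟫_ℂ
  steady_u : ∀ t ∈ Icc 0 T, ‖funL2 m (u t) - polyL2 m (R t)‖ ≤ D
  steady_u' : ∀ t ∈ Icc 0 T, ‖funL2 m (u' t) - polyL2 m (R' t)‖ ≤ D
  steady_w : ∀ t ∈ Icc 0 T, ‖funL2 m (w t) - polyL2 m (Z t)‖ ≤ D
  steady_u_sub : ∀ s ∈ Icc 0 T, ∀ t ∈ Icc 0 T, ‖funL2 m (u t) - polyL2 m (R t)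
    - (funL2 m (u s) - polyL2 m (R s))‖ ≤ D * |t - s|
  steady_u'_sub : ∀ s ∈ Icc 0 T, ∀ t ∈ Icc 0 T, ‖funL2 m (u' t) - polyL2 m (R' t)
    - (funL2 m (u' s) - polyL2 m (R' s))‖ ≤ D * |t - s|

variable {m : Mesh a b n} {q : ℕ} {T K : ℝ} {F : ℝ → ℝ} {M : ℝ → ℝ} {u w : ℝ → ℝ → ℂ}
  {U U' W : ℝ → PiecewisePoly n}

/-- The steady problem solved by the exact solution, with the time derivative and the nonlinear
term in place of the fourth space derivative. -/
theorem IsSmoothSolution.funL2_steadyRhs (m : Mesh a b n) (hT : 0 < T)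
    (h : IsSmoothSolution a b T F u w)
    (hF : Continuous (nonlinearTerm F)) {t : ℝ} (ht : t ∈ Icc 0 T) :
    funL2 m (steadyRhs (u t)) = I • funL2 m (u t) - I • funL2 m (timeDeriv T u t)
      - funL2 m (nonlinearTerm F ∘ u t) := by
  have hs : SlabSmooth T u := h.smooth
  have c1 := (hs.contDiff ht).continuous
  have c2 := ((hs.timeDeriv hT).contDiff ht).continuous
  have c3 : Continuous (nonlinearTerm F ∘ u t) := hF.comp c1
  rw [← funL2_smul m I c1, ← funL2_smul m I c2,
    ← funL2_sub m (c1.const_smul I) (c2.const_smul I),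
    ← funL2_sub m ((c1.const_smul I).sub (c2.const_smul I)) c3]
  congr 1
  funext x
  have h1 := h.eq1 t ht x
  have hw : w t = iteratedDeriv 2 (u t) := funext (h.eq2 t ht)
  have h4 : iteratedDeriv 2 (iteratedDeriv 2 (u t)) = iteratedDeriv 4 (u t) := by
    simp only [iteratedDeriv_eq_iterate, ← Function.iterate_add_apply, Nat.reduceAdd]
  rw [hw, h4] at h1
  simp only [steadyRhs, nonlinearTerm, Pi.add_apply, Pi.sub_apply, Pi.smul_apply, smul_eq_mul,
    Function.comp_apply]
  linear_combination h1

variable [NeZero n]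

/-- The energy identity of a weak equation `i v + S u = r`, where `w` is the discrete second
derivative of `u` and `⟪u, S u⟫ = ‖w‖²`. -/
theorem energy_of_weak {u w : PiecewisePoly n} (hu : InVh q u)
    (hw : InVh q w) (h2 : ∀ Ψ, InVh q Ψ → ⟪polyL2 m Ψ, polyL2 m w⟫_ℂ = dgForm m u (conjPP Ψ))
    {v r : CellL2 m} (h1 : ∀ Φ, InVh q Φ →
      I * ⟪polyL2 m Φ, v⟫_ℂ + dgForm m (conjPP Φ) w = ⟪polyL2 m Φ, r⟫_ℂ) :
    I * ⟪polyL2 m u, v⟫_ℂ + ((‖polyL2 m w‖ ^ 2 : ℝ) : ℂ) = ⟪polyL2 m u, r⟫_ℂ := by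
  have h3 := dgForm_conjPP_self m (μ := 0) hw fun Ψ hΨ => by
    rw [inner_zero_right, add_zero]; exact h2 Ψ hΨ
  rw [inner_zero_left, sub_zero] at h3
  rw [← h1 u hu, h3]

/-- Coefficients of degree above `q` vanish at all times, hence so do their derivatives. -/
theorem IsDGSolution.mem_deriv (hT : 0 < T) (h : IsDGSolution m q T F U U' W) {t : ℝ}
    (ht : t ∈ Icc 0 T) : InVh q (U' t) := fun j => by
  rw [Polynomial.natDegree_le_iff_coeff_eq_zero]
  intro k hk
  have h1 := h.time_deriv t ht j k
  have h2 : HasDerivWithinAt (fun s => (U s j).coeff k) 0 (Icc 0 T) t :=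
    (hasDerivWithinAt_const t (Icc 0 T) (0 : ℂ)).congr
      (fun s hs => Polynomial.coeff_eq_zero_of_natDegree_lt ((h.mem_u s hs j).trans_lt hk))
      (Polynomial.coeff_eq_zero_of_natDegree_lt ((h.mem_u t ht j).trans_lt hk))
  exact (uniqueDiffOn_Icc hT t ht).eq_deriv _ h1 h2

theorem IsDGSolution.first_eq (h : IsDGSolution m q T F U U' W)
    (hF : Continuous (nonlinearTerm F)) {t : ℝ} (ht : t ∈ Icc 0 T) {Φ : PiecewisePoly n}
    (hΦ : InVh q Φ) : I * ⟪polyL2 m Φ, polyL2 m (U' t)⟫_ℂ + dgForm m (conjPP Φ) (W t)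
      + ⟪polyL2 m Φ, compL2 m ⟨nonlinearTerm F, hF⟩ (U t)⟫_ℂ = 0 :=
  first_eq_inner (fun j φ hφ => h.eq1 t ht j φ hφ) hΦ

/-- The error `θ = U - R` satisfies the second equation of the scheme exactly and the first one with
right hand side `errorRhs`; it vanishes initially, because the initial values of the scheme are the
steady approximation at time `0`. -/
theorem exists_comparison (hq : 1 ≤ q) (hT : 0 < T) (hF : NonlinearityBound F M)
    (hu : IsSmoothSolution a b T F u w) (hK : DerivBound T (q + 5) K u)
    (hU : IsDGSolution m q T F U U' W) (h0 : IsSteadyDG m q (u 0) (U 0) (W 0)) :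
    ∃ R R' Z, Comparison m T K (8 * Real.sqrt (b - a) * K * m.h ^ (q + 1))
      ⟨nonlinearTerm F, hF.continuous_nonlinearTerm⟩ u (timeDeriv T u) w U U' W R R' Z := by
  have hs : SlabSmooth T u := hu.smooth
  have hs' := hs.timeDeriv hT
  have hF' := hF.continuous_nonlinearTerm
  have hK' : DerivBound T (q + 4) K (timeDeriv T u) := hK.timeDeriv hT hs
  choose R Z hR using fun t => exists_steadyDG m q (funL2 m (steadyRhs (u t)))
  choose R' Z' hR' using fun t => exists_steadyDG m q (funL2 m (steadyRhs (timeDeriv T u t)))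
  obtain ⟨a1, a2, a3⟩ := SteadyDG.curve_error_le hq hT hs hu.periodic (hK.mono (by lia))
    fun t _ => hR t
  obtain ⟨b1, -, b3⟩ := SteadyDG.curve_error_le hq hT hs'
    (fun t ht => periodic_timeDeriv hu.periodic ht) hK' fun t _ => hR' t
  have hsecond : ∀ t ∈ Icc 0 T, ∀ Ψ, InVh q Ψ → ⟪polyL2 m Ψ, polyL2 m (W t - Z t)⟫_ℂ
      = dgForm m (U t - R t) (conjPP Ψ) := fun t ht Ψ hΨ => by
    simp only [map_sub, inner_sub_right, LinearMap.sub_apply]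
    rw [(hU.eq2 t ht).inner_eq hΨ, (hR t).eq2 Ψ hΨ]
  set N : C(ℂ, ℂ) := ⟨nonlinearTerm F, hF'⟩
  have hfirst : ∀ t ∈ Icc 0 T, ∀ Φ, InVh q Φ →
      I * ⟪polyL2 m Φ, polyL2 m (U' t - R' t)⟫_ℂ + dgForm m (conjPP Φ) (W t - Z t)
        = ⟪polyL2 m Φ, errorRhs m N (u t) (timeDeriv T u t) (U t) (R t) (R' t)⟫_ℂ := by
    intro t ht Φ hΦ
    have e1 := hU.first_eq hF' ht hΦ
    have e2 := (hR t).eq1 Φ hΦ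
    rw [hu.funL2_steadyRhs m hT hF' ht] at e2
    simp only [errorRhs, map_sub, inner_sub_right, inner_add_right, inner_smul_right,
      N, ContinuousMap.coe_mk] at e1 e2 ⊢
    linear_combination e1 - e2
  have hmu : ∀ t ∈ Icc 0 T, InVh q (U t - R t) := fun t ht => (hU.mem_u t ht).sub (hR t).mem_u
  have hmw : ∀ t ∈ Icc 0 T, InVh q (W t - Z t) := fun t ht => (hU.mem_w t ht).sub (hR t).mem_w
  refine ⟨R, R', Z, ?_⟩
  refine
    { continuous := fun t ht => (hs.contDiff ht).continuous
      norm_le := fun t ht => hK.norm_le ht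
      norm_sub_le := fun s hs₁ t ht x =>
        (hK.mono (r' := 0 + 1) (by lia)).norm_sub_le hT hs hs₁ ht x
      init := ?_
      hasDeriv := fun t ht => ?_
      energy := fun t ht => energy_of_weak (hmu t ht) (hmw t ht) (hsecond t ht) (hfirst t ht)
      energy_sub := fun s hs₁ t ht => ?_
      steady_u := a1
      steady_u' := b1
      steady_w := fun t ht => by
        rw [show w t = iteratedDeriv 2 (u t) from funext (hu.eq2 t ht)]; exact a2 t ht
      steady_u_sub := a3
      steady_u'_sub := b3 }
  · have h0T : (0 : ℝ) ∈ Icc 0 T := ⟨le_rfl, hT.le⟩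
    have e1 := h0.steadyDG (continuous_steadyRhs (hs.contDiff h0T))
    have e2 := (e1.sub (hR 0)).norm_le
    have e3 : (funL2 m fun x => I * u 0 x + iteratedDeriv 4 (u 0) x)
        - funL2 m (steadyRhs (u 0)) = 0 := sub_self _
    rw [e3, norm_zero] at e2
    exact norm_le_zero_iff.1 e2
  · simp only [map_sub]
    refine (hasDerivWithinAt_polyL2 m ht hU.mem_u (hU.mem_deriv hT ht)
      (hU.time_deriv t ht)).sub ?_
    exact SteadyDG.hasDerivWithinAt hT hs (hK.mono (by lia)) (fun t _ => hR t)
      (fun t _ => hR' t) ht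
  · simp only [← map_sub (polyL2 m)]
    refine energy_of_weak (q := q) ((hmu t ht).sub (hmu s hs₁)) ((hmw t ht).sub (hmw s hs₁))
      (fun Ψ hΨ => ?_) fun Φ hΦ => ?_
    · rw [map_sub (polyL2 m) (W t - Z t), inner_sub_right, hsecond t ht Ψ hΨ, hsecond s hs₁ Ψ hΨ,
        map_sub (dgForm m) (U t - R t), LinearMap.sub_apply]
    · rw [inner_sub_right, ← hfirst t ht Φ hΦ, ← hfirst s hs₁ Φ hΦ,
        map_sub (polyL2 m) (U' t - R' t), inner_sub_right,
        map_sub (dgForm m (conjPP Φ)) (W t - Z t)]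
      ring

end Comparison

/-! ### Error estimates under a bound for the discrete solution -/

/-- Lipschitz constant for the right hand side of the error equation, for solutions bounded by
`R`. -/
def errorLipschitz (M : ℝ → ℝ) (K R : ℝ) : ℝ := nonlinearConst M R * (1 + 2 * R + 2 * K)

/-- The constant of the error estimate for solutions bounded by `R`. -/
def errorConst (M : ℝ → ℝ) (a b T K R : ℝ) : ℝ :=
  3 * ((1 + energyConst T (errorLipschitz M K R) * (errorLipschitz M K R + 2))
    * (8 * Real.sqrt (b - a) * K))

theorem energyConst_nonneg {T Λ : ℝ} (hT : 0 ≤ T) (hΛ : 0 ≤ Λ) : 0 ≤ energyConst T Λ := by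
  unfold energyConst; positivity

theorem errorLipschitz_nonneg (M : ℝ → ℝ) {K R : ℝ} (hK : 0 ≤ K) (hR : 0 ≤ R) :
    0 ≤ errorLipschitz M K R := by
  have := nonlinearConst_nonneg M hR
  unfold errorLipschitz; positivity

theorem errorConst_nonneg (M : ℝ → ℝ) (a b : ℝ) {T K R : ℝ} (hT : 0 ≤ T) (hK : 0 ≤ K)
    (hR : 0 ≤ R) : 0 ≤ errorConst M a b T K R := by
  have h1 := errorLipschitz_nonneg M hK hR
  have h2 := energyConst_nonneg hT h1
  unfold errorConst; positivity

section Estimates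

variable {a b : ℝ} {n : ℕ} {m : Mesh a b n} {T K : ℝ} {F : ℝ → ℝ} {M : ℝ → ℝ}
  {u w : ℝ → ℝ → ℂ} {U U' W : ℝ → PiecewisePoly n} {D Q τ : ℝ} {u' : ℝ → ℝ → ℂ}
  {R R' Z : ℝ → PiecewisePoly n}

namespace Comparison

theorem norm_error_le {N : C(ℂ, ℂ)} (h : Comparison m T K D N u u' w U U' W R R' Z) {t : ℝ}
    (ht : t ∈ Icc 0 T) :
    ‖funL2 m (u t) - polyL2 m (U t)‖ ≤ D + ‖polyL2 m (U t - R t)‖ := by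
  have e : funL2 m (u t) - polyL2 m (U t)
      = (funL2 m (u t) - polyL2 m (R t)) - polyL2 m (U t - R t) := by rw [map_sub]; abel
  rw [e]
  exact (_root_.norm_sub_le _ _).trans (by linarith [h.steady_u t ht])

theorem norm_errorRhs_le (hF : NonlinearityBound F M)
    (h : Comparison m T K D ⟨nonlinearTerm F, hF.continuous_nonlinearTerm⟩ u u' w U U' W R R' Z)
    (hK : 0 ≤ K) (hKQ : K ≤ Q) {t : ℝ} (ht : t ∈ Icc 0 T)
    (hQ : ∀ j, ∀ x ∈ Icc (m.left j) (m.right j), ‖(U t j).eval (x : ℂ)‖ ≤ Q) :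
    ‖errorRhs m ⟨nonlinearTerm F, hF.continuous_nonlinearTerm⟩ (u t) (u' t) (U t) (R t) (R' t)‖
      ≤ (errorLipschitz M K Q + 2) * D
        + errorLipschitz M K Q * ‖polyL2 m (U t - R t)‖ := by
  have hQ0 : 0 ≤ Q := hK.trans hKQ
  have hL := nonlinearConst_nonneg M hQ0
  have h1 := norm_funL2_comp_sub_compL2_le m
    (N := ⟨nonlinearTerm F, hF.continuous_nonlinearTerm⟩) hL (hF.incrementLipschitz hQ0)
    (h.continuous t ht) (v := U t) (fun x => (h.norm_le t ht x).trans hKQ) hQ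
  have h2 := h.norm_error_le ht
  have hle : nonlinearConst M Q ≤ errorLipschitz M K Q :=
    le_mul_of_one_le_right hL (by linarith)
  have hΛ := errorLipschitz_nonneg M hK hQ0
  have h3 : nonlinearConst M Q * ‖funL2 m (u t) - polyL2 m (U t)‖
      ≤ errorLipschitz M K Q * (D + ‖polyL2 m (U t - R t)‖) := by gcongr
  have h4 := h.steady_u t ht
  have h5 := h.steady_u' t ht
  refine (norm_add_le _ _).trans ?_
  have h6 := _root_.norm_sub_le (I • (funL2 m (u' t) - polyL2 m (R' t)))
    (I • (funL2 m (u t) - polyL2 m (R t)))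
  rw [norm_smul, norm_smul, Complex.norm_I, one_mul, one_mul] at h6
  linarith

theorem norm_errorRhs_sub_le (hF : NonlinearityBound F M)
    (h : Comparison m T K D ⟨nonlinearTerm F, hF.continuous_nonlinearTerm⟩ u u' w U U' W R R' Z)
    (hK : 0 ≤ K) (hKQ : K ≤ Q)
    (hQ : ∀ t ∈ Icc 0 T, ∀ j, ∀ x ∈ Icc (m.left j) (m.right j), ‖(U t j).eval (x : ℂ)‖ ≤ Q)
    {s t : ℝ} (hs : s ∈ Icc 0 T) (ht : t ∈ Icc 0 T) :
    ‖errorRhs m ⟨nonlinearTerm F, hF.continuous_nonlinearTerm⟩ (u t) (u' t) (U t) (R t) (R' t)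
      - errorRhs m ⟨nonlinearTerm F, hF.continuous_nonlinearTerm⟩ (u s) (u' s) (U s) (R s) (R' s)‖
      ≤ |t - s| * ((errorLipschitz M K Q + 2) * D
          + errorLipschitz M K Q * ‖polyL2 m (U s - R s)‖)
        + errorLipschitz M K Q * ‖polyL2 m (U t - R t) - polyL2 m (U s - R s)‖ := by
  have hQ0 : 0 ≤ Q := hK.trans hKQ
  have hL := nonlinearConst_nonneg M hQ0
  set N : C(ℂ, ℂ) := ⟨nonlinearTerm F, hF.continuous_nonlinearTerm⟩ with hN
  have h1 := norm_increment_funL2_comp_sub_compL2_le m (N := N) (κ := K * |t - s|) hL hQ0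
    (by positivity) (hF.incrementLipschitz hQ0) (h.continuous t ht) (h.continuous s hs)
    (fun x => (h.norm_le t ht x).trans hKQ) (fun x => (h.norm_le s hs x).trans hKQ)
    (hQ t ht) (hQ s hs) (h.norm_sub_le s hs t ht)
  have h2 := h.norm_error_le hs
  set δθ := ‖polyL2 m (U t - R t) - polyL2 m (U s - R s)‖
  have h3 : ‖funL2 m (u t) - polyL2 m (U t) - (funL2 m (u s) - polyL2 m (U s))‖
      ≤ D * |t - s| + δθ := by
    have e : funL2 m (u t) - polyL2 m (U t) - (funL2 m (u s) - polyL2 m (U s))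
        = (funL2 m (u t) - polyL2 m (R t) - (funL2 m (u s) - polyL2 m (R s)))
          - (polyL2 m (U t - R t) - polyL2 m (U s - R s)) := by simp only [map_sub]; abel
    rw [e]
    exact (_root_.norm_sub_le _ _).trans (by linarith [h.steady_u_sub s hs t ht])
  have e : errorRhs m N (u t) (u' t) (U t) (R t) (R' t)
      - errorRhs m N (u s) (u' s) (U s) (R s) (R' s)
      = (funL2 m (N ∘ u t) - compL2 m N (U t) - (funL2 m (N ∘ u s) - compL2 m N (U s)))
        + (I • (funL2 m (u' t) - polyL2 m (R' t) - (funL2 m (u' s) - polyL2 m (R' s)))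
          - I • (funL2 m (u t) - polyL2 m (R t) - (funL2 m (u s) - polyL2 m (R s)))) := by
    unfold errorRhs; module
  rw [e]
  refine (norm_add_le _ _).trans ?_
  have h6 := _root_.norm_sub_le
    (I • (funL2 m (u' t) - polyL2 m (R' t) - (funL2 m (u' s) - polyL2 m (R' s))))
    (I • (funL2 m (u t) - polyL2 m (R t) - (funL2 m (u s) - polyL2 m (R s))))
  rw [norm_smul, norm_smul, Complex.norm_I, one_mul, one_mul] at h6
  have h7 := h.steady_u_sub s hs t ht
  have h8 := h.steady_u'_sub s hs t ht
  set L := nonlinearConst M Q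
  have hΛ : errorLipschitz M K Q = L * (1 + 2 * Q + 2 * K) := rfl
  set θs := ‖polyL2 m (U s - R s)‖
  have hθs : 0 ≤ θs := norm_nonneg _
  have hδθ : 0 ≤ δθ := norm_nonneg _
  have i1 : L * (1 + 2 * Q) * ‖funL2 m (u t) - polyL2 m (U t)
      - (funL2 m (u s) - polyL2 m (U s))‖ ≤ L * (1 + 2 * Q) * (D * |t - s| + δθ) := by gcongr
  have i2 : 2 * L * (K * |t - s|) * ‖funL2 m (u s) - polyL2 m (U s)‖
      ≤ 2 * L * (K * |t - s|) * (D + θs) := by gcongr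
  have i3 : 0 ≤ L * K * δθ := by positivity
  have i4 : 0 ≤ L * (1 + 2 * Q) * |t - s| * θs := by positivity
  rw [hΛ]
  nlinarith

theorem norm_sub_steady_le (hF : NonlinearityBound F M)
    (h : Comparison m T K D ⟨nonlinearTerm F, hF.continuous_nonlinearTerm⟩ u u' w U U' W R R' Z)
    (hK : 0 ≤ K) (hD : 0 ≤ D) (hKQ : K ≤ Q) (hτ : τ ∈ Icc 0 T)
    (hQ : ∀ t ∈ Icc 0 τ, ∀ j, ∀ x ∈ Icc (m.left j) (m.right j), ‖(U t j).eval (x : ℂ)‖ ≤ Q)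
    {t : ℝ} (ht : t ∈ Icc 0 τ) :
    ‖polyL2 m (U t - R t)‖ ≤ energyConst T (errorLipschitz M K Q)
      * ((errorLipschitz M K Q + 2) * D) := by
  have hsub : Icc 0 τ ⊆ Icc 0 T := Icc_subset_Icc_right hτ.2
  have hΛ := errorLipschitz_nonneg M hK (hK.trans hKQ)
  set Λ := errorLipschitz M K Q
  have h1 := norm_le_mul_of_energy_identity (τ := τ) (δ := (Λ + 2) * D) (Λ := Λ) (by positivity) hΛ
    (fun t ht => (h.hasDeriv t (hsub ht)).mono hsub) (fun t ht => h.energy t (hsub ht))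
    (fun t ht => h.norm_errorRhs_le hF hK hKQ (hsub ht) (hQ t ht)) t ht
  rw [h.init, norm_zero, zero_add] at h1
  have htT := hsub ht
  have hT : 0 ≤ T := htT.1.trans htT.2
  have h2 : Real.exp (Λ * t) ≤ Real.exp (Λ * T) :=
    Real.exp_le_exp.2 (mul_le_mul_of_nonneg_left htT.2 hΛ)
  have h3 : T * Real.exp (Λ * T) ≤ energyConst T Λ := by
    have e1 : 0 ≤ Λ * (T * Real.exp (Λ * T)) := by positivity
    have e2 : 0 ≤ (Real.exp (Λ * T) + (1 + Λ * (T * Real.exp (Λ * T))) * T) * Real.exp (Λ * T) := by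
      positivity
    unfold energyConst; nlinarith
  calc _ ≤ (Λ + 2) * D * t * Real.exp (Λ * t) := h1
    _ ≤ (Λ + 2) * D * T * Real.exp (Λ * T) := by
        have := htT.2
        gcongr
    _ = T * Real.exp (Λ * T) * ((Λ + 2) * D) := by ring
    _ ≤ _ := by gcongr

theorem error_le (hT : 0 < T) (hF : NonlinearityBound F M)
    (h : Comparison m T K D ⟨nonlinearTerm F, hF.continuous_nonlinearTerm⟩ u u' w U U' W R R' Z)
    (hK : 0 ≤ K) (hD : 0 ≤ D) (hKQ : K ≤ Q)
    (hQ : ∀ t ∈ Icc 0 T, ∀ j, ∀ x ∈ Icc (m.left j) (m.right j), ‖(U t j).eval (x : ℂ)‖ ≤ Q)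
    {t : ℝ} (ht : t ∈ Icc 0 T) :
    ‖funL2 m (u t) - polyL2 m (U t)‖ + ‖funL2 m (w t) - polyL2 m (W t)‖
      + ‖funL2 m (u' t) - polyL2 m (U' t)‖
      ≤ 3 * ((1 + energyConst T (errorLipschitz M K Q) * (errorLipschitz M K Q + 2)) * D) := by
  have hΛ := errorLipschitz_nonneg M hK (hK.trans hKQ)
  obtain ⟨h1, h2, h3⟩ := norm_le_of_energy_identities hT
    (δ := (errorLipschitz M K Q + 2) * D) (Λ := errorLipschitz M K Q) (by positivity) hΛ
    h.hasDeriv h.energy h.energy_sub h.init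
    (fun t ht => h.norm_errorRhs_le hF hK hKQ ht (hQ t ht))
    (fun s hs t ht => h.norm_errorRhs_sub_le hF hK hKQ hQ hs ht) t ht
  have e1 := h.norm_error_le ht
  have e2 : ‖funL2 m (w t) - polyL2 m (W t)‖ ≤ D + ‖polyL2 m (W t - Z t)‖ := by
    have e : funL2 m (w t) - polyL2 m (W t)
        = (funL2 m (w t) - polyL2 m (Z t)) - polyL2 m (W t - Z t) := by rw [map_sub]; abel
    rw [e]
    exact (_root_.norm_sub_le _ _).trans (by linarith [h.steady_w t ht])
  have e3 : ‖funL2 m (u' t) - polyL2 m (U' t)‖ ≤ D + ‖polyL2 m (U' t - R' t)‖ := by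
    have e : funL2 m (u' t) - polyL2 m (U' t)
        = (funL2 m (u' t) - polyL2 m (R' t)) - polyL2 m (U' t - R' t) := by rw [map_sub]; abel
    rw [e]
    exact (_root_.norm_sub_le _ _).trans (by linarith [h.steady_u' t ht])
  nlinarith

end Comparison

end Estimates

/-! ### Bounds for the discrete solution -/

section Bounds

variable {a b : ℝ} {n : ℕ} {m : Mesh a b n} {q : ℕ} {T K β : ℝ} {F : ℝ → ℝ}
  {u w : ℝ → ℝ → ℂ} {U U' W : ℝ → PiecewisePoly n}

theorem inner_polyL2_compL2_im (m : Mesh a b n) (hF : Continuous (nonlinearTerm F))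
    (v : PiecewisePoly n) : (⟪polyL2 m v, compL2 m ⟨nonlinearTerm F, hF⟩ v⟫_ℂ).im = 0 := by
  have h : ⟪polyL2 m v, compL2 m ⟨nonlinearTerm F, hF⟩ v⟫_ℂ
      = ((∑ j, ∫ x in m.left j..m.right j, ‖(v j).eval (x : ℂ)‖ ^ 2
        * deriv F (‖(v j).eval (x : ℂ)‖ ^ 2) : ℝ) : ℂ) := by
    rw [polyL2_eq, compL2, inner_toL2]
    push_cast
    refine Finset.sum_congr rfl fun j _ => ?_
    rw [← intervalIntegral.integral_ofReal]
    refine intervalIntegral.integral_congr fun x _ => ?_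
    simp only [ContinuousMap.comp_apply, ContinuousMap.coe_mk, polyC_apply, nonlinearTerm]
    rw [← mul_assoc, Complex.conj_mul']
    push_cast
    rfl
  rw [h, Complex.ofReal_im]

theorem l2Error_add_eq (hT : 0 < T) (hu : IsSmoothSolution a b T F u w) {t : ℝ}
    (ht : t ∈ Icc 0 T) :
    l2Error m (u t) (U t) = ‖funL2 m (u t) - polyL2 m (U t)‖ ∧
      l2Error m (w t) (W t) = ‖funL2 m (w t) - polyL2 m (W t)‖ ∧
      l2Error m (timeDeriv T u t) (U' t) = ‖funL2 m (timeDeriv T u t) - polyL2 m (U' t)‖ := by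
  have hs : SlabSmooth T u := hu.smooth
  refine ⟨l2Error_eq m (hs.contDiff ht).continuous _, l2Error_eq m ?_ _,
    l2Error_eq m ((hs.timeDeriv hT).contDiff ht).continuous _⟩
  rw [show w t = iteratedDeriv 2 (u t) from funext (hu.eq2 t ht)]
  exact (hs.contDiff ht).continuous_iteratedDeriv 2 ENat.LEInfty.out

variable [NeZero n]

/-- The scheme does not increase the `L²` norm, because the nonlinear term and the form of the
scheme are real when tested with the solution. -/
theorem IsDGSolution.norm_le (hT : 0 < T) (h : IsDGSolution m q T F U U' W)
    (hF : Continuous (nonlinearTerm F)) {t : ℝ} (ht : t ∈ Icc 0 T) :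
    ‖polyL2 m (U t)‖ ≤ ‖polyL2 m (U 0)‖ := by
  have := norm_le_of_re_inner_le (θ := fun t => polyL2 m (U t)) (θ' := fun t => polyL2 m (U' t))
    (A := 0) (L := 0) le_rfl le_rfl
    (fun t ht => hasDerivWithinAt_polyL2 m ht h.mem_u (h.mem_deriv hT ht) (h.time_deriv t ht))
    (fun t ht => by
      have e1 := energy_of_weak (h.mem_u t ht) (h.mem_w t ht)
        (fun Ψ hΨ => (h.eq2 t ht).inner_eq hΨ) (v := polyL2 m (U' t))
        (r := -compL2 m ⟨nonlinearTerm F, hF⟩ (U t)) (fun Φ hΦ => by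
          rw [inner_neg_right]
          linear_combination h.first_eq hF ht hΦ)
      have e2 := congrArg Complex.im e1
      rw [inner_neg_right, Complex.neg_im, inner_polyL2_compL2_im] at e2
      simp only [Complex.add_im, Complex.mul_im, Complex.I_re, Complex.I_im, Complex.ofReal_im,
        zero_mul, one_mul, zero_add, add_zero, neg_zero] at e2
      rw [e2]; simp) t ht
  simpa using this

/-- The inverse inequality on a cell of a quasi-uniform mesh, in terms of the mesh size. -/
theorem norm_eval_sq_le {Ci : ℝ} (hCi : 0 ≤ Ci) (hinv : ∀ l r : ℝ, l < r → ∀ p : ℂ[X],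
    p.natDegree ≤ q → ∀ x ∈ Icc l r,
      ‖p.eval (x : ℂ)‖ ^ 2 ≤ Ci / (r - l) * ∫ x in l..r, ‖p.eval (x : ℂ)‖ ^ 2)
    (hβ : m.h / m.hmin < β) {p : ℂ[X]} (hp : p.natDegree ≤ q) {j : Fin n} {x : ℝ}
    (hx : x ∈ Icc (m.left j) (m.right j)) {S : ℝ}
    (hS : ∫ x in m.left j..m.right j, ‖p.eval (x : ℂ)‖ ^ 2 ≤ S) :
    ‖p.eval (x : ℂ)‖ ^ 2 ≤ Ci * β / m.h * S := by
  have hlen := m.len_pos j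
  have hS0 : 0 ≤ S := (intervalIntegral.integral_nonneg (m.left_lt_right j).le
    fun x _ => by positivity).trans hS
  have h1 := m.h_le_mul_len hβ j
  have hh := m.h_pos
  refine (hinv _ _ (m.left_lt_right j) p hp x hx).trans ?_
  change Ci / m.len j * _ ≤ _
  have h2 : Ci / m.len j ≤ Ci * β / m.h := by
    rw [div_le_div_iff₀ hlen hh]
    nlinarith
  exact mul_le_mul h2 hS (intervalIntegral.integral_nonneg (m.left_lt_right j).le
    fun x _ => by positivity) ((div_nonneg hCi hlen.le).trans h2)

/-- An `L²` error of size `h` implies a pointwise bound on fine meshes: on each cell the discrete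
solution is compared with a constant, to which the inverse inequality applies. -/
theorem norm_eval_le_add_one {Ci : ℝ} (hCi : 0 ≤ Ci) (hinv : ∀ l r : ℝ, l < r → ∀ p : ℂ[X],
    p.natDegree ≤ q → ∀ x ∈ Icc l r,
      ‖p.eval (x : ℂ)‖ ^ 2 ≤ Ci / (r - l) * ∫ x in l..r, ‖p.eval (x : ℂ)‖ ^ 2)
    (hβ : m.h / m.hmin < β) {g : ℝ → ℂ} (hg : ContDiff ℝ ∞ g) (hgK : ∀ x, ‖g x‖ ≤ K)
    (hgK' : ∀ x, ‖deriv g x‖ ≤ K) {v : PiecewisePoly n} (hv : InVh q v)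
    (he : ‖funL2 m g - polyL2 m v‖ ≤ m.h)
    (hsmall : 2 * Ci * |β| * (1 + K ^ 2 * (b - a)) * m.h ≤ 1) (j : Fin n) {x : ℝ}
    (hx : x ∈ Icc (m.left j) (m.right j)) : ‖(v j).eval (x : ℂ)‖ ≤ K + 1 := by
  have hh := m.h_pos
  have hK : 0 ≤ K := (norm_nonneg _).trans (hgK x)
  set x₀ := m.left j
  set p : ℂ[X] := v j - Polynomial.C (g x₀)
  have hp : p.natDegree ≤ q :=
    (Polynomial.natDegree_sub_le _ _).trans (max_le (hv j) (by simp))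
  have hgc := hg.continuous
  have hS : ∫ y in m.left j..m.right j, ‖p.eval (y : ℂ)‖ ^ 2
      ≤ 2 * m.h ^ 2 * (1 + K ^ 2 * (b - a)) := by
    have h1 : ∫ y in m.left j..m.right j, ‖p.eval (y : ℂ)‖ ^ 2
        ≤ ∫ y in m.left j..m.right j, (2 * ‖g y - (v j).eval (y : ℂ)‖ ^ 2
          + 2 * (K * m.h) ^ 2) := by
      refine intervalIntegral.integral_mono_on (m.left_lt_right j).le
        (Continuous.intervalIntegrable (by fun_prop) _ _)
        (Continuous.intervalIntegrable (by fun_prop) _ _) fun y hy => ?_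
      have e : p.eval (y : ℂ) = (g y - g x₀) - (g y - (v j).eval (y : ℂ)) := by simp [p]
      have i1 : ‖g y - g x₀‖ ≤ K * m.h := by
        refine (Convex.norm_image_sub_le_of_norm_deriv_le (s := univ)
          (fun z _ => hg.differentiable (by simp) z) (fun z _ => hgK' z) convex_univ
          (mem_univ x₀) (mem_univ y)).trans ?_
        have := m.len_le_h j
        rw [Real.norm_of_nonneg (sub_nonneg.2 hy.1)]
        refine mul_le_mul_of_nonneg_left ?_ hK
        exact (sub_le_sub_right hy.2 _).trans this
      have i2 : ‖p.eval (y : ℂ)‖ ≤ K * m.h + ‖g y - (v j).eval (y : ℂ)‖ := by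
        rw [e]; exact (norm_sub_le _ _).trans (by linarith)
      refine (pow_le_pow_left₀ (norm_nonneg _) i2 2).trans ?_
      nlinarith [sq_nonneg (K * m.h - ‖g y - (v j).eval (y : ℂ)‖)]
    have h2 : ∫ y in m.left j..m.right j, ‖g y - (v j).eval (y : ℂ)‖ ^ 2 ≤ m.h ^ 2 := by
      have := integral_norm_sq_le_norm_sq_toL2 m
        ((fun _ => ⟨g, hgc⟩) - fun j => polyC (v j)) j
      rw [map_sub, ← polyL2_eq, ← funL2_eq m hgc] at this
      exact this.trans (pow_le_pow_left₀ (norm_nonneg _) he 2)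
    have h3 : m.right j - m.left j ≤ b - a := (m.len_le_h j).trans m.h_le
    rw [intervalIntegral.integral_add (Continuous.intervalIntegrable (by fun_prop) _ _)
      (Continuous.intervalIntegrable (by fun_prop) _ _), intervalIntegral.integral_const_mul,
      intervalIntegral.integral_const, smul_eq_mul] at h1
    have h4 : (m.right j - m.left j) * (2 * (K * m.h) ^ 2) ≤ (b - a) * (2 * (K * m.h) ^ 2) := by
      gcongr
    nlinarith
  have h1 := norm_eval_sq_le hCi hinv hβ hp hx hS
  have h2 : ‖p.eval (x : ℂ)‖ ^ 2 ≤ 1 := by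
    have hba : 0 ≤ b - a := m.h_pos.le.trans m.h_le
    refine h1.trans (le_trans ?_ hsmall)
    have e : Ci * β / m.h * (2 * m.h ^ 2 * (1 + K ^ 2 * (b - a)))
        = 2 * Ci * β * (1 + K ^ 2 * (b - a)) * m.h := by field_simp
    rw [e]
    have := le_abs_self β
    gcongr
  have h3 : ‖p.eval (x : ℂ)‖ ≤ 1 := by
    by_contra! hlt; nlinarith
  have e : (v j).eval (x : ℂ) = g x₀ + p.eval (x : ℂ) := by simp [p]
  rw [e]
  exact (norm_add_le _ _).trans (add_le_add (hgK x₀) h3)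

end Bounds

end

theorem mainTheorem2 (q : ℕ) (hq : 1 ≤ q) (a b T β K : ℝ) (M : ℝ → ℝ)
    (hab : a < b) (hT : 0 < T) :
    ∃ C > 0, ∃ h₀ > 0,
      ∀ (F : ℝ → ℝ) (u w : ℝ → ℝ → ℂ),
        NonlinearityBound F M → IsSmoothSolution a b T F u w → DerivBound T (q + 5) K u →
        ∀ (n : ℕ) [NeZero n] (m : Mesh a b n), m.h / m.hmin < β →
        ∀ uh uht wh : ℝ → PiecewisePoly n,
          IsDGSolution m q T F uh uht wh → IsSteadyDG m q (u 0) (uh 0) (wh 0) →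
          (∀ t ∈ Icc 0 T,
            l2Error m (u t) (uh t) + l2Error m (w t) (wh t)
              + l2Error m (timeDeriv T u t) (uht t) ≤ C * m.h ^ (q + 1)) ∧
          (m.h ≤ h₀ → ∀ t ∈ Icc 0 T,
            l2Error m (u t) (uh t) + l2Error m (timeDeriv T u t) (uht t) ≤ m.h) := by
  have h0T : (0 : ℝ) ∈ Icc 0 T := ⟨le_rfl, hT.le⟩
  rcases lt_or_ge K 0 with hK | hK
  · -- A negative bound is impossible, since it would bound a norm.
    refine ⟨1, one_pos, 1, one_pos, fun F u w _ _ hb => ?_⟩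
    exact absurd ((norm_nonneg _).trans (hb.norm_le h0T 0)) (not_le.2 hK)
  have hba : 0 ≤ b - a := sub_nonneg.2 hab.le
  obtain ⟨Ci, hCi, hinv⟩ := exists_inverse_inequality q
  -- On meshes with `h ≤ h₀` a continuation argument bounds the discrete solution by `K + 1`; on
  -- the others the conserved `L²` norm and the inverse inequality bound it by `Q`.
  set C₁ := errorConst M a b T K (K + 1) with hC₁
  have hC₁0 : 0 ≤ C₁ := errorConst_nonneg M a b hT.le hK (by linarith)
  set B := 2 * Ci * |β| * (1 + K ^ 2 * (b - a)) with hB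
  have hB0 : 0 ≤ B := by positivity
  set h₀ := 1 / (2 * (C₁ + B + 1)) with hh₀
  have hh₀0 : 0 < h₀ := by positivity
  set Q := K + Real.sqrt (Ci * |β| / h₀ * (2 * K * Real.sqrt (b - a)) ^ 2) with hQdef
  have hKQ : K ≤ Q := le_add_of_nonneg_right (Real.sqrt_nonneg _)
  set C₂ := errorConst M a b T K Q with hC₂
  have hC₂0 : 0 ≤ C₂ := errorConst_nonneg M a b hT.le hK (hK.trans hKQ)
  refine ⟨C₁ + C₂ + 1, by positivity, h₀, hh₀0, ?_⟩
  intro F u w hF hu hb n _ m hβ uh uht wh hU h0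
  have hh := m.h_pos
  have hs : SlabSmooth T u := hu.smooth
  have hFc := hF.continuous_nonlinearTerm
  obtain ⟨R, R', Z, hcmp⟩ := exists_comparison hq hT hF hu hb hU h0
  set D := 8 * Real.sqrt (b - a) * K * m.h ^ (q + 1) with hD
  have hD0 : 0 ≤ D := by positivity
  have hconst : ∀ S, 3 * ((1 + energyConst T (errorLipschitz M K S) * (errorLipschitz M K S + 2))
      * D) = errorConst M a b T K S * m.h ^ (q + 1) := fun S => by
    rw [hD, errorConst]; ring
  -- The two parts of the conclusion follow from a bound for the discrete solution.
  have hmain : ∀ S, K ≤ S → (∀ t ∈ Icc 0 T, ∀ j, ∀ x ∈ Icc (m.left j) (m.right j),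
      ‖(uh t j).eval (x : ℂ)‖ ≤ S) → ∀ t ∈ Icc 0 T, l2Error m (u t) (uh t)
        + l2Error m (w t) (wh t) + l2Error m (timeDeriv T u t) (uht t)
        ≤ errorConst M a b T K S * m.h ^ (q + 1) := by
    intro S hKS hS t ht
    obtain ⟨e1, e2, e3⟩ := l2Error_add_eq (m := m) (U := uh) (U' := uht) (W := wh) hT hu ht
    rw [e1, e2, e3, ← hconst]
    exact hcmp.error_le hT hF hK hD0 hKS hS ht
  have hpow : 0 ≤ m.h ^ (q + 1) := by positivity
  rcases le_or_gt m.h h₀ with hle | hgt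
  · have hden : (C₁ + B + 1) * m.h ≤ 1 / 2 := by
      rw [hh₀, le_div_iff₀ (by positivity)] at hle
      linarith
    have hC₁h : C₁ * m.h < 1 / 2 := by nlinarith [mul_nonneg hB0 hh.le]
    have hBh : B * m.h ≤ 1 := by nlinarith [mul_nonneg hC₁0 hh.le]
    have hh1 : m.h ≤ 1 := by nlinarith [mul_nonneg hB0 hh.le, mul_nonneg hC₁0 hh.le]
    have hpow_le : m.h ^ (q + 1) ≤ m.h * m.h := by
      rw [← sq]
      exact pow_le_pow_of_le_one hh.le hh1 (by lia)
    have hC₁pow : C₁ * m.h ^ (q + 1) < m.h / 2 := by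
      calc C₁ * m.h ^ (q + 1) ≤ C₁ * (m.h * m.h) := by gcongr
        _ = C₁ * m.h * m.h := by ring
        _ < 1 / 2 * m.h := by gcongr
        _ = m.h / 2 := by ring
    set Λ := errorLipschitz M K (K + 1) with hΛ
    have hΛ0 : 0 ≤ Λ := errorLipschitz_nonneg M hK (by linarith)
    have hE0 : 0 ≤ energyConst T Λ := energyConst_nonneg hT.le hΛ0
    have hC₁D : 3 * ((1 + energyConst T Λ * (Λ + 2)) * D) = C₁ * m.h ^ (q + 1) := hconst (K + 1)
    have hpos : 0 ≤ energyConst T Λ * (Λ + 2) * D := by positivity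
    have hsup : ∀ t ∈ Icc 0 T, ‖polyL2 m (uh t - R t)‖ ≤ m.h / 2 →
        ∀ j, ∀ x ∈ Icc (m.left j) (m.right j), ‖(uh t j).eval (x : ℂ)‖ ≤ K + 1 := by
      intro t ht hθ j x hx
      have he : ‖funL2 m (u t) - polyL2 m (uh t)‖ ≤ m.h := by
        have := hcmp.norm_error_le ht
        linarith
      refine norm_eval_le_add_one hCi.le hinv hβ (hs.contDiff ht) (fun x => hb.norm_le ht x)
        (fun x => ?_) (hU.mem_u t ht) he hBh j hx
      exact (DerivBound.spaceDeriv (r := 0) hT hs (hb.mono (by lia))).norm_le ht x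
    have hboot := le_of_bootstrap (X := fun t => ‖polyL2 m (uh t - R t)‖) (T := T) (c := m.h / 2)
      (fun t ht => (hcmp.hasDeriv t ht).continuousWithinAt.norm)
      (by simp only [hcmp.init, norm_zero]; positivity)
      (fun τ hτ hle => by
        have hsub : Icc 0 τ ⊆ Icc 0 T := Icc_subset_Icc_right hτ.2
        have := hcmp.norm_sub_steady_le hF hK hD0 (by linarith : K ≤ K + 1) hτ
          (fun t ht => hsup t (hsub ht) (hle t ht)) (right_mem_Icc.2 hτ.1)
        rw [← hΛ] at this
        refine lt_of_le_of_lt (this.trans ?_) hC₁pow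
        rw [← hC₁D]
        nlinarith)
    have hfin := hmain (K + 1) (by linarith) fun t ht => hsup t ht (hboot t ht)
    refine ⟨fun t ht => (hfin t ht).trans ?_, fun _ t ht => ?_⟩
    · gcongr
      linarith
    · have h1 := hfin t ht
      have h2 : 0 ≤ l2Error m (w t) (wh t) := Real.sqrt_nonneg _
      linarith
  · refine ⟨fun t ht => (hmain Q hKQ (fun t ht j x hx => ?_) t ht).trans ?_,
      fun h => absurd h (not_le.2 hgt)⟩
    · have hinit : ‖polyL2 m (uh 0)‖ ≤ 2 * K * Real.sqrt (b - a) := by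
        have c0 := continuous_steadyRhs (hs.contDiff h0T)
        refine ((h0.steadyDG c0).norm_le).trans
          (norm_funL2_le m c0 (by positivity) fun x => ?_)
        refine (norm_add_le _ _).trans ?_
        have h1 := hb.norm_le h0T x
        have h4 := (DerivBound.iterate_spaceDeriv (r := 0) hT hs 4 (hb.mono (by lia))).norm_le
          h0T x
        rw [iteratedDeriv_eq_iterate_spaceDeriv, Pi.smul_apply, norm_smul, Complex.norm_I, one_mul]
        linarith
      have hnorm := (hU.norm_le hT hFc ht).trans hinit
      have hcell := (integral_norm_sq_le_norm_sq_toL2 m (fun j => polyC (uh t j)) j).trans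
        (pow_le_pow_left₀ (norm_nonneg _) hnorm 2)
      have h1 := norm_eval_sq_le hCi.le hinv hβ (hU.mem_u t ht j) hx hcell
      have h2 : Ci * β / m.h ≤ Ci * |β| / h₀ := by
        have := le_abs_self β
        calc Ci * β / m.h ≤ Ci * |β| / m.h := by gcongr
          _ ≤ Ci * |β| / h₀ := by gcongr
      have h3 := Real.le_sqrt_of_sq_le (h1.trans (mul_le_mul_of_nonneg_right h2 (sq_nonneg _)))
      exact h3.trans (le_add_of_nonneg_left hK)
    · gcongr
      linarith
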